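/- **Conventions.** A quantum query algorithm with $q$ queries starts in a computational basis state of a query register together with a finite workspace, applies unitaries $U_0,\dots,U_q$ (independent of the input function) interleaved with $q$ applications of the oracle to the query register, measures in the computational basis, and outputs a function of the outcome. For $f:\mathbb F_2^n\to\mathbb F_2$ the oracle is $|x\rangle|b\rangle\mapsto|x\rangle|b+f(x)\rangle$; for $f:\mathbb F_p^n\to\mathbb C$ with values of modulus one it is $|x\rangle\mapsto f(x)|x\rangle$. Let $\delta(f,g)=2^{-n}|\{x:f(x)\ne g(x)\}|$ for $f,g:\mathbb F_2^n\to\mathbb F_2$, and let $\delta_{\mathrm{RM}_2}(f)$ be the minimum of $\delta(f,g)$ over all polynomials $g$ of degree at most $2$. For $p$ prime put $\omega_p=e^{2\pi i/p}$ and, for $f:\mathbb F_p^n\to\mathbb C$, let $\widehat f(y)=\mathbb E_x f(x)\omega_p^{-\langle x,y\rangle}$, $\Delta_hf(x)=f(x+h)\overline{f(x)}$ and $\|f\|_{U^3}=(\mathbb E_{x,h_1,h_2,h_3}\Delta_{h_3}\Delta_{h_2}\Delta_{h_1}f(x))^{1/8}$. A polynomial phase function is a function $f(x)=\omega_p^{P(x)}$,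 where $P$ is a polynomial over $\mathbb F_p$ in $n$ variables of degree at most $p-1$ in each variable. **Theorem.** (1) There is an absolute constant $C>0$ such that for every $\varepsilon>0$ the following holds with $\eta=\exp(-1/\varepsilon^{C})$. There is a constant $K_\varepsilon>0$ depending only on $\varepsilon$ and, for each $n$, a quantum query algorithm, making at most $K_\varepsilon\, n\log n$ queries when $n\ge 2$, that for every $f:\mathbb F_2^n\to\mathbb F_2$ with $\delta_{\mathrm{RM}_2}(f)\le\frac12-\varepsilon$ returns, with probability at least $2/3$, a polynomial $g$ over $\mathbb F_2$ in $n$ variables of degree at most $2$ with $\delta(f,g)\le\frac12-\eta$. (2) For every prime $p$ there is an integer $K\ge1$ such that for every $\gamma>0$ and every $n$ there is a quantum query algorithm, making at most $K\gamma^{-K}\,n\log n$ queries when $n\ge2$, that for every polynomial phase function $f:\mathbb F_p^n\to\mathbb C$ with $\|f\|_{U^3}\ge\gamma$ returns, with probability at least $\gamma^{K}/K$, a matrix $M\in\mathbb F_p^{n\times n}$ with $$\mathbb E_{h\in\mathbb F_p^n}\big|\widehat{\Delta_hf}(Mh)\big|^2\ \ge\ \exp(-K\gamma^{-K}).$$ 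-/

import Mathlib

open scoped BigOperators Matrix Kronecker

noncomputable section

namespace QuadraticDecoding

/-! ### Quantum query algorithms -/

/-- A quantum query algorithm with query register indexed by `Q` and outputs in `R`.
Its state space is `ℂ^Q ⊗ ℂ^W` for a finite workspace `W`. It starts in the computational basis
state `init`, applies `U 0, O, U 1, O, …, O, U queries` with `O` the oracle, measures in the
computational basis and maps the outcome to an element of `R`. Only `U 0, …, U queries` matter.
Internal randomness, intermediate measurements and adaptivity are covered by deferring all
measurements to the end. -/
structure QueryAlgorithm (Q R : Type) [Fintype Q] [DecidableEq Q] where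
  W : Type
  [fintypeW : Fintype W]
  [decEqW : DecidableEq W]
  queries : ℕ
  init : Q × W
  U : ℕ → Matrix.unitaryGroup (Q × W) ℂ
  output : Q × W → R

attribute [instance] QueryAlgorithm.fintypeW QueryAlgorithm.decEqW

namespace QueryAlgorithm

variable {Q R : Type} [Fintype Q] [DecidableEq Q]

/-- The state vector after the `k`-th oracle call and the unitary `U k` that follows it. The
oracle acts on the query register and as the identity on the workspace. -/
def state (A : QueryAlgorithm Q R) (O : Matrix Q Q ℂ) : ℕ → (Q × A.W → ℂ)
  | 0 => (A.U 0 : Matrix (Q × A.W) (Q × A.W) ℂ) *ᵥ Pi.single A.init 1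
  | k + 1 => (A.U (k + 1) : Matrix (Q × A.W) (Q × A.W) ℂ) *ᵥ
      ((O ⊗ₖ (1 : Matrix A.W A.W ℂ)) *ᵥ A.state O k)

/-- The probability that the output of `A`, run with the oracle `O`, lies in `S`. -/
def prob (A : QueryAlgorithm Q R) (O : Matrix Q Q ℂ) (S : Set R) : ℝ :=
  ∑ s : Q × A.W, Set.indicator {s | A.output s ∈ S} (fun s => ‖A.state O A.queries s‖ ^ 2) s

end QueryAlgorithm

/-- The bit-flip oracle `|x⟩|b⟩ ↦ |x⟩|b + f x⟩` of `f : 𝔽₂ⁿ → 𝔽₂`. -/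
def bitOracle {n : ℕ} (f : (Fin n → ZMod 2) → ZMod 2) :
    Matrix ((Fin n → ZMod 2) × ZMod 2) ((Fin n → ZMod 2) × ZMod 2) ℂ :=
  Matrix.of fun s t => if s = (t.1, t.2 + f t.1) then 1 else 0

/-- The phase oracle `|x⟩ ↦ f x |x⟩`. -/
def phaseOracle {p n : ℕ} (f : (Fin n → ZMod p) → ℂ) :
    Matrix (Fin n → ZMod p) (Fin n → ZMod p) ℂ :=
  Matrix.diagonal f

/-! ### Quadratic Reed-Muller codewords -/

/-- The normalized Hamming distance between two functions on `𝔽₂ⁿ`. -/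
def relDist {n : ℕ} (f g : (Fin n → ZMod 2) → ZMod 2) : ℝ :=
  (hammingDist f g : ℝ) / 2 ^ n

/-- The Reed-Muller codewords of degree at most `2`: evaluations on all of `𝔽₂ⁿ` of polynomials
of total degree at most `2`. -/
def RM2 (n : ℕ) : Set ((Fin n → ZMod 2) → ZMod 2) :=
  {c | ∃ P : MvPolynomial (Fin n) (ZMod 2), P.totalDegree ≤ 2 ∧ ∀ x, c x = MvPolynomial.eval x P}

/-- The minimal normalized distance from `f` to a Reed-Muller codeword of degree at most `2`
(the infimum is over a finite nonempty set). -/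
def distRM2 {n : ℕ} (f : (Fin n → ZMod 2) → ZMod 2) : ℝ :=
  sInf (relDist f '' RM2 n)

/-! ### Higher-order Fourier analysis over `𝔽ₚⁿ` -/

section Fourier

variable {p n : ℕ} [Fact p.Prime]

/-- A polynomial phase function `x ↦ ω_p ^ P(x)`, with `ω_p = exp (2πi/p)` and `P` of degree at
most `p - 1` in every variable. -/
def IsPolynomialPhase (f : (Fin n → ZMod p) → ℂ) : Prop :=
  ∃ P : MvPolynomial (Fin n) (ZMod p), (∀ i, P.degreeOf i ≤ p - 1) ∧
    ∀ x, f x = ZMod.stdAddChar (MvPolynomial.eval x P)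

/-- The multiplicative derivative `Δ_h f (x) = f (x + h) * conj (f x)`. -/
def mulDeriv (h : Fin n → ZMod p) (f : (Fin n → ZMod p) → ℂ) : (Fin n → ZMod p) → ℂ :=
  fun x => f (x + h) * starRingEnd ℂ (f x)

/-- The Fourier coefficient `𝔼_x f x * ω_p ^ (-⟨x, y⟩)`. -/
def fourierCoeff (f : (Fin n → ZMod p) → ℂ) (y : Fin n → ZMod p) : ℂ :=
  Finset.expect Finset.univ fun x => f x * ZMod.stdAddChar (-(x ⬝ᵥ y))

/-- The average `𝔼_{h₁, …, h_d, x} Δ_{h_d} ⋯ Δ_{h₁} f (x)`. -/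
def gowersAverage : ℕ → ((Fin n → ZMod p) → ℂ) → ℂ
  | 0, f => Finset.expect Finset.univ f
  | d + 1, f => Finset.expect Finset.univ fun h => gowersAverage d (mulDeriv h f)

/-- The Gowers `U^d`-norm, for `d ≥ 1` (the average is then a nonnegative real number). -/
def gowersNorm (d : ℕ) (f : (Fin n → ZMod p) → ℂ) : ℝ :=
  (gowersAverage d f).re ^ ((1 : ℝ) / 2 ^ d)

end Fourier

end QuadraticDecoding

end

noncomputable section

namespace QuadraticDecoding

/-! ### Non-adaptive query algorithms -/

section Unitary

variable {Q : Type} [Fintype Q] [DecidableEq Q]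

lemma exists_unitary_mulVec_single (i : Q) (a : Q → ℂ) (ha : ∑ q, ‖a q‖ ^ 2 = 1) :
    ∃ U : Matrix.unitaryGroup Q ℂ, (U : Matrix Q Q ℂ) *ᵥ Pi.single i 1 = a := by
  have hnorm : ‖WithLp.toLp 2 a‖ = 1 := by
    rw [EuclideanSpace.norm_eq]
    simp [ha]
  have hv : Orthonormal ℂ (Set.domRestrict ({i} : Set Q)
      (fun _ : Q => (WithLp.toLp 2 a : EuclideanSpace ℂ Q))) := by
    rw [orthonormal_iff_ite]
    rintro ⟨x, rfl⟩ ⟨y, rfl⟩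
    simp [hnorm]
  obtain ⟨b, hb⟩ := hv.exists_orthonormalBasis_extension_of_card_eq (by simp)
  refine ⟨⟨_, (EuclideanSpace.basisFun Q ℂ).toMatrix_orthonormalBasis_mem_unitary b⟩, ?_⟩
  ext q
  have := hb i rfl
  simp [Module.Basis.toMatrix_apply, this]

lemma exists_unitary_mulVec (a b : Q → ℂ) (ha : ∑ q, ‖a q‖ ^ 2 = 1) (hb : ∑ q, ‖b q‖ ^ 2 = 1) :
    ∃ U : Matrix.unitaryGroup Q ℂ, (U : Matrix Q Q ℂ) *ᵥ a = b := by
  obtain ⟨i⟩ : Nonempty Q := by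
    by_contra h
    rw [not_nonempty_iff] at h
    simp at ha
  obtain ⟨U, hU⟩ := exists_unitary_mulVec_single i a ha
  obtain ⟨V, hV⟩ := exists_unitary_mulVec_single i b hb
  refine ⟨V * U⁻¹, ?_⟩
  rw [← hU, Matrix.mulVec_mulVec, ← Matrix.UnitaryGroup.mul_val]
  simp [hV]

/-- A unitary acting on the first register, controlled by the second one. -/
def controlled {W : Type} [Fintype W] [DecidableEq W] (U : W → Matrix.unitaryGroup Q ℂ) :
    Matrix.unitaryGroup (Q × W) ℂ :=
  ⟨Matrix.blockDiagonal fun w => (U w : Matrix Q Q ℂ), by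
    rw [Matrix.mem_unitaryGroup_iff, Matrix.star_eq_conjTranspose,
      Matrix.blockDiagonal_conjTranspose, ← Matrix.blockDiagonal_mul]
    have : (fun w => (U w : Matrix Q Q ℂ) * (U w : Matrix Q Q ℂ)ᴴ) = 1 := by
      funext w
      exact Matrix.mem_unitaryGroup_iff.1 (U w).2
    rw [this, Matrix.blockDiagonal_one]⟩

lemma controlled_mulVec {W : Type} [Fintype W] [DecidableEq W]
    (U : W → Matrix.unitaryGroup Q ℂ) (ψ : Q × W → ℂ) (s : Q × W) :
    ((controlled U : Matrix (Q × W) (Q × W) ℂ) *ᵥ ψ) s =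
      ((U s.2 : Matrix Q Q ℂ) *ᵥ fun q => ψ (q, s.2)) s.1 := by
  simp only [controlled, Matrix.mulVec, dotProduct, Matrix.blockDiagonal_apply,
    Fintype.sum_prod_type]
  refine Finset.sum_congr rfl fun q _ => ?_
  simp

lemma kronecker_mulVec_mul {R S : Type} [Fintype R] [Fintype S]
    (M : Matrix R R ℂ) (N : Matrix S S ℂ) (a : R → ℂ) (b : S → ℂ) :
    ((M ⊗ₖ N) *ᵥ fun t : R × S => a t.1 * b t.2) = fun s => (M *ᵥ a) s.1 * (N *ᵥ b) s.2 := by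
  ext s
  simp only [Matrix.mulVec, dotProduct, Matrix.kroneckerMap_apply, Fintype.sum_prod_type,
    Finset.sum_mul_sum]
  refine Finset.sum_congr rfl fun q _ => Finset.sum_congr rfl fun w _ => ?_
  ring

lemma kronecker_one_mulVec_apply {R S : Type} [Fintype R] [Fintype S] [DecidableEq S]
    (M : Matrix R R ℂ) (ψ : R × S → ℂ) (s : R × S) :
    ((M ⊗ₖ (1 : Matrix S S ℂ)) *ᵥ ψ) s = (M *ᵥ fun r => ψ (r, s.2)) s.1 := by
  simp only [Matrix.mulVec, dotProduct, Matrix.kroneckerMap_apply, Fintype.sum_prod_type,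
    Matrix.one_apply]
  refine Finset.sum_congr rfl fun q _ => ?_
  simp

end Unitary

section Nonadaptive

variable {Q R X W κ : Type} [Fintype Q] [DecidableEq Q] [Fintype W] [DecidableEq W] [Fintype κ]

/-- A non-adaptive algorithm: given unit vectors `v x` that are eigenvectors of every admissible
oracle, with eigenvalues `φ x`, one can multiply a fixed superposition `u` over the workspace by
the phases `∏ k, φ (q k w)`, apply a unitary `V` to the workspace, and measure the workspace. -/
theorem exists_nonadaptive (v : X → Q → ℂ) (hv : ∀ x, ∑ q, ‖v x q‖ ^ 2 = 1) (x₀ : X)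
    (q : κ → W → X) (u : W → ℂ) (hu : ∑ w, ‖u w‖ ^ 2 = 1) (V : Matrix.unitaryGroup W ℂ)
    (out : W → R) :
    ∃ A : QueryAlgorithm Q R, A.queries = Fintype.card κ ∧
      ∀ (O : Matrix Q Q ℂ) (φ : X → ℂ), (∀ x, O *ᵥ v x = φ x • v x) → ∀ S : Set R,
        A.prob O S = ∑ w, Set.indicator {w | out w ∈ S}
          (fun w => ‖((V : Matrix W W ℂ) *ᵥ fun w => (∏ k, φ (q k w)) * u w) w‖ ^ 2) w := by
  classical
  set T := Fintype.card κ with hT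
  let e : κ ≃ Fin T := Fintype.equivFin κ
  let q' : ℕ → W → X := fun k w => if h : k < T then q (e.symm ⟨k, h⟩) w else x₀
  obtain ⟨w₀⟩ : Nonempty W := by
    by_contra h
    rw [not_nonempty_iff] at h
    simp at hu
  obtain ⟨a₀⟩ : Nonempty Q := by
    by_contra h
    rw [not_nonempty_iff] at h
    have := hv x₀
    simp at this
  have hprep : ∑ s : Q × W, ‖v (q' 0 s.2) s.1 * u s.2‖ ^ 2 = 1 := by
    rw [Fintype.sum_prod_type_right]
    simp only [norm_mul, mul_pow, ← Finset.sum_mul, hv, one_mul, hu]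
  obtain ⟨B₀, hB₀⟩ := exists_unitary_mulVec_single (a₀, w₀) _ hprep
  choose move hmove using fun x y => exists_unitary_mulVec (v x) (v y) (hv x) (hv y)
  let B : ℕ → Matrix.unitaryGroup (Q × W) ℂ := fun k =>
    Nat.rec B₀ (fun k _ => controlled fun w => move (q' k w) (q' (k + 1) w)) k
  let F : Matrix.unitaryGroup (Q × W) ℂ :=
    ⟨(1 : Matrix Q Q ℂ) ⊗ₖ (V : Matrix W W ℂ), Matrix.kronecker_mem_unitary (one_mem _) V.2⟩
  let A : QueryAlgorithm Q R :=
    { W := W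
      queries := T
      init := (a₀, w₀)
      U := fun k => if k = T then F * B k else B k
      output := fun s => out s.2 }
  refine ⟨A, rfl, fun O φ hO S => ?_⟩
  let ψ : ℕ → W → ℂ := fun k w => (∏ j ∈ Finset.range k, φ (q' j w)) * u w
  let pre : ℕ → Q × W → ℂ := fun k s => v (q' k s.2) s.1 * ψ k s.2
  have hstep : ∀ k, (B (k + 1) : Matrix (Q × W) (Q × W) ℂ) *ᵥ
      ((O ⊗ₖ (1 : Matrix W W ℂ)) *ᵥ pre k) = pre (k + 1) := by
    intro k
    have h1 : (O ⊗ₖ (1 : Matrix W W ℂ)) *ᵥ pre k =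
        fun s => v (q' k s.2) s.1 * ψ (k + 1) s.2 := by
      ext s
      rw [kronecker_one_mulVec_apply]
      have : (fun r => pre k (r, s.2)) = ψ k s.2 • v (q' k s.2) := by
        ext r
        simp [pre, mul_comm]
      rw [this, Matrix.mulVec_smul, hO]
      simp only [Pi.smul_apply, smul_eq_mul, ψ, Finset.prod_range_succ]
      ring
    rw [h1]
    ext s
    change ((controlled fun w => move (q' k w) (q' (k + 1) w) :
      Matrix (Q × W) (Q × W) ℂ) *ᵥ _) s = _
    rw [controlled_mulVec]
    have : (fun r => v (q' k s.2) r * ψ (k + 1) s.2) = ψ (k + 1) s.2 • v (q' k s.2) := by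
      ext r
      simp [mul_comm]
    rw [this, Matrix.mulVec_smul, hmove]
    simp [pre, mul_comm]
  have hzero : (B 0).1 *ᵥ (Pi.single (a₀, w₀) 1 : Q × W → ℂ) = pre 0 := by
    change (B₀ : Matrix (Q × W) (Q × W) ℂ) *ᵥ _ = _
    rw [hB₀]
    ext s
    simp [pre, ψ]
  have hstate : ∀ k, k < T → A.state O k = pre k := by
    intro k
    induction k with
    | zero =>
      intro hk
      rw [QueryAlgorithm.state, show A.U 0 = B 0 from if_neg hk.ne]
      exact hzero
    | succ k ih =>
      intro hk
      rw [QueryAlgorithm.state, show A.U (k + 1) = B (k + 1) from if_neg hk.ne,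
        ih (by omega)]
      exact hstep k
  have hfinal : A.state O T = (F : Matrix (Q × W) (Q × W) ℂ) *ᵥ pre T := by
    have hU : A.U T = F * B T := if_pos rfl
    rcases hT' : T with _ | k
    · rw [hT'] at hU
      rw [QueryAlgorithm.state, hU, Matrix.UnitaryGroup.mul_val, ← Matrix.mulVec_mulVec]
      exact congrArg _ hzero
    · rw [hT'] at hU
      rw [QueryAlgorithm.state, hU, Matrix.UnitaryGroup.mul_val, ← Matrix.mulVec_mulVec,
        hstate k (by omega)]
      exact congrArg _ (hstep k)
  have hψ : ψ T = fun w => (∏ k, φ (q k w)) * u w := by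
    ext w
    simp only [ψ]
    congr 1
    rw [Finset.prod_range, ← e.prod_comp]
    refine Finset.prod_congr rfl fun k _ => ?_
    simp [q']
  have hpre : pre T = fun s => v x₀ s.1 * ψ T s.2 := by
    ext s
    simp [pre, q']
  have hval : ∀ s, A.state O T s = v x₀ s.1 * ((V : Matrix W W ℂ) *ᵥ ψ T) s.2 := by
    intro s
    rw [hfinal, hpre]
    change (((1 : Matrix Q Q ℂ) ⊗ₖ (V : Matrix W W ℂ)) *ᵥ _) s = _
    rw [kronecker_mulVec_mul]
    simp
  rw [QueryAlgorithm.prob]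
  change ∑ s : Q × W, Set.indicator {s : Q × W | out s.2 ∈ S}
    (fun s => ‖A.state O T s‖ ^ 2) s = _
  rw [Fintype.sum_prod_type_right]
  refine Finset.sum_congr rfl fun w _ => ?_
  by_cases hw : out w ∈ S
  · simp only [Set.indicator, Set.mem_ofPred_eq, hw, if_true, hval, norm_mul, mul_pow,
      ← Finset.sum_mul, hv, one_mul, hψ]
  · simp [Set.indicator, hw]

/-- The `m`-fold tensor power of a unitary. -/
def tensorPower [DecidableEq R] [Fintype R] (V : Matrix.unitaryGroup R ℂ) (m : ℕ) :
    Matrix.unitaryGroup (Fin m → R) ℂ :=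
  ⟨Matrix.of fun s t => ∏ i, (V : Matrix R R ℂ) (s i) (t i), by
    rw [Matrix.mem_unitaryGroup_iff]
    ext s t
    have hV : ∀ a b, ∑ c, (V : Matrix R R ℂ) a c * star ((V : Matrix R R ℂ) b c) =
        if a = b then 1 else 0 := by
      intro a b
      have := congrFun (congrFun (Matrix.mem_unitaryGroup_iff.1 V.2) a) b
      simpa [Matrix.mul_apply, Matrix.one_apply] using this
    simp only [Matrix.mul_apply, Matrix.star_apply, Matrix.of_apply, star_prod,
      ← Finset.prod_mul_distrib]
    rw [← Fintype.prod_sum (fun i c => (V : Matrix R R ℂ) (s i) c *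
      star ((V : Matrix R R ℂ) (t i) c))]
    simp only [hV, Matrix.one_apply, Finset.prod_ite_zero, Finset.mem_univ, true_imp_iff,
      funext_iff, Finset.prod_const_one]⟩

lemma tensorPower_mulVec [DecidableEq R] [Fintype R] (V : Matrix.unitaryGroup R ℂ) (m : ℕ)
    (ψ : Fin m → R → ℂ) (s : Fin m → R) :
    ((tensorPower V m : Matrix (Fin m → R) (Fin m → R) ℂ) *ᵥ fun t => ∏ i, ψ i (t i)) s =
      ∏ i, ((V : Matrix R R ℂ) *ᵥ ψ i) (s i) := by
  simp only [tensorPower, Matrix.mulVec, dotProduct, Matrix.of_apply, ← Finset.prod_mul_distrib]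
  rw [Fintype.prod_sum]

/-- Running `m` independent copies of a non-adaptive measurement on a register `W`. -/
theorem exists_nonadaptive_iid (v : X → Q → ℂ) (hv : ∀ x, ∑ q, ‖v x q‖ ^ 2 = 1) (x₀ : X)
    (q : κ → W → X) (u : W → ℂ) (hu : ∑ w, ‖u w‖ ^ 2 = 1) (V : Matrix.unitaryGroup W ℂ)
    (m : ℕ) (out : (Fin m → W) → R) :
    ∃ A : QueryAlgorithm Q R, A.queries = m * Fintype.card κ ∧
      ∀ (O : Matrix Q Q ℂ) (φ : X → ℂ), (∀ x, O *ᵥ v x = φ x • v x) → ∀ S : Set R,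
        A.prob O S = ∑ w, Set.indicator {w | out w ∈ S} (fun w : Fin m → W =>
          ∏ i, ‖((V : Matrix W W ℂ) *ᵥ fun w => (∏ k, φ (q k w)) * u w) (w i)‖ ^ 2) w := by
  obtain ⟨A, hA, h⟩ := exists_nonadaptive (W := Fin m → W) (κ := Fin m × κ) v hv x₀
    (fun k w => q k.2 (w k.1)) (fun w => ∏ i, u (w i))
    (by
      simp only [norm_prod, ← Finset.prod_pow]
      rw [← Fintype.prod_sum (fun (_ : Fin m) w => ‖u w‖ ^ 2)]
      simp [hu]) (tensorPower V m) out
  refine ⟨A, by simpa using hA, fun O φ hO S => ?_⟩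
  rw [h O φ hO S]
  refine Finset.sum_congr rfl fun w _ => ?_
  congr 1
  ext w
  simp only [Fintype.prod_prod_type, ← Finset.prod_mul_distrib]
  rw [tensorPower_mulVec V m (fun _ w => (∏ k, φ (q k w)) * u w) w, norm_prod, Finset.prod_pow]

end Nonadaptive

section FourierSampling

variable {p : ℕ} [Fact p.Prime] {k : ℕ}

lemma sum_stdAddChar_dotProduct (y : Fin k → ZMod p) :
    ∑ x : Fin k → ZMod p, ZMod.stdAddChar (x ⬝ᵥ y) = if y = 0 then (p : ℂ) ^ k else 0 := by
  have h : ∀ x : Fin k → ZMod p, (ZMod.stdAddChar (x ⬝ᵥ y) : ℂ) =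
      ∏ i, ZMod.stdAddChar (x i * y i) := by
    intro x
    exact map_sum (ZMod.stdAddChar (N := p)).toAddMonoidHom _ _
  simp only [h]
  rw [← Fintype.prod_sum (fun i (c : ZMod p) => (ZMod.stdAddChar (c * y i) : ℂ))]
  have h1 : ∀ i, ∑ c : ZMod p, (ZMod.stdAddChar (c * y i) : ℂ) =
      if y i = 0 then (p : ℂ) else 0 := by
    intro i
    simpa [mul_comm, ZMod.card] using
      AddChar.sum_mulShift (R := ZMod p) (R' := ℂ) (y i) (ZMod.isPrimitive_stdAddChar p)
  simp [h1, Finset.prod_ite_zero, funext_iff]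

/-- The quantum Fourier transform on `𝔽ₚᵏ`. -/
def qft (p k : ℕ) [Fact p.Prime] : Matrix.unitaryGroup (Fin k → ZMod p) ℂ :=
  ⟨Matrix.of fun y x => ((Real.sqrt ((p : ℝ) ^ k) : ℝ) : ℂ)⁻¹ * ZMod.stdAddChar (-(x ⬝ᵥ y)), by
    have hp : (0 : ℝ) < (p : ℝ) ^ k := pow_pos (by exact_mod_cast (Fact.out : p.Prime).pos) _
    have hs : ((Real.sqrt ((p : ℝ) ^ k) : ℝ) : ℂ) * ((Real.sqrt ((p : ℝ) ^ k) : ℝ) : ℂ) =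
        (p : ℂ) ^ k := by
      rw [← Complex.ofReal_mul, Real.mul_self_sqrt hp.le]
      push_cast
      rfl
    rw [Matrix.mem_unitaryGroup_iff]
    ext y z
    have : ∀ x : Fin k → ZMod p,
        (((Real.sqrt ((p : ℝ) ^ k) : ℝ) : ℂ)⁻¹ * ZMod.stdAddChar (-(x ⬝ᵥ y))) *
          star (((Real.sqrt ((p : ℝ) ^ k) : ℝ) : ℂ)⁻¹ * (ZMod.stdAddChar (-(x ⬝ᵥ z)) : ℂ)) =
        ((p : ℂ) ^ k)⁻¹ * ZMod.stdAddChar (x ⬝ᵥ (z - y)) := by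
      intro x
      rw [star_mul', RCLike.star_def, ← AddChar.map_neg_eq_conj, neg_neg,
        map_inv₀, Complex.conj_ofReal, ← hs, mul_inv, dotProduct_sub, sub_eq_neg_add,
        AddChar.map_add_eq_mul]
      ring
    simp only [Matrix.mul_apply, Matrix.star_apply, Matrix.of_apply, this, ← Finset.mul_sum]
    rw [sum_stdAddChar_dotProduct, Matrix.one_apply]
    have hp' : (p : ℂ) ^ k ≠ 0 := pow_ne_zero _ (by exact_mod_cast (Fact.out : p.Prime).ne_zero)
    by_cases h : y = z
    · simp [h, hp']
    · simp [h, sub_eq_zero, Ne.symm h]⟩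

variable {Q R X Z κ : Type} [Fintype Q] [DecidableEq Q] [Fintype Z] [DecidableEq Z] [Nonempty Z]
  [Fintype κ]

/-- Fourier sampling: `m` independent samples `(y, z)`, each with probability
`|Z|⁻¹ |𝔼ₓ Φ(x, z) ω^(-⟨x, y⟩)|²`, where `Φ(x, z) = ∏ k, φ (q k (x, z))`. -/
theorem exists_fourierSampling (v : X → Q → ℂ) (hv : ∀ x, ∑ q, ‖v x q‖ ^ 2 = 1) (x₀ : X)
    (q : κ → (Fin k → ZMod p) × Z → X) (m : ℕ) (out : (Fin m → (Fin k → ZMod p) × Z) → R) :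
    ∃ A : QueryAlgorithm Q R, A.queries = m * Fintype.card κ ∧
      ∀ (O : Matrix Q Q ℂ) (φ : X → ℂ), (∀ x, O *ᵥ v x = φ x • v x) → ∀ S : Set R,
        A.prob O S = ∑ w, Set.indicator {w | out w ∈ S}
          (fun w : Fin m → (Fin k → ZMod p) × Z => ∏ i, (Fintype.card Z : ℝ)⁻¹ *
            ‖fourierCoeff (fun x => ∏ j, φ (q j (x, (w i).2))) (w i).1‖ ^ 2) w := by
  classical
  have hp : (0 : ℝ) < (p : ℝ) ^ k := pow_pos (by exact_mod_cast (Fact.out : p.Prime).pos) _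
  have hZ : (0 : ℝ) < Fintype.card Z := by exact_mod_cast Fintype.card_pos
  let c : ℝ := (Real.sqrt ((p : ℝ) ^ k))⁻¹ * (Real.sqrt (Fintype.card Z))⁻¹
  have hc : c ^ 2 = ((p : ℝ) ^ k)⁻¹ * (Fintype.card Z : ℝ)⁻¹ := by
    simp only [c, mul_pow, inv_pow, Real.sq_sqrt hp.le, Real.sq_sqrt hZ.le]
  obtain ⟨A, hA, h⟩ := exists_nonadaptive_iid (W := (Fin k → ZMod p) × Z) v hv x₀ q
    (fun _ => (c : ℂ))
    (by
      simp only [Complex.norm_real, Real.norm_eq_abs, sq_abs, hc, Finset.sum_const,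
        Finset.card_univ, Fintype.card_prod, Fintype.card_fun, ZMod.card, Fintype.card_fin,
        nsmul_eq_mul]
      push_cast
      field_simp)
    ⟨((qft p k : Matrix (Fin k → ZMod p) (Fin k → ZMod p) ℂ) ⊗ₖ (1 : Matrix Z Z ℂ)),
      Matrix.kronecker_mem_unitary (qft p k).2 (one_mem _)⟩ m out
  refine ⟨A, hA, fun O φ hO S => ?_⟩
  rw [h O φ hO S]
  refine Finset.sum_congr rfl fun w _ => ?_
  congr 1
  ext w
  refine Finset.prod_congr rfl fun i _ => ?_
  change ‖(((qft p k : Matrix (Fin k → ZMod p) (Fin k → ZMod p) ℂ) ⊗ₖ (1 : Matrix Z Z ℂ)) *ᵥ _)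
    (w i)‖ ^ 2 = _
  rw [kronecker_one_mulVec_apply]
  have : ((qft p k : Matrix (Fin k → ZMod p) (Fin k → ZMod p) ℂ) *ᵥ
      fun r => (∏ j, φ (q j (r, (w i).2))) * (c : ℂ)) (w i).1 =
      (((Real.sqrt (Fintype.card Z))⁻¹ : ℝ) : ℂ) *
        fourierCoeff (fun x => ∏ j, φ (q j (x, (w i).2))) (w i).1 := by
    have hs : ((Real.sqrt ((p : ℝ) ^ k) : ℝ) : ℂ) * ((Real.sqrt ((p : ℝ) ^ k) : ℝ) : ℂ) =
        (p : ℂ) ^ k := by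
      rw [← Complex.ofReal_mul, Real.mul_self_sqrt hp.le]
      push_cast
      rfl
    simp only [qft, Matrix.mulVec, dotProduct, Matrix.of_apply, fourierCoeff,
      Finset.expect, Finset.card_univ, Fintype.card_fun, ZMod.card, Fintype.card_fin, c]
    rw [← NNRat.cast_smul_eq_nnqsmul ℂ]
    push_cast
    rw [smul_eq_mul, ← hs, Finset.mul_sum, Finset.mul_sum]
    refine Finset.sum_congr rfl fun x _ => ?_
    rw [mul_inv]
    ring
  rw [this, norm_mul, mul_pow, Complex.norm_real, Real.norm_eq_abs, sq_abs, inv_pow,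
    Real.sq_sqrt hZ.le]

end FourierSampling

/-! ### Independent samples from a finite distribution -/

section IID

variable {α β R : Type} [Fintype α] [Fintype β] [Fintype R]

/-- The probability of `S` under `m` independent samples from the distribution `D`. -/
def iidProb (D : α → ℝ) (m : ℕ) (S : Set (Fin m → α)) : ℝ :=
  ∑ s, S.indicator (fun s => ∏ i, D (s i)) s

variable {D : α → ℝ} {m : ℕ}

lemma iidProb_mono (hD : ∀ a, 0 ≤ D a) {S T : Set (Fin m → α)} (h : S ⊆ T) :
    iidProb D m S ≤ iidProb D m T :=
  Finset.sum_le_sum fun s _ => Set.indicator_le_indicator_of_subset h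
    (fun s => Finset.prod_nonneg fun i _ => hD (s i)) s

lemma iidProb_nonneg (hD : ∀ a, 0 ≤ D a) (S : Set (Fin m → α)) : 0 ≤ iidProb D m S :=
  Finset.sum_nonneg fun _ _ => Set.indicator_nonneg
    (fun s _ => Finset.prod_nonneg fun i _ => hD (s i)) _

lemma iidProb_compl (hs : ∑ a, D a = 1) (S : Set (Fin m → α)) :
    iidProb D m Sᶜ = 1 - iidProb D m S := by
  have h : ∑ s : Fin m → α, ∏ i, D (s i) = 1 := by
    rw [← Fintype.prod_sum (fun (_ : Fin m) a => D a)]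
    simp [hs]
  rw [eq_sub_iff_add_eq, iidProb, iidProb, ← Finset.sum_add_distrib, ← h]
  refine Finset.sum_congr rfl fun s _ => ?_
  by_cases hS : s ∈ S <;> simp [hS]

lemma iidProb_iUnion_le (hD : ∀ a, 0 ≤ D a) {ι : Type} [Fintype ι] (S : ι → Set (Fin m → α)) :
    iidProb D m (⋃ j, S j) ≤ ∑ j, iidProb D m (S j) := by
  simp only [iidProb]
  rw [Finset.sum_comm]
  refine Finset.sum_le_sum fun s _ => ?_
  have hpos : 0 ≤ ∏ i, D (s i) := Finset.prod_nonneg fun i _ => hD (s i)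
  have hnn : ∀ j, 0 ≤ (S j).indicator (fun s => ∏ i, D (s i)) s := fun j =>
    Set.indicator_nonneg (fun s _ => Finset.prod_nonneg fun i _ => hD (s i)) s
  by_cases hs : s ∈ ⋃ j, S j
  · obtain ⟨j, hj⟩ := Set.mem_iUnion.1 hs
    rw [Set.indicator_of_mem hs]
    calc ∏ i, D (s i) = (S j).indicator (fun s => ∏ i, D (s i)) s := by
          rw [Set.indicator_of_mem hj]
      _ ≤ _ := Finset.single_le_sum (fun j _ => hnn j) (Finset.mem_univ j)
  · rw [Set.indicator_of_notMem hs]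
    exact Finset.sum_nonneg fun j _ => hnn j

lemma iidProb_union_le (hD : ∀ a, 0 ≤ D a) (S T : Set (Fin m → α)) :
    iidProb D m (S ∪ T) ≤ iidProb D m S + iidProb D m T := by
  rw [Set.union_eq_iUnion]
  refine (iidProb_iUnion_le hD _).trans ?_
  simp

lemma iidProb_le_pow (hD : ∀ a, 0 ≤ D a) (S : Set (Fin m → α)) (g : α → ℝ) (hg : ∀ a, 0 ≤ g a)
    (hS : ∀ s ∈ S, 1 ≤ ∏ i, g (s i)) : iidProb D m S ≤ (∑ a, D a * g a) ^ m := by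
  have h : (∑ a, D a * g a) ^ m = ∑ s : Fin m → α, ∏ i, (D (s i) * g (s i)) := by
    rw [← Fintype.prod_sum (fun (_ : Fin m) a => D a * g a)]
    simp
  rw [h, iidProb]
  refine Finset.sum_le_sum fun s _ => ?_
  rw [Finset.prod_mul_distrib]
  have hpos : 0 ≤ ∏ i, D (s i) := Finset.prod_nonneg fun i _ => hD (s i)
  by_cases hs : s ∈ S
  · rw [Set.indicator_of_mem hs]
    exact le_mul_of_one_le_right hpos (hS s hs)
  · rw [Set.indicator_of_notMem hs]
    exact mul_nonneg hpos (Finset.prod_nonneg fun i _ => hg (s i))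

/-- A Hoeffding-type bound for the lower tail. -/
theorem iidProb_sum_le (hD : ∀ a, 0 ≤ D a) (hs : ∑ a, D a = 1) (Y : α → ℝ)
    (hY : ∀ a, |Y a| ≤ 1) {τ : ℝ} (hτ₀ : 0 ≤ τ) (hτ : τ ≤ 4) :
    iidProb D m {s | ∑ i, Y (s i) ≤ m * (∑ a, D a * Y a - τ)} ≤
      Real.exp (-(m * τ ^ 2 / 16)) := by
  set μ := ∑ a, D a * Y a with hμ
  have hμ1 : |μ| ≤ 1 := by
    calc |μ| ≤ ∑ a, |D a * Y a| := Finset.abs_sum_le_sum_abs _ _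
      _ ≤ ∑ a, D a := by
          refine Finset.sum_le_sum fun a _ => ?_
          rw [abs_mul, abs_of_nonneg (hD a)]
          exact mul_le_of_le_one_right (hD a) (hY a)
      _ = 1 := hs
  set l := τ / 8 with hl
  have hl0 : 0 ≤ l := by positivity
  have hl1 : l ≤ 1 / 2 := by rw [hl]; linarith
  have hmain := iidProb_le_pow (m := m) hD {s | ∑ i, Y (s i) ≤ m * (μ - τ)}
    (fun a => Real.exp (l * (μ - τ - Y a))) (fun a => (Real.exp_pos _).le) (by
      intro s hs
      rw [← Real.exp_sum, Real.one_le_exp_iff, ← Finset.mul_sum, Finset.sum_sub_distrib]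
      refine mul_nonneg hl0 ?_
      have : ∑ i, Y (s i) ≤ m * (μ - τ) := hs
      simpa [mul_sub] using this)
  refine hmain.trans ?_
  have hone : ∑ a, D a * Real.exp (l * (μ - τ - Y a)) ≤ Real.exp (-(τ ^ 2 / 16)) := by
    have hpt : ∀ a, D a * Real.exp (l * (μ - τ - Y a)) ≤
        Real.exp (-(l * τ)) * (D a * (1 + 4 * l ^ 2) + l * (D a * μ - D a * Y a)) := by
      intro a
      have hd : |μ - Y a| ≤ 2 := by
        have := abs_sub μ (Y a)
        linarith [hY a]
      have hx : |l * (μ - Y a)| ≤ 1 := by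
        rw [abs_mul, abs_of_nonneg hl0]
        nlinarith [abs_nonneg (μ - Y a)]
      have he := (abs_le.1 (Real.abs_exp_sub_one_sub_id_le hx)).2
      have hsq : (l * (μ - Y a)) ^ 2 ≤ 4 * l ^ 2 := by
        rw [mul_pow, ← sq_abs (μ - Y a)]
        have : |μ - Y a| ^ 2 ≤ 4 := by nlinarith [abs_nonneg (μ - Y a)]
        nlinarith [sq_nonneg l]
      have hb : Real.exp (l * (μ - Y a)) ≤ 1 + 4 * l ^ 2 + l * (μ - Y a) := by linarith
      have : Real.exp (l * (μ - τ - Y a)) = Real.exp (-(l * τ)) * Real.exp (l * (μ - Y a)) := by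
        rw [← Real.exp_add]
        congr 1
        ring
      rw [this]
      calc D a * (Real.exp (-(l * τ)) * Real.exp (l * (μ - Y a)))
          = Real.exp (-(l * τ)) * (D a * Real.exp (l * (μ - Y a))) := by ring
        _ ≤ Real.exp (-(l * τ)) * (D a * (1 + 4 * l ^ 2 + l * (μ - Y a))) := by
          gcongr
          exact hD a
        _ = _ := by ring
    refine (Finset.sum_le_sum fun a _ => hpt a).trans ?_
    rw [← Finset.mul_sum, Finset.sum_add_distrib, ← Finset.sum_mul, ← Finset.mul_sum,
      Finset.sum_sub_distrib, ← Finset.sum_mul, hs, ← hμ]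
    have : 1 * (1 + 4 * l ^ 2) + l * (1 * μ - μ) ≤ Real.exp (4 * l ^ 2) := by
      have := Real.add_one_le_exp (4 * l ^ 2)
      linarith
    calc _ ≤ Real.exp (-(l * τ)) * Real.exp (4 * l ^ 2) := by gcongr
      _ = Real.exp (-(τ ^ 2 / 16)) := by
        rw [← Real.exp_add]
        congr 1
        rw [hl]
        ring
  calc _ ≤ Real.exp (-(τ ^ 2 / 16)) ^ m := by
        gcongr
        exact Finset.sum_nonneg fun a _ => mul_nonneg (hD a) (Real.exp_pos _).le
    _ = _ := by
        rw [← Real.exp_nat_mul]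
        congr 1
        ring

/-- A two-stage success bound for independent samples from a product distribution. -/
lemma mul_le_iidProb_of_equiv {D : R → ℝ} {D₁ : α → ℝ} {D₂ : β → ℝ} (e : R ≃ α × β)
    (hD : ∀ r, D r = D₁ (e r).1 * D₂ (e r).2) (h₁ : ∀ a, 0 ≤ D₁ a)
    (S : Set ((Fin m → α) × (Fin m → β))) (G : Set (Fin m → α)) {a b : ℝ} (hb₀ : 0 ≤ b)
    (ha : a ≤ iidProb D₁ m G) (h₂ : ∀ b, 0 ≤ D₂ b)
    (hb : ∀ s ∈ G, b ≤ iidProb D₂ m {c | (s, c) ∈ S}) :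
    a * b ≤ iidProb D m {w | (fun i => (e (w i)).1, fun i => (e (w i)).2) ∈ S} := by
  let E : (Fin m → R) ≃ (Fin m → α) × (Fin m → β) :=
    (Equiv.arrowCongr (Equiv.refl (Fin m)) e).trans (Equiv.arrowProdEquivProdArrow (Fin m) _ _)
  have hE : iidProb D m {w | (fun i => (e (w i)).1, fun i => (e (w i)).2) ∈ S} =
      ∑ s : Fin m → α, (∏ i, D₁ (s i)) * iidProb D₂ m {c | (s, c) ∈ S} := by
    have h1 : iidProb D m {w | (fun i => (e (w i)).1, fun i => (e (w i)).2) ∈ S} =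
        ∑ t : (Fin m → α) × (Fin m → β), S.indicator
          (fun t => (∏ i, D₁ (t.1 i)) * ∏ i, D₂ (t.2 i)) t := by
      rw [iidProb, ← E.sum_comp]
      refine Finset.sum_congr rfl fun w _ => ?_
      simp only [Set.indicator, hD, Finset.prod_mul_distrib]
      rfl
    rw [h1, Fintype.sum_prod_type]
    refine Finset.sum_congr rfl fun s _ => ?_
    rw [iidProb, Finset.mul_sum]
    refine Finset.sum_congr rfl fun c _ => ?_
    by_cases h : (s, c) ∈ S <;> simp [h, Set.indicator]
  rw [hE]
  calc a * b ≤ iidProb D₁ m G * b := by gcongr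
    _ = ∑ s, G.indicator (fun s => ∏ i, D₁ (s i)) s * b := by rw [iidProb, Finset.sum_mul]
    _ ≤ _ := by
      refine Finset.sum_le_sum fun s _ => ?_
      have hpos : 0 ≤ ∏ i, D₁ (s i) := Finset.prod_nonneg fun i _ => h₁ (s i)
      by_cases hs : s ∈ G
      · rw [Set.indicator_of_mem hs]
        exact mul_le_mul_of_nonneg_left (hb s hs) hpos
      · rw [Set.indicator_of_notMem hs, zero_mul]
        exact mul_nonneg hpos (iidProb_nonneg h₂ _)

/-- The probability of an event that depends on one sample only. -/
lemma iidProb_eval (hs : ∑ a, D a = 1) (i₀ : Fin m) (S : Set α) :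
    iidProb D m {s | s i₀ ∈ S} = ∑ a, S.indicator D a := by
  classical
  have h : ∀ s : Fin m → α, Set.indicator {s : Fin m → α | s i₀ ∈ S} (fun s => ∏ i, D (s i)) s =
      ∏ i, (D (s i) * if i = i₀ then S.indicator 1 (s i) else 1) := by
    intro s
    rw [Finset.prod_mul_distrib, Finset.prod_ite_eq' Finset.univ i₀ (fun i => S.indicator 1 (s i))]
    by_cases h : s i₀ ∈ S <;> simp [h, Set.indicator]
  simp only [iidProb, h]
  rw [← Fintype.prod_sum (fun i a => D a * if i = i₀ then S.indicator 1 a else 1),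
    Finset.prod_eq_single i₀]
  · refine Finset.sum_congr rfl fun a _ => ?_
    by_cases h : a ∈ S <;> simp [h]
  · intro i _ hi
    simp [hi, hs]
  · simp

/-- The mass that `P` gives to a set. -/
def mass (D : α → ℝ) (S : Set α) : ℝ := ∑ e, S.indicator D e

lemma mass_mono (hD : ∀ a, 0 ≤ D a) {S T : Set α} (h : S ⊆ T) : mass D S ≤ mass D T :=
  Finset.sum_le_sum fun e _ => Set.indicator_le_indicator_of_subset h hD e

lemma mass_nonneg (hD : ∀ a, 0 ≤ D a) (S : Set α) : 0 ≤ mass D S :=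
  Finset.sum_nonneg fun _ _ => Set.indicator_nonneg (fun e _ => hD e) _

end IID

section Subspaces

variable {p : ℕ} [Fact p.Prime] {E : Type} [AddCommGroup E] [Module (ZMod p) E] [Fintype E]
  {P : E → ℝ} {m : ℕ}

lemma iidProb_mem_span_le (hP : ∀ e, 0 ≤ P e) (hs : ∑ e, P e = 1) {θ : ℝ}
    (hθ₀ : 0 ≤ θ) (T S : Finset (Fin m)) (hST : Disjoint S T) :
    iidProb P m {s | (∀ i ∈ S, s i ∈ Submodule.span (ZMod p) (Set.range fun i : T => s i)) ∧
      mass P (Submodule.span (ZMod p) (Set.range fun i : T => s i) : Set E) < θ} ≤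
      θ ^ S.card := by
  classical
  let H : (T → E) → Submodule (ZMod p) E := fun a => Submodule.span (ZMod p) (Set.range a)
  let e := Equiv.piEquivPiSubtypeProd (fun i => i ∈ T) (fun _ : Fin m => E)
  have h1 : iidProb P m {s | (∀ i ∈ S, s i ∈ Submodule.span (ZMod p)
      (Set.range fun i : T => s i)) ∧
      mass P (Submodule.span (ZMod p) (Set.range fun i : T => s i) : Set E) < θ} =
      ∑ a : T → E, (if mass P (H a : Set E) < θ then ∏ i, P (a i) else 0) *
        ∑ b : {i // i ∉ T} → E, ∏ i, (P (b i) *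
          if (i : Fin m) ∈ S then Set.indicator (H a : Set E) 1 (b i) else 1) := by
    simp only [Finset.mul_sum]
    rw [← Fintype.sum_prod_type', iidProb, ← e.sum_comp]
    refine Finset.sum_congr rfl fun s _ => ?_
    have hHs : H (e s).1 = Submodule.span (ZMod p) (Set.range fun i : T => s i) := rfl
    have hprod : ∏ i, P (s i) = (∏ i, P ((e s).1 i)) * ∏ i, P ((e s).2 i) := by
      convert! (Fintype.prod_subtype_mul_prod_subtype (fun i => i ∈ T) (fun i => P (s i))).symm
    simp only [Set.indicator_apply, Set.mem_ofPred_eq, ← hHs]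
    rw [hprod, Finset.prod_mul_distrib]
    have hall : (∀ i ∈ S, s i ∈ H (e s).1) ↔
        ∀ i : {i // i ∉ T}, (i : Fin m) ∈ S → (e s).2 i ∈ H (e s).1 := by
      constructor
      · intro h i hi
        exact h i hi
      · intro h i hi
        exact h ⟨i, Finset.disjoint_left.1 hST hi⟩ hi
    by_cases hm : mass P (H (e s).1 : Set E) < θ
    · by_cases h : ∀ i ∈ S, s i ∈ H (e s).1
      · rw [if_pos ⟨h, hm⟩, if_pos hm]
        have : ∏ i : {i // i ∉ T}, (if (i : Fin m) ∈ S then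
            (if (e s).2 i ∈ (H (e s).1 : Set E) then (1 : E → ℝ) ((e s).2 i) else 0) else 1) = 1 := by
          refine Finset.prod_eq_one fun i _ => ?_
          by_cases hi : (i : Fin m) ∈ S
          · rw [if_pos hi, if_pos (SetLike.mem_coe.2 (hall.1 h i hi)), Pi.one_apply]
          · rw [if_neg hi]
        rw [this, mul_one]
      · rw [if_neg (fun hh => h hh.1)]
        rw [hall] at h
        push Not at h
        obtain ⟨i, hi, hi'⟩ := h
        have : ∏ i : {i // i ∉ T}, (if (i : Fin m) ∈ S then
            (if (e s).2 i ∈ (H (e s).1 : Set E) then (1 : E → ℝ) ((e s).2 i) else 0) else 1) = 0 :=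
          Finset.prod_eq_zero (Finset.mem_univ i) (by rw [if_pos hi, if_neg (by simpa using hi')])
        rw [this, mul_zero, mul_zero]
    · rw [if_neg (fun hh => hm hh.2), if_neg hm, zero_mul]
  rw [h1]
  have hθ : ∀ a : T → E, (if mass P (H a : Set E) < θ then ∏ i, P (a i) else 0) *
      ∑ b : {i // i ∉ T} → E, ∏ i, (P (b i) *
        if (i : Fin m) ∈ S then Set.indicator (H a : Set E) 1 (b i) else 1) ≤
      (∏ i, P (a i)) * θ ^ S.card := by
    intro a
    have hpos : 0 ≤ ∏ i, P (a i) := Finset.prod_nonneg fun i _ => hP (a i)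
    rw [← Fintype.prod_sum (fun (i : {i // i ∉ T}) e => P e *
        if (i : Fin m) ∈ S then Set.indicator (H a : Set E) 1 e else 1)]
    have hfac : ∀ i : {i // i ∉ T}, ∑ e, (P e *
        if (i : Fin m) ∈ S then Set.indicator (H a : Set E) 1 e else 1) =
        if (i : Fin m) ∈ S then mass P (H a : Set E) else 1 := by
      intro i
      by_cases hi : (i : Fin m) ∈ S
      · simp only [hi, if_true, mass]
        refine Finset.sum_congr rfl fun e _ => ?_
        by_cases he : e ∈ (H a : Set E) <;> simp [he]
      · simp [hi, hs]
    simp only [hfac]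
    rw [Finset.prod_ite, Finset.prod_const_one, mul_one, Finset.prod_const]
    have hcard : (Finset.univ.filter fun i : {i // i ∉ T} => (i : Fin m) ∈ S).card = S.card := by
      refine Finset.card_bij (fun i _ => (i : Fin m)) (fun i hi => (Finset.mem_filter.1 hi).2)
        (fun i _ j _ h => Subtype.ext h) (fun i hi => ?_)
      exact ⟨⟨i, Finset.disjoint_left.1 hST hi⟩, by simp [hi], rfl⟩
    rw [hcard]
    split_ifs with hm
    · gcongr
      exact mass_nonneg hP _
    · rw [zero_mul]
      positivity
  refine (Finset.sum_le_sum fun a _ => hθ a).trans ?_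
  rw [← Finset.sum_mul, ← Fintype.prod_sum (fun (_ : T) e => P e)]
  simp [hs]

/-- Uniform convergence over subspaces: with high probability, every subspace that contains many
samples has large mass. -/
theorem iidProb_exists_subspace_le (hP : ∀ e, 0 ≤ P e) (hs : ∑ e, P e = 1) {θ : ℝ}
    (hθ₀ : 0 ≤ θ) (hθ : θ ≤ 1) (k : ℕ) :
    iidProb P m {s | ∃ V : Submodule (ZMod p) E,
      k + Module.finrank (ZMod p) E ≤ Nat.card {i | s i ∈ V} ∧ mass P (V : Set E) < θ} ≤
      4 ^ m * θ ^ k := by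
  classical
  let B : Finset (Fin m) × Finset (Fin m) → Set (Fin m → E) := fun TS =>
    if Disjoint TS.2 TS.1 ∧ k ≤ TS.2.card then
      {s | (∀ i ∈ TS.2, s i ∈ Submodule.span (ZMod p) (Set.range fun i : TS.1 => s i)) ∧
        mass P (Submodule.span (ZMod p) (Set.range fun i : TS.1 => s i) : Set E) < θ}
    else ∅
  have hsub : {s | ∃ V : Submodule (ZMod p) E,
      k + Module.finrank (ZMod p) E ≤ Nat.card {i | s i ∈ V} ∧ mass P (V : Set E) < θ} ⊆
      ⋃ TS, B TS := by
    rintro s ⟨V, hV, hm⟩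
    obtain ⟨b, hb, -, hspan, hli⟩ := exists_linearIndepOn_extension (K := ZMod p) (v := s)
      (s := ∅) (t := {i | s i ∈ V}) (linearIndepOn_empty _ _) (Set.empty_subset _)
    set T : Finset (Fin m) := b.toFinset with hT
    set J : Finset (Fin m) := Finset.univ.filter fun i => s i ∈ V with hJ
    have hrange : Set.range (fun i : T => s i) = s '' b := by
      ext x
      simp [hT]
    have hTJ : T ⊆ J := by
      intro i hi
      rw [hJ, Finset.mem_filter]
      exact ⟨Finset.mem_univ _, hb (by simpa [hT] using hi)⟩
    have hTcard : T.card ≤ Module.finrank (ZMod p) E := by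
      have := LinearIndependent.fintype_card_le_finrank hli
      rwa [← Set.toFinset_card] at this
    have hJcard : Nat.card {i | s i ∈ V} = J.card := by
      rw [Nat.card_eq_fintype_card, Fintype.card_subtype]
      rfl
    have hle : Submodule.span (ZMod p) (s '' b) ≤ V := by
      rw [Submodule.span_le]
      rintro _ ⟨i, hi, rfl⟩
      exact hb hi
    refine Set.mem_iUnion.2 ⟨(T, J \ T), ?_⟩
    have hcond : Disjoint (J \ T) T ∧ k ≤ (J \ T).card := by
      refine ⟨Finset.sdiff_disjoint, ?_⟩
      rw [Finset.card_sdiff_of_subset hTJ]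
      omega
    simp only [B]
    rw [if_pos hcond]
    refine ⟨fun i hi => ?_, ?_⟩
    · simp only [hrange]
      exact hspan ⟨i, by simpa [hJ] using (Finset.mem_sdiff.1 hi).1, rfl⟩
    · simp only [hrange]
      exact (mass_mono hP hle).trans_lt hm
  refine (iidProb_mono hP hsub).trans ((iidProb_iUnion_le hP B).trans ?_)
  have hB : ∀ TS, iidProb P m (B TS) ≤ θ ^ k := by
    intro TS
    by_cases hc : Disjoint TS.2 TS.1 ∧ k ≤ TS.2.card
    · simp only [B]
      rw [if_pos hc]
      exact (iidProb_mem_span_le hP hs hθ₀ TS.1 TS.2 hc.1).trans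
        (pow_le_pow_of_le_one hθ₀ hθ hc.2)
    · simp only [B]
      rw [if_neg hc]
      simp [iidProb, pow_nonneg hθ₀]
  refine (Finset.sum_le_sum fun TS _ => hB TS).trans ?_
  rw [Finset.sum_const, Finset.card_univ, Fintype.card_prod, Fintype.card_finset, Fintype.card_fin,
    nsmul_eq_mul]
  push_cast
  rw [← mul_pow]
  norm_num

end Subspaces

/-! ### Fourier analysis of derivatives -/

section FourierIdentities

variable {p n : ℕ} [Fact p.Prime]

lemma expect_eq_inv_mul_sum (g : (Fin n → ZMod p) → ℂ) :
    Finset.expect Finset.univ g = ((p : ℂ) ^ n)⁻¹ * ∑ x, g x := by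
  rw [Fintype.expect_eq_sum_div_card]
  simp [ZMod.card, div_eq_inv_mul]

lemma expect_eq_inv_mul_sum_real (g : (Fin n → ZMod p) → ℝ) :
    Finset.expect Finset.univ g = ((p : ℝ) ^ n)⁻¹ * ∑ x, g x := by
  rw [Fintype.expect_eq_sum_div_card]
  simp [ZMod.card, div_eq_inv_mul]

lemma card_pow_ne_zero (p n : ℕ) [Fact p.Prime] : ((p : ℂ) ^ n) ≠ 0 :=
  pow_ne_zero _ (by exact_mod_cast (Fact.out : p.Prime).ne_zero)

lemma card_pow_pos (p n : ℕ) [Fact p.Prime] : (0 : ℝ) < (p : ℝ) ^ n :=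
  pow_pos (by exact_mod_cast (Fact.out : p.Prime).pos) _

lemma conj_stdAddChar (a : ZMod p) :
    starRingEnd ℂ (ZMod.stdAddChar a) = ZMod.stdAddChar (-a) :=
  (AddChar.map_neg_eq_conj _ _).symm

lemma norm_stdAddChar (a : ZMod p) : ‖(ZMod.stdAddChar a : ℂ)‖ = 1 :=
  AddChar.norm_apply _ _

lemma sum_mul_stdAddChar (y : Fin n → ZMod p) (a : (Fin n → ZMod p) → ℂ) :
    ∑ k : Fin n → ZMod p, ZMod.stdAddChar (-(k ⬝ᵥ y)) * ∑ z, a z * ZMod.stdAddChar (z ⬝ᵥ k) =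
      (p : ℂ) ^ n * a y := by
  simp only [Finset.mul_sum]
  rw [Finset.sum_comm]
  have : ∀ z, ∑ k : Fin n → ZMod p, ZMod.stdAddChar (-(k ⬝ᵥ y)) *
      (a z * ZMod.stdAddChar (z ⬝ᵥ k)) = if z = y then (p : ℂ) ^ n * a z else 0 := by
    intro z
    have h1 : ∀ k : Fin n → ZMod p, ZMod.stdAddChar (-(k ⬝ᵥ y)) *
        (a z * ZMod.stdAddChar (z ⬝ᵥ k)) = a z * ZMod.stdAddChar (k ⬝ᵥ (z - y)) := by
      intro k
      rw [dotProduct_sub, sub_eq_neg_add, AddChar.map_add_eq_mul, dotProduct_comm z k]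
      ring
    simp only [h1, ← Finset.mul_sum, sum_stdAddChar_dotProduct, sub_eq_zero]
    split_ifs <;> ring
  simp [this]

/-- The autocorrelation of `g` is the Fourier transform of `|ĝ|²`. -/
lemma expect_mulDeriv (g : (Fin n → ZMod p) → ℂ) (k : Fin n → ZMod p) :
    Finset.expect Finset.univ (mulDeriv k g) =
      ∑ z, ((‖fourierCoeff g z‖ ^ 2 : ℝ) : ℂ) * ZMod.stdAddChar (z ⬝ᵥ k) := by
  have hN := card_pow_ne_zero p n
  have h1 : ∀ z, ((‖fourierCoeff g z‖ ^ 2 : ℝ) : ℂ) * ZMod.stdAddChar (z ⬝ᵥ k) =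
      ((p : ℂ) ^ n)⁻¹ * ((p : ℂ) ^ n)⁻¹ * ∑ x', ∑ x, g x * starRingEnd ℂ (g x') *
        ZMod.stdAddChar (z ⬝ᵥ (x' + k - x)) := by
    intro z
    push_cast
    rw [← Complex.mul_conj', fourierCoeff, expect_eq_inv_mul_sum, map_mul, map_sum]
    simp only [map_mul, map_inv₀, map_pow, Complex.conj_natCast, conj_stdAddChar, neg_neg]
    rw [mul_mul_mul_comm, Finset.sum_mul_sum, Finset.sum_comm, mul_assoc, Finset.sum_mul]
    congr 1
    refine Finset.sum_congr rfl fun x' _ => ?_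
    rw [Finset.sum_mul]
    refine Finset.sum_congr rfl fun x _ => ?_
    rw [dotProduct_sub, dotProduct_add, sub_eq_add_neg, AddChar.map_add_eq_mul,
      AddChar.map_add_eq_mul, dotProduct_comm z x, dotProduct_comm z x']
    ring
  simp only [h1, ← Finset.mul_sum]
  rw [Finset.sum_comm]
  have h2 : ∀ x', ∑ z, ∑ x, g x * starRingEnd ℂ (g x') *
      ZMod.stdAddChar (z ⬝ᵥ (x' + k - x)) = (p : ℂ) ^ n * mulDeriv k g x' := by
    intro x'
    rw [Finset.sum_comm]
    simp only [← Finset.mul_sum, sum_stdAddChar_dotProduct, sub_eq_zero]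
    simp only [mul_ite, mul_zero, Finset.sum_ite_eq, Finset.mem_univ, if_true, mulDeriv]
    ring
  simp only [h2, ← Finset.mul_sum]
  rw [expect_eq_inv_mul_sum]
  field_simp

lemma sum_norm_sq_fourierCoeff (g : (Fin n → ZMod p) → ℂ) (hg : ∀ x, ‖g x‖ = 1) :
    ∑ z, ‖fourierCoeff g z‖ ^ 2 = 1 := by
  have h := expect_mulDeriv g 0
  have h1 : mulDeriv 0 g = fun _ => 1 := by
    ext x
    simp [mulDeriv, Complex.mul_conj', hg]
  rw [h1] at h
  simp only [dotProduct_zero, AddChar.map_zero_eq_one, mul_one, Finset.expect_const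
    Finset.univ_nonempty] at h
  exact_mod_cast h.symm

lemma norm_mulDeriv {f : (Fin n → ZMod p) → ℂ} (hf : ∀ x, ‖f x‖ = 1) (h x : Fin n → ZMod p) :
    ‖mulDeriv h f x‖ = 1 := by
  simp [mulDeriv, hf]

lemma mulDeriv_comm (h k : Fin n → ZMod p) (f : (Fin n → ZMod p) → ℂ) :
    mulDeriv h (mulDeriv k f) = mulDeriv k (mulDeriv h f) := by
  ext x
  simp only [mulDeriv, map_mul, Complex.conj_conj, add_right_comm x h k]
  ring

lemma norm_sq_fourierCoeff_eq (g : (Fin n → ZMod p) → ℂ) (y : Fin n → ZMod p) :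
    ((‖fourierCoeff g y‖ ^ 2 : ℝ) : ℂ) = ((p : ℂ) ^ n)⁻¹ * ∑ k : Fin n → ZMod p,
      ZMod.stdAddChar (-(k ⬝ᵥ y)) * Finset.expect Finset.univ (mulDeriv k g) := by
  simp only [expect_mulDeriv]
  rw [sum_mul_stdAddChar, inv_mul_cancel_left₀ (card_pow_ne_zero p n)]

/-- The `U²` identity. -/
lemma sum_norm_sq_expect_mulDeriv (g : (Fin n → ZMod p) → ℂ) :
    ∑ k, ‖Finset.expect Finset.univ (mulDeriv k g)‖ ^ 2 =
      (p : ℝ) ^ n * ∑ z, (‖fourierCoeff g z‖ ^ 2) ^ 2 := by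
  have h : ((∑ k, ‖Finset.expect Finset.univ (mulDeriv k g)‖ ^ 2 : ℝ) : ℂ) =
      (((p : ℝ) ^ n * ∑ z, (‖fourierCoeff g z‖ ^ 2) ^ 2 : ℝ) : ℂ) := by
    have h1 : ∀ k, ((‖Finset.expect Finset.univ (mulDeriv k g)‖ ^ 2 : ℝ) : ℂ) =
        ∑ y, ((‖fourierCoeff g y‖ ^ 2 : ℝ) : ℂ) * (ZMod.stdAddChar (-(k ⬝ᵥ y)) *
          Finset.expect Finset.univ (mulDeriv k g)) := by
      intro k
      push_cast
      rw [← Complex.conj_mul']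
      conv_lhs => rw [expect_mulDeriv g k, map_sum, Finset.sum_mul, ← expect_mulDeriv g k]
      refine Finset.sum_congr rfl fun y _ => ?_
      rw [map_mul, conj_stdAddChar, Complex.conj_ofReal, dotProduct_comm k y]
      push_cast
      ring
    rw [Complex.ofReal_sum]
    simp only [h1]
    rw [Finset.sum_comm]
    simp only [← Finset.mul_sum]
    rw [Complex.ofReal_mul, Complex.ofReal_sum, Finset.mul_sum]
    refine Finset.sum_congr rfl fun y _ => ?_
    have hy := norm_sq_fourierCoeff_eq g y
    rw [eq_inv_mul_iff_mul_eq₀ (card_pow_ne_zero p n)] at hy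
    rw [← hy]
    push_cast
    ring
  exact_mod_cast h

/-- The weights `|(Δ_h f)^(y)|²`, as a function on `𝔽ₚⁿ × 𝔽ₚⁿ`. -/
def derivWeight (f : (Fin n → ZMod p) → ℂ) (v : (Fin n → ZMod p) × (Fin n → ZMod p)) : ℝ :=
  ‖fourierCoeff (mulDeriv v.1 f) v.2‖ ^ 2

/-- The probability distribution `(h, y) ↦ p⁻ⁿ |(Δ_h f)^(y)|²`. -/
def derivDist (f : (Fin n → ZMod p) → ℂ) (v : (Fin n → ZMod p) × (Fin n → ZMod p)) : ℝ :=
  ((p : ℝ) ^ n)⁻¹ * derivWeight f v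

lemma derivWeight_nonneg (f : (Fin n → ZMod p) → ℂ) (v) : 0 ≤ derivWeight f v :=
  sq_nonneg _

lemma derivDist_nonneg (f : (Fin n → ZMod p) → ℂ) (v) : 0 ≤ derivDist f v :=
  mul_nonneg (inv_nonneg.2 (card_pow_pos p n).le) (derivWeight_nonneg f v)

lemma sum_derivWeight {f : (Fin n → ZMod p) → ℂ} (hf : ∀ x, ‖f x‖ = 1)
    (h : Fin n → ZMod p) : ∑ y, derivWeight f (h, y) = 1 := by
  simp only [derivWeight]
  exact sum_norm_sq_fourierCoeff _ (norm_mulDeriv hf h)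

lemma derivWeight_le_one {f : (Fin n → ZMod p) → ℂ} (hf : ∀ x, ‖f x‖ = 1)
    (v) : derivWeight f v ≤ 1 := by
  rw [← sum_derivWeight hf v.1]
  exact Finset.single_le_sum (f := fun y => derivWeight f (v.1, y))
    (fun y _ => derivWeight_nonneg f _) (Finset.mem_univ v.2)

lemma sum_derivWeight_univ {f : (Fin n → ZMod p) → ℂ} (hf : ∀ x, ‖f x‖ = 1) :
    ∑ v, derivWeight f v = (p : ℝ) ^ n := by
  rw [Fintype.sum_prod_type]
  simp [sum_derivWeight hf, ZMod.card]

lemma sum_derivDist {f : (Fin n → ZMod p) → ℂ} (hf : ∀ x, ‖f x‖ = 1) :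
    ∑ v, derivDist f v = 1 := by
  simp only [derivDist, ← Finset.mul_sum, sum_derivWeight_univ hf]
  exact inv_mul_cancel₀ (card_pow_pos p n).ne'

lemma derivWeight_zero {f : (Fin n → ZMod p) → ℂ} (hf : ∀ x, ‖f x‖ = 1) :
    derivWeight f 0 = 1 := by
  have h1 : mulDeriv 0 f = fun _ => 1 := by
    ext x
    simp [mulDeriv, Complex.mul_conj', hf]
  simp [derivWeight, h1, fourierCoeff]

/-- The weights are their own symplectic Fourier transform. -/
lemma derivWeight_eq_sum (f : (Fin n → ZMod p) → ℂ) (v : (Fin n → ZMod p) × (Fin n → ZMod p)) :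
    (derivWeight f v : ℂ) = ∑ u : (Fin n → ZMod p) × (Fin n → ZMod p),
      (derivDist f u : ℂ) * ZMod.stdAddChar (u.2 ⬝ᵥ v.1 - u.1 ⬝ᵥ v.2) := by
  rw [derivWeight, norm_sq_fourierCoeff_eq, Fintype.sum_prod_type, Finset.mul_sum]
  refine Finset.sum_congr rfl fun k _ => ?_
  rw [mulDeriv_comm, expect_mulDeriv, Finset.mul_sum, Finset.mul_sum]
  refine Finset.sum_congr rfl fun z _ => ?_
  simp only [derivDist, derivWeight]
  rw [sub_eq_add_neg, AddChar.map_add_eq_mul]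
  push_cast
  ring

lemma gowersAverage_two (g : (Fin n → ZMod p) → ℂ) :
    gowersAverage 2 g = ((∑ z, (‖fourierCoeff g z‖ ^ 2) ^ 2 : ℝ) : ℂ) := by
  have h1 : ∀ φ : (Fin n → ZMod p) → ℂ, gowersAverage 1 φ =
      ((‖Finset.expect Finset.univ φ‖ ^ 2 : ℝ) : ℂ) := by
    intro φ
    simp only [gowersAverage]
    push_cast
    rw [← Complex.mul_conj', expect_eq_inv_mul_sum, expect_eq_inv_mul_sum φ]
    simp only [expect_eq_inv_mul_sum, map_mul, map_inv₀, map_pow, Complex.conj_natCast, map_sum]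
    rw [← Finset.mul_sum, Finset.sum_comm, mul_mul_mul_comm, Finset.sum_mul_sum, ← mul_assoc,
      Finset.sum_comm (s := Finset.univ) (t := Finset.univ)
        (f := fun i j => φ i * starRingEnd ℂ (φ j))]
    congr 1
    refine Finset.sum_congr rfl fun x _ => ?_
    simp only [mulDeriv]
    exact Equiv.sum_comp (Equiv.addLeft x) fun y => φ y * starRingEnd ℂ (φ x)
  rw [gowersAverage]
  simp only [h1]
  rw [expect_eq_inv_mul_sum, ← Complex.ofReal_sum, sum_norm_sq_expect_mulDeriv]
  push_cast
  rw [inv_mul_cancel_left₀ (card_pow_ne_zero p n)]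

lemma gowersAverage_three (f : (Fin n → ZMod p) → ℂ) :
    (gowersAverage 3 f).re = ((p : ℝ) ^ n)⁻¹ * ∑ v, derivWeight f v ^ 2 := by
  rw [gowersAverage]
  simp only [gowersAverage_two]
  rw [expect_eq_inv_mul_sum, ← Complex.ofReal_sum, Fintype.sum_prod_type]
  have : ((p : ℂ) ^ n)⁻¹ = ((((p : ℝ) ^ n)⁻¹ : ℝ) : ℂ) := by push_cast; rfl
  rw [this, ← Complex.ofReal_mul, Complex.ofReal_re]
  rfl

/-- Sets on which the weights are large have many differences with large weight. -/
lemma sq_sum_derivWeight_le {f : (Fin n → ZMod p) → ℂ} (hf : ∀ x, ‖f x‖ = 1)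
    (A : Finset ((Fin n → ZMod p) × (Fin n → ZMod p))) :
    (∑ v ∈ A, derivWeight f v) ^ 2 ≤ ∑ v ∈ A, ∑ v' ∈ A, derivWeight f (v - v') := by
  set χ : (Fin n → ZMod p) × (Fin n → ZMod p) → (Fin n → ZMod p) × (Fin n → ZMod p) → ℂ :=
    fun u v => ZMod.stdAddChar (u.2 ⬝ᵥ v.1 - u.1 ⬝ᵥ v.2) with hχ
  have hw : ∀ v, (derivWeight f v : ℂ) = ∑ u, (derivDist f u : ℂ) * χ u v :=
    derivWeight_eq_sum f
  have hχsub : ∀ u v v', χ u (v - v') = χ u v * starRingEnd ℂ (χ u v') := by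
    intro u v v'
    simp only [hχ, conj_stdAddChar, ← AddChar.map_add_eq_mul]
    congr 1
    simp only [Prod.fst_sub, Prod.snd_sub, dotProduct_sub]
    ring
  have h1 : ((∑ v ∈ A, derivWeight f v : ℝ) : ℂ) =
      ∑ u, (derivDist f u : ℂ) * ∑ v ∈ A, χ u v := by
    push_cast
    simp only [hw, Finset.mul_sum]
    exact Finset.sum_comm
  have h2 : ((∑ v ∈ A, ∑ v' ∈ A, derivWeight f (v - v') : ℝ) : ℂ) =
      ((∑ u, derivDist f u * ‖∑ v ∈ A, χ u v‖ ^ 2 : ℝ) : ℂ) := by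
    push_cast
    have h3 : ∀ u, (derivDist f u : ℂ) * (‖∑ v ∈ A, χ u v‖ : ℂ) ^ 2 =
        ∑ v ∈ A, ∑ v' ∈ A, (derivDist f u : ℂ) * (χ u v * starRingEnd ℂ (χ u v')) := by
      intro u
      rw [← Complex.mul_conj', map_sum, Finset.sum_mul_sum]
      simp only [Finset.mul_sum]
    simp only [hw, hχsub, h3]
    rw [Finset.sum_comm (s := Finset.univ)]
    refine Finset.sum_congr rfl fun v _ => ?_
    rw [Finset.sum_comm]
  have h2' := Complex.ofReal_injective h2
  rw [h2']
  have h3 : ∑ v ∈ A, derivWeight f v ≤ ∑ u, derivDist f u * ‖∑ v ∈ A, χ u v‖ := by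
    have hn : ‖((∑ v ∈ A, derivWeight f v : ℝ) : ℂ)‖ ≤
        ∑ u, derivDist f u * ‖∑ v ∈ A, χ u v‖ := by
      rw [h1]
      refine (norm_sum_le _ _).trans (Finset.sum_le_sum fun u _ => ?_)
      rw [norm_mul, Complex.norm_real, Real.norm_of_nonneg (derivDist_nonneg f u)]
    rw [Complex.norm_real] at hn
    exact (le_abs_self _).trans hn
  have h0 : 0 ≤ ∑ v ∈ A, derivWeight f v := Finset.sum_nonneg fun v _ => derivWeight_nonneg f v
  calc (∑ v ∈ A, derivWeight f v) ^ 2 ≤ (∑ u, derivDist f u * ‖∑ v ∈ A, χ u v‖) ^ 2 := by gcongr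
    _ ≤ (∑ u, derivDist f u) * ∑ u, derivDist f u * ‖∑ v ∈ A, χ u v‖ ^ 2 := by
        refine Finset.sum_sq_le_sum_mul_sum_of_sq_le_mul _ (fun u _ => derivDist_nonneg f u)
          (fun u _ => mul_nonneg (derivDist_nonneg f u) (sq_nonneg _)) fun u _ => le_of_eq ?_
        ring
    _ = _ := by rw [sum_derivDist hf, one_mul]

end FourierIdentities

/-! ### Sampling with the bit-flip oracle -/

section BitSampling

variable {n : ℕ}

/-- The vectors `|x⟩ ⊗ (|0⟩ + (-1)ᶜ|1⟩)/√2`, eigenvectors of every bit-flip oracle. -/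
def kickback (x : (Fin n → ZMod 2) × ZMod 2) (s : (Fin n → ZMod 2) × ZMod 2) : ℂ :=
  if s.1 = x.1 then ((Real.sqrt 2 : ℝ) : ℂ)⁻¹ * ZMod.stdAddChar (x.2 * s.2) else 0

lemma sum_norm_sq_kickback (x : (Fin n → ZMod 2) × ZMod 2) : ∑ s, ‖kickback x s‖ ^ 2 = 1 := by
  rw [Fintype.sum_prod_type, Finset.sum_eq_single x.1]
  · simp [kickback]
  · intro b _ hb
    simp [kickback, hb]
  · simp

lemma bitOracle_mulVec_kickback (f : (Fin n → ZMod 2) → ZMod 2)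
    (x : (Fin n → ZMod 2) × ZMod 2) :
    bitOracle f *ᵥ kickback x = (ZMod.stdAddChar (x.2 * f x.1) : ℂ) • kickback x := by
  ext s
  simp only [Matrix.mulVec, dotProduct, bitOracle, Matrix.of_apply, Pi.smul_apply, smul_eq_mul]
  rw [Finset.sum_eq_single (s.1, s.2 + f s.1)]
  · have h : s = (s.1, s.2 + f s.1 + f s.1) := by
      rw [add_assoc, CharTwo.add_self_eq_zero, add_zero]
    simp only [← h, if_true, one_mul, kickback]
    split_ifs with hx
    · rw [hx, mul_add, AddChar.map_add_eq_mul]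
      ring
    · simp
  · intro t _ ht
    rw [if_neg, zero_mul]
    intro h
    apply ht
    rw [h]
    simp only [add_assoc, CharTwo.add_self_eq_zero, add_zero]
  · simp

/-- The distribution of `(z, f z)` for uniform `z`. -/
def graphDist (f : (Fin n → ZMod 2) → ZMod 2) (c : (Fin n → ZMod 2) × ZMod 2) : ℝ :=
  if c.2 = f c.1 then ((2 : ℝ) ^ n)⁻¹ else 0

lemma graphDist_nonneg (f : (Fin n → ZMod 2) → ZMod 2) (c) : 0 ≤ graphDist f c := by
  unfold graphDist
  split_ifs <;> positivity

lemma sum_graphDist_mul (f : (Fin n → ZMod 2) → ZMod 2) (Y : (Fin n → ZMod 2) × ZMod 2 → ℝ) :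
    ∑ c, graphDist f c * Y c = ((2 : ℝ) ^ n)⁻¹ * ∑ z, Y (z, f z) := by
  rw [Fintype.sum_prod_type, Finset.mul_sum]
  refine Finset.sum_congr rfl fun z _ => ?_
  simp [graphDist, ite_mul]

lemma sum_graphDist (f : (Fin n → ZMod 2) → ZMod 2) : ∑ c, graphDist f c = 1 := by
  have := sum_graphDist_mul f (fun _ => 1)
  simpa [ZMod.card] using this

lemma fourierCoeff_cons (g : (Fin n → ZMod 2) → ℂ) (d : ZMod 2) (y : Fin (n + 1) → ZMod 2) :
    fourierCoeff (fun a : Fin (n + 1) → ZMod 2 => g (Fin.tail a) * ZMod.stdAddChar (a 0 * d)) y =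
      if y 0 = d then fourierCoeff g (Fin.tail y) else 0 := by
  simp only [fourierCoeff, expect_eq_inv_mul_sum]
  have hsum : ∀ Ψ : (Fin (n + 1) → ZMod 2) → ℂ,
      ∑ a, Ψ a = ∑ c : ZMod 2, ∑ x : Fin n → ZMod 2, Ψ (Fin.cons c x) := by
    intro Ψ
    rw [← (Fin.consEquiv fun _ : Fin (n + 1) => ZMod 2).sum_comp, Fintype.sum_prod_type]
    rfl
  have h : ∀ (c : ZMod 2) (x : Fin n → ZMod 2),
      g (Fin.tail (Fin.cons c x : Fin (n + 1) → ZMod 2)) *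
        ZMod.stdAddChar ((Fin.cons c x : Fin (n + 1) → ZMod 2) 0 * d) *
        ZMod.stdAddChar (-((Fin.cons c x : Fin (n + 1) → ZMod 2) ⬝ᵥ y)) =
      (ZMod.stdAddChar (c * (d - y 0)) : ℂ) *
        (g x * ZMod.stdAddChar (-(x ⬝ᵥ Fin.tail y))) := by
    intro c x
    have : (Fin.cons c x : Fin (n + 1) → ZMod 2) ⬝ᵥ y = c * y 0 + x ⬝ᵥ Fin.tail y := by
      simp [dotProduct, Fin.sum_univ_succ, Fin.tail]
    rw [this, neg_add, AddChar.map_add_eq_mul, mul_sub, sub_eq_add_neg, AddChar.map_add_eq_mul]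
    simp only [Fin.tail_cons, Fin.cons_zero]
    ring
  rw [hsum]
  simp only [h, ← Finset.mul_sum, ← Finset.sum_mul]
  have h2 : ∑ c : ZMod 2, (ZMod.stdAddChar (c * (d - y 0)) : ℂ) = if y 0 = d then 2 else 0 := by
    have := AddChar.sum_mulShift (R := ZMod 2) (R' := ℂ) (d - y 0) (ZMod.isPrimitive_stdAddChar 2)
    simp only [ZMod.card, sub_eq_zero, @eq_comm _ d] at this
    simpa [mul_comm] using this
  rw [h2]
  split_ifs
  · push_cast
    rw [pow_succ]
    field_simp
  · simp

/-- The regrouping of a measurement outcome into a sample of `derivDist` and one of `graphDist`. -/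
def regroup (n : ℕ) : (Fin (n + 1) → ZMod 2) × ((Fin n → ZMod 2) × (Fin n → ZMod 2)) ≃
    ((Fin n → ZMod 2) × (Fin n → ZMod 2)) × ((Fin n → ZMod 2) × ZMod 2) where
  toFun r := ((r.2.1, Fin.tail r.1), (r.2.2, r.1 0))
  invFun t := (Fin.cons t.2.2 t.1.2, (t.1.1, t.2.1))
  left_inv r := by simp
  right_inv t := by simp

/-- With three queries to a bit-flip oracle per sample, one obtains independent samples from
`derivDist` and `graphDist`. -/
theorem exists_bitSampling {R : Type} (m : ℕ)
    (out : (Fin m → (Fin n → ZMod 2) × (Fin n → ZMod 2)) →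
      (Fin m → (Fin n → ZMod 2) × ZMod 2) → R) :
    ∃ A : QueryAlgorithm ((Fin n → ZMod 2) × ZMod 2) R, A.queries = m * 3 ∧
      ∀ (f : (Fin n → ZMod 2) → ZMod 2) (S : Set R)
        (good : Set (Fin m → (Fin n → ZMod 2) × (Fin n → ZMod 2))) (a b : ℝ), 0 ≤ b →
        a ≤ iidProb (derivDist fun x => (ZMod.stdAddChar (f x) : ℂ)) m good →
        (∀ s ∈ good, b ≤ iidProb (graphDist f) m {c | out s c ∈ S}) →
        a * b ≤ A.prob (bitOracle f) S := by
  obtain ⟨A, hA, h⟩ := exists_fourierSampling (p := 2) (k := n + 1)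
    (Z := (Fin n → ZMod 2) × (Fin n → ZMod 2)) (κ := Fin 3)
    (kickback (n := n)) sum_norm_sq_kickback 0
    (fun j r => ![(Fin.tail r.1, 1), (Fin.tail r.1 + r.2.1, 1), (r.2.2, r.1 0)] j) m
    (fun w => out (fun i => (regroup n (w i)).1) (fun i => (regroup n (w i)).2))
  refine ⟨A, by simpa using hA, fun f S good a b hb ha hgood => ?_⟩
  rw [h (bitOracle f) (fun x => ZMod.stdAddChar (x.2 * f x.1)) (bitOracle_mulVec_kickback f) S]
  have hD : ∀ r : (Fin (n + 1) → ZMod 2) × ((Fin n → ZMod 2) × (Fin n → ZMod 2)),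
      (Fintype.card ((Fin n → ZMod 2) × (Fin n → ZMod 2)) : ℝ)⁻¹ *
        ‖fourierCoeff (fun x => ∏ j : Fin 3, (ZMod.stdAddChar
          ((![(Fin.tail x, 1), (Fin.tail x + r.2.1, 1), (r.2.2, x 0)] j :
            (Fin n → ZMod 2) × ZMod 2).2 *
          f (![(Fin.tail x, 1), (Fin.tail x + r.2.1, 1), (r.2.2, x 0)] j :
            (Fin n → ZMod 2) × ZMod 2).1) : ℂ)) r.1‖ ^ 2 =
      derivDist (fun x => (ZMod.stdAddChar (f x) : ℂ)) (regroup n r).1 *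
        graphDist f (regroup n r).2 := by
    intro r
    have hφ : (fun x => ∏ j : Fin 3, (ZMod.stdAddChar
          ((![(Fin.tail x, 1), (Fin.tail x + r.2.1, 1), (r.2.2, x 0)] j :
            (Fin n → ZMod 2) × ZMod 2).2 *
          f (![(Fin.tail x, 1), (Fin.tail x + r.2.1, 1), (r.2.2, x 0)] j :
            (Fin n → ZMod 2) × ZMod 2).1) : ℂ)) =
        fun x : Fin (n + 1) → ZMod 2 => mulDeriv r.2.1 (fun x => (ZMod.stdAddChar (f x) : ℂ))
          (Fin.tail x) * ZMod.stdAddChar (x 0 * f r.2.2) := by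
      ext x
      simp only [Fin.prod_univ_three, mulDeriv, conj_stdAddChar, ZMod.neg_eq_self_mod_two,
        Matrix.cons_val_zero, Matrix.cons_val_one, Matrix.cons_val_two, Matrix.head_cons,
        Matrix.tail_cons, one_mul]
      simp [mul_comm]
    rw [hφ, fourierCoeff_cons]
    simp only [regroup, Equiv.coe_fn_mk, derivDist, derivWeight, graphDist, Fintype.card_prod,
      Fintype.card_fun, ZMod.card, Fintype.card_fin]
    push_cast
    by_cases hy : r.1 0 = f r.2.2
    · simp only [hy, if_true, mul_inv]
      ring
    · simp [hy]
  simp only [hD]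
  exact mul_le_iidProb_of_equiv (regroup n)
    (D := fun r => derivDist (fun x => (ZMod.stdAddChar (f x) : ℂ)) (regroup n r).1 *
        graphDist f (regroup n r).2) (fun _ => rfl) (derivDist_nonneg _)
    {t | out t.1 t.2 ∈ S} good hb ha (graphDist_nonneg f) hgood

end BitSampling

/-! ### Empirical mass maximization over subspaces -/

section Empirical

variable {p : ℕ} [Fact p.Prime] {E : Type} [AddCommGroup E] [Module (ZMod p) E] [Fintype E]
  {P : E → ℝ} {m : ℕ}

/-- With high probability, a given subspace of mass at least `θ` contains more than half of the
expected number of samples, and every subspace that does has mass at least `exp (-24/θ)`. -/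
theorem le_iidProb_subspace (hP : ∀ e, 0 ≤ P e) (hs : ∑ e, P e = 1) {θ : ℝ} (hθ₀ : 0 < θ)
    (hθ : θ ≤ 1) (h8 : 8 ≤ θ * m) (hm : 4 * (Module.finrank (ZMod p) E : ℝ) ≤ θ * m)
    (V₀ : Submodule (ZMod p) E) (hV₀ : θ ≤ mass P (V₀ : Set E)) :
    1 - 2 * Real.exp (-(m * θ ^ 2 / 64)) ≤ iidProb P m
      {s | θ * m / 2 < (Nat.card {i | s i ∈ V₀} : ℝ) ∧ ∀ V : Submodule (ZMod p) E,
        θ * m / 2 < (Nat.card {i | s i ∈ V} : ℝ) → Real.exp (-(24 / θ)) ≤ mass P (V : Set E)} := by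
  classical
  have hcard : ∀ (V : Submodule (ZMod p) E) (s : Fin m → E), (Nat.card {i | s i ∈ V} : ℝ) =
      ∑ i, Set.indicator (V : Set E) 1 (s i) := by
    intro V s
    rw [Nat.card_eq_fintype_card, Fintype.card_subtype]
    simp [Set.indicator_apply]
  set k : ℕ := ⌊θ * m / 4⌋₊ with hk
  have hk1 : (k : ℝ) ≤ θ * m / 4 := Nat.floor_le (by positivity)
  have hk2 : θ * m / 8 ≤ k := by
    have := Nat.lt_floor_add_one (θ * m / 4)
    rw [← hk] at this
    linarith
  set B₁ : Set (Fin m → E) := {s | ∑ i, Set.indicator (V₀ : Set E) 1 (s i) ≤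
    m * (∑ a, P a * Set.indicator (V₀ : Set E) 1 a - θ / 2)} with hB₁
  set B₂ : Set (Fin m → E) := {s | ∃ V : Submodule (ZMod p) E,
      k + Module.finrank (ZMod p) E ≤ Nat.card {i | s i ∈ V} ∧
        mass P (V : Set E) < Real.exp (-(24 / θ))} with hB₂
  have h1 : iidProb P m B₁ ≤ Real.exp (-(m * θ ^ 2 / 64)) := by
    refine (iidProb_sum_le hP hs (Set.indicator (V₀ : Set E) 1) ?_ (by positivity)
      (by linarith)).trans (le_of_eq ?_)
    · intro a
      by_cases ha : a ∈ (V₀ : Set E) <;> simp [ha]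
    · congr 1
      ring
  have h2 : iidProb P m B₂ ≤ Real.exp (-(m * θ ^ 2 / 64)) := by
    refine (iidProb_exists_subspace_le hP hs (Real.exp_pos _).le
      (Real.exp_le_one_iff.2 (by rw [neg_nonpos]; positivity)) k).trans ?_
    have h4 : (4 : ℝ) ≤ Real.exp 2 := by
      have : (2 : ℝ) ≤ Real.exp 1 := by linarith [Real.add_one_le_exp (1 : ℝ)]
      calc (4 : ℝ) = 2 * 2 := by norm_num
        _ ≤ Real.exp 1 * Real.exp 1 := by gcongr
        _ = Real.exp 2 := by rw [← Real.exp_add]; norm_num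
    calc (4 : ℝ) ^ m * Real.exp (-(24 / θ)) ^ k ≤ Real.exp 2 ^ m * Real.exp (-(24 / θ)) ^ k := by
          gcongr
      _ = Real.exp (m * 2 + k * (-(24 / θ))) := by
          rw [← Real.exp_nat_mul, ← Real.exp_nat_mul, ← Real.exp_add]
      _ ≤ _ := by
          rw [Real.exp_le_exp]
          have h5 : 3 * (m : ℝ) ≤ k * (24 / θ) := by
            calc 3 * (m : ℝ) = θ * m / 8 * (24 / θ) := by field_simp; ring
              _ ≤ _ := by gcongr
          have h6 : (m : ℝ) * θ ^ 2 / 64 ≤ m := by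
            have : θ ^ 2 ≤ 1 := pow_le_one₀ hθ₀.le hθ
            have : (m : ℝ) * θ ^ 2 ≤ m * 1 := by gcongr
            linarith [(Nat.cast_nonneg m : (0 : ℝ) ≤ m)]
          linarith
  have h3 : (B₁ ∪ B₂)ᶜ ⊆ {s | θ * m / 2 < (Nat.card {i | s i ∈ V₀} : ℝ) ∧
      ∀ V : Submodule (ZMod p) E, θ * m / 2 < (Nat.card {i | s i ∈ V} : ℝ) →
        Real.exp (-(24 / θ)) ≤ mass P (V : Set E)} := by
    intro s hs'
    rw [Set.compl_union] at hs'
    obtain ⟨hs1, hs2⟩ := hs'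
    refine ⟨?_, fun V hV => ?_⟩
    · rw [hB₁, Set.mem_compl_iff, Set.mem_ofPred_eq, not_le] at hs1
      rw [hcard]
      refine lt_of_le_of_lt ?_ hs1
      have : ∑ a, P a * Set.indicator (V₀ : Set E) 1 a = mass P (V₀ : Set E) := by
        refine Finset.sum_congr rfl fun a _ => ?_
        by_cases ha : a ∈ (V₀ : Set E) <;> simp [ha]
      rw [this]
      have : (m : ℝ) * (θ / 2) ≤ m * (mass P (V₀ : Set E) - θ / 2) := by
        gcongr
        linarith
      linarith
    · by_contra hlt
      push Not at hlt
      refine hs2 ⟨V, ?_, hlt⟩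
      have : ((k + Module.finrank (ZMod p) E : ℕ) : ℝ) ≤ (Nat.card {i | s i ∈ V} : ℝ) := by
        push_cast
        linarith
      exact_mod_cast this
  refine le_trans ?_ (iidProb_mono hP h3)
  rw [iidProb_compl hs]
  linarith [iidProb_union_le hP B₁ B₂]

end Empirical

/-! ### Decoding quadratic Reed-Muller codes -/

section Quadratic

variable {n : ℕ}

lemma exists_matrix_of_totalDegree_le_two {K : Type} [Field K] (P : MvPolynomial (Fin n) K)
    (hP : P.totalDegree ≤ 2) :
    ∃ M : Matrix (Fin n) (Fin n) K, ∀ x h, MvPolynomial.eval (x + h) P =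
      MvPolynomial.eval x P + MvPolynomial.eval h P - MvPolynomial.eval 0 P + x ⬝ᵥ (M *ᵥ h) := by
  classical
  have hmon : ∀ s ∈ P.support, ∃ M : Matrix (Fin n) (Fin n) K, ∀ x h,
      MvPolynomial.eval (x + h) (MvPolynomial.monomial s (P.coeff s)) =
      MvPolynomial.eval x (MvPolynomial.monomial s (P.coeff s)) +
      MvPolynomial.eval h (MvPolynomial.monomial s (P.coeff s)) -
      MvPolynomial.eval 0 (MvPolynomial.monomial s (P.coeff s)) + x ⬝ᵥ (M *ᵥ h) := by
    intro s hs
    have hdeg : Multiset.card (Finsupp.toMultiset s) ≤ 2 := by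
      rw [Finsupp.card_toMultiset]
      exact (MvPolynomial.le_totalDegree hs).trans hP
    have heval : ∀ x : Fin n → K, MvPolynomial.eval x (MvPolynomial.monomial s (P.coeff s)) =
        P.coeff s * ((Finsupp.toMultiset s).map x).prod := by
      intro x
      rw [MvPolynomial.eval_monomial, Finsupp.toMultiset_map, Finsupp.prod_toMultiset,
        Finsupp.prod_mapDomain_index (by simp) (by simp [pow_add])]
    simp only [heval]
    generalize P.coeff s = c
    generalize Finsupp.toMultiset s = t at hdeg
    obtain h0 | h1 | h2 : Multiset.card t = 0 ∨ Multiset.card t = 1 ∨ Multiset.card t = 2 := by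
      omega
    · obtain rfl := Multiset.card_eq_zero.1 h0
      exact ⟨0, fun x h => by simp⟩
    · obtain ⟨i, rfl⟩ := Multiset.card_eq_one.1 h1
      exact ⟨0, fun x h => by simp [mul_add]⟩
    · obtain ⟨i, j, rfl⟩ := Multiset.card_eq_two.1 h2
      refine ⟨Matrix.single i j c + Matrix.single j i c, fun x h => ?_⟩
      simp only [Multiset.insert_eq_cons, Multiset.map_cons, Multiset.map_singleton,
        Multiset.prod_cons, Multiset.prod_singleton, Pi.add_apply, Pi.zero_apply,
        Matrix.add_mulVec, dotProduct_add, Matrix.single_mulVec]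
      simp [Function.update_apply, dotProduct]
      ring
  choose! M hM using hmon
  refine ⟨∑ s ∈ P.support, M s, fun x h => ?_⟩
  have hsum : ∀ y, MvPolynomial.eval y P =
      ∑ s ∈ P.support, MvPolynomial.eval y (MvPolynomial.monomial s (P.coeff s)) := by
    intro y
    conv_lhs => rw [P.as_sum, map_sum]
  simp only [hsum, Matrix.sum_mulVec, dotProduct_sum]
  rw [← Finset.sum_add_distrib, ← Finset.sum_sub_distrib, ← Finset.sum_add_distrib]
  exact Finset.sum_congr rfl fun s hs => hM s hs x h

/-- The sign `(-1)ᵃ`. -/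
def sign (a : ZMod 2) : ℝ := if a = 0 then 1 else -1

lemma zmod_two_cases (a : ZMod 2) : a = 0 ∨ a = 1 := by
  revert a
  decide

lemma sign_add_one (a : ZMod 2) : sign (a + 1) = -sign a := by
  rcases zmod_two_cases a with rfl | rfl
  · simp [sign]
  · simp [sign, CharTwo.add_self_eq_zero]

lemma abs_sign (a : ZMod 2) : |sign a| = 1 := by
  unfold sign
  split_ifs <;> simp

lemma stdAddChar_eq_sign (a : ZMod 2) : (ZMod.stdAddChar a : ℂ) = (sign a : ℂ) := by
  rcases zmod_two_cases a with rfl | rfl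
  · simp [sign]
  · have h := ZMod.stdAddChar_coe (N := 2) 1
    have h2 : (2 * Real.pi * Complex.I * ((1 : ℤ) : ℂ) / ((2 : ℕ) : ℂ)) = Real.pi * Complex.I := by
      push_cast
      ring
    rw [h2, Complex.exp_pi_mul_I] at h
    simpa [sign] using h

/-- The correlation `𝔼ₓ (-1)^(f x + g x)`. -/
def corr (f g : (Fin n → ZMod 2) → ZMod 2) : ℝ := ((2 : ℝ) ^ n)⁻¹ * ∑ x, sign (f x + g x)

lemma relDist_eq (f g : (Fin n → ZMod 2) → ZMod 2) : relDist f g = (1 - corr f g) / 2 := by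
  have h : ∀ x, sign (f x + g x) = 1 - 2 * (if f x ≠ g x then (1 : ℝ) else 0) := by
    intro x
    by_cases hx : f x = g x
    · simp [hx, sign, CharTwo.add_self_eq_zero]
    · have : f x + g x ≠ 0 := by
        rwa [Ne, ← CharTwo.sub_eq_add, sub_eq_zero]
      simp only [sign, this, if_false, ne_eq, hx, not_false_eq_true, if_true]
      norm_num
  rw [corr, relDist, hammingDist]
  simp only [h, Finset.sum_sub_distrib, ← Finset.mul_sum]
  rw [Finset.sum_boole]
  simp only [Finset.sum_const, Finset.card_univ, Fintype.card_fun, ZMod.card, Fintype.card_fin,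
    nsmul_eq_mul, mul_one]
  push_cast
  field_simp
  ring

/-- The quadratic `q` with an affine function added. -/
def plusAffine (q : MvPolynomial (Fin n) (ZMod 2)) (t : (Fin n → ZMod 2) × ZMod 2) :
    MvPolynomial (Fin n) (ZMod 2) :=
  q + ((∑ i, MvPolynomial.C (t.1 i) * MvPolynomial.X i) + MvPolynomial.C t.2)

lemma eval_plusAffine (q : MvPolynomial (Fin n) (ZMod 2)) (t : (Fin n → ZMod 2) × ZMod 2)
    (x : Fin n → ZMod 2) :
    MvPolynomial.eval x (plusAffine q t) = MvPolynomial.eval x q + (x ⬝ᵥ t.1 + t.2) := by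
  simp [plusAffine, dotProduct, mul_comm]

lemma totalDegree_plusAffine_le {q : MvPolynomial (Fin n) (ZMod 2)} (hq : q.totalDegree ≤ 2)
    (t : (Fin n → ZMod 2) × ZMod 2) : (plusAffine q t).totalDegree ≤ 2 := by
  refine (MvPolynomial.totalDegree_add _ _).trans (max_le hq ?_)
  refine (MvPolynomial.totalDegree_add _ _).trans (max_le ?_ (by simp))
  refine MvPolynomial.totalDegree_finsetSum_le fun i _ => ?_
  refine (MvPolynomial.totalDegree_mul _ _).trans ?_
  simp

lemma fourierCoeff_sub_eq_corr (f : (Fin n → ZMod 2) → ZMod 2)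
    (q : MvPolynomial (Fin n) (ZMod 2)) (z : Fin n → ZMod 2) :
    fourierCoeff (fun x => (ZMod.stdAddChar (f x - MvPolynomial.eval x q) : ℂ)) z =
      (corr f (fun x => MvPolynomial.eval x (plusAffine q (z, 0))) : ℂ) := by
  rw [fourierCoeff, expect_eq_inv_mul_sum, corr]
  push_cast
  congr 1
  refine Finset.sum_congr rfl fun x _ => ?_
  rw [← AddChar.map_add_eq_mul, stdAddChar_eq_sign, eval_plusAffine, CharTwo.sub_eq_add,
    CharTwo.neg_eq, add_zero, add_assoc]

lemma corr_plusAffine_one (f : (Fin n → ZMod 2) → ZMod 2) (q : MvPolynomial (Fin n) (ZMod 2))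
    (z : Fin n → ZMod 2) :
    corr f (fun x => MvPolynomial.eval x (plusAffine q (z, 1))) =
      -corr f (fun x => MvPolynomial.eval x (plusAffine q (z, 0))) := by
  simp only [corr, eval_plusAffine, add_zero, ← add_assoc, sign_add_one, Finset.sum_neg_distrib,
    mul_neg]

/-- The mass of the graph of the bilinear form of a quadratic `q` is `∑ |ĝ|⁴`, where `g` is the
phase of `f - q`. -/
lemma mass_graph_eq (f : (Fin n → ZMod 2) → ZMod 2) (q : MvPolynomial (Fin n) (ZMod 2))
    (M : Matrix (Fin n) (Fin n) (ZMod 2))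
    (hM : ∀ x h, MvPolynomial.eval (x + h) q =
      MvPolynomial.eval x q + MvPolynomial.eval h q - MvPolynomial.eval 0 q + x ⬝ᵥ (M *ᵥ h)) :
    mass (derivDist fun x => (ZMod.stdAddChar (f x) : ℂ)) (M.mulVecLin.graph : Set _) =
      ∑ z, (corr f (fun x => MvPolynomial.eval x (plusAffine q (z, 0))) ^ 2) ^ 2 := by
  set g : (Fin n → ZMod 2) → ℂ := fun x => ZMod.stdAddChar (f x - MvPolynomial.eval x q) with hg
  have h1 : ∀ h, derivWeight (fun x => (ZMod.stdAddChar (f x) : ℂ)) (h, M *ᵥ h) =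
      ‖Finset.expect Finset.univ (mulDeriv h g)‖ ^ 2 := by
    intro h
    have h2 : Finset.expect Finset.univ (mulDeriv h g) =
        ZMod.stdAddChar (-(MvPolynomial.eval h q - MvPolynomial.eval 0 q)) *
        fourierCoeff (mulDeriv h fun x => (ZMod.stdAddChar (f x) : ℂ)) (M *ᵥ h) := by
      rw [fourierCoeff, Finset.mul_expect]
      refine Finset.expect_congr rfl fun x _ => ?_
      simp only [hg, mulDeriv, conj_stdAddChar, ← AddChar.map_add_eq_mul, hM]
      congr 1
      ring
    rw [h2, norm_mul, norm_stdAddChar, one_mul, derivWeight]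
  have h3 : mass (derivDist fun x => (ZMod.stdAddChar (f x) : ℂ)) (M.mulVecLin.graph : Set _) =
      ((2 : ℝ) ^ n)⁻¹ * ∑ h, ‖Finset.expect Finset.univ (mulDeriv h g)‖ ^ 2 := by
    rw [mass, Fintype.sum_prod_type, Finset.mul_sum]
    refine Finset.sum_congr rfl fun h _ => ?_
    rw [Finset.sum_eq_single (M *ᵥ h)]
    · rw [Set.indicator_of_mem (by simp), derivDist, h1]
      simp
    · intro y _ hy
      exact Set.indicator_of_notMem (by simpa using hy) _
    · simp
  rw [h3, sum_norm_sq_expect_mulDeriv]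
  push_cast
  rw [inv_mul_cancel_left₀ (by positivity)]
  refine Finset.sum_congr rfl fun z _ => ?_
  rw [hg, fourierCoeff_sub_eq_corr, Complex.norm_real, Real.norm_eq_abs, sq_abs]

lemma exists_corr_of_mass (f : (Fin n → ZMod 2) → ZMod 2) (q : MvPolynomial (Fin n) (ZMod 2))
    (M : Matrix (Fin n) (Fin n) (ZMod 2))
    (hM : ∀ x h, MvPolynomial.eval (x + h) q =
      MvPolynomial.eval x q + MvPolynomial.eval h q - MvPolynomial.eval 0 q + x ⬝ᵥ (M *ᵥ h))
    {ρ : ℝ} (hmass : ρ ^ 2 ≤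
      mass (derivDist fun x => (ZMod.stdAddChar (f x) : ℂ)) (M.mulVecLin.graph : Set _)) :
    ∃ t, ρ ≤ corr f (fun x => MvPolynomial.eval x (plusAffine q t)) := by
  rw [mass_graph_eq f q M hM] at hmass
  have hsum : ∑ z, corr f (fun x => MvPolynomial.eval x (plusAffine q (z, 0))) ^ 2 = 1 := by
    have := sum_norm_sq_fourierCoeff
      (fun x => (ZMod.stdAddChar (f x - MvPolynomial.eval x q) : ℂ)) (fun x => norm_stdAddChar _)
    simpa only [fourierCoeff_sub_eq_corr, Complex.norm_real, Real.norm_eq_abs, sq_abs] using this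
  obtain ⟨z, hz⟩ : ∃ z, ρ ^ 2 ≤
      corr f (fun x => MvPolynomial.eval x (plusAffine q (z, 0))) ^ 2 := by
    by_contra! hlt
    have : ∑ z, (corr f (fun x => MvPolynomial.eval x (plusAffine q (z, 0))) ^ 2) ^ 2 < ρ ^ 2 := by
      calc _ < ∑ z, ρ ^ 2 * corr f (fun x => MvPolynomial.eval x (plusAffine q (z, 0))) ^ 2 := by
            obtain ⟨z₀, -, hz₀⟩ := Finset.exists_ne_zero_of_sum_ne_zero (hsum ▸ one_ne_zero)
            refine Finset.sum_lt_sum (fun z _ => ?_) ⟨z₀, Finset.mem_univ _, ?_⟩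
            · rw [sq (_ ^ 2)]
              exact mul_le_mul_of_nonneg_right (hlt z).le (sq_nonneg _)
            · rw [sq (_ ^ 2)]
              exact mul_lt_mul_of_pos_right (hlt z₀) (lt_of_le_of_ne (sq_nonneg _) hz₀.symm)
        _ = ρ ^ 2 := by rw [← Finset.mul_sum, hsum, mul_one]
    linarith
  rw [sq_le_sq] at hz
  rcases abs_cases (corr f (fun x => MvPolynomial.eval x (plusAffine q (z, 0)))) with h | h
  · exact ⟨(z, 0), (le_abs_self ρ).trans (by rw [← h.1]; exact hz)⟩
  · refine ⟨(z, 1), (le_abs_self ρ).trans ?_⟩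
    rw [corr_plusAffine_one, ← h.1]
    exact hz

lemma exists_quadratic_of_distRM2 {f : (Fin n → ZMod 2) → ZMod 2} {δ : ℝ} (h : distRM2 f ≤ δ) :
    ∃ q : MvPolynomial (Fin n) (ZMod 2), q.totalDegree ≤ 2 ∧
      1 - 2 * δ ≤ corr f (fun x => MvPolynomial.eval x q) := by
  have hne : (relDist f '' RM2 n).Nonempty := ⟨_, 0, ⟨0, by simp, fun x => rfl⟩, rfl⟩
  obtain ⟨c, ⟨q, hq, hc⟩, hd⟩ := hne.csInf_mem ((Set.toFinite (RM2 n)).image _)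
  refine ⟨q, hq, ?_⟩
  have h1 : relDist f c ≤ δ := hd.le.trans h
  rw [relDist_eq, funext hc] at h1
  linarith

/-- Choosing the affine part of a quadratic by its empirical correlation. -/
lemma le_iidProb_affine (f : (Fin n → ZMod 2) → ZMod 2) (q : MvPolynomial (Fin n) (ZMod 2))
    {ρ : ℝ} (hρ₀ : 0 < ρ) (hρ : ρ ≤ 1) (m : ℕ) :
    1 - 2 ^ (n + 2) * Real.exp (-(m * ρ ^ 2 / 256)) ≤ iidProb (graphDist f) m
      {c | ∀ t, |∑ i, sign ((c i).2 + MvPolynomial.eval (c i).1 (plusAffine q t)) -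
        m * corr f (fun x => MvPolynomial.eval x (plusAffine q t))| < m * (ρ / 4)} := by
  set Y : (Fin n → ZMod 2) × ZMod 2 → (Fin n → ZMod 2) × ZMod 2 → ℝ := fun t c =>
    sign (c.2 + MvPolynomial.eval c.1 (plusAffine q t)) with hY
  have hmean : ∀ t, ∑ c, graphDist f c * Y t c =
      corr f (fun x => MvPolynomial.eval x (plusAffine q t)) := fun t => sum_graphDist_mul f (Y t)
  set B : ((Fin n → ZMod 2) × ZMod 2) × Bool → Set (Fin m → (Fin n → ZMod 2) × ZMod 2) :=
    fun t => {c | ∑ i, (if t.2 then Y t.1 (c i) else -Y t.1 (c i)) ≤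
      m * (∑ a, graphDist f a * (if t.2 then Y t.1 a else -Y t.1 a) - ρ / 4)} with hB
  have hBle : ∀ t, iidProb (graphDist f) m (B t) ≤ Real.exp (-(m * ρ ^ 2 / 256)) := by
    intro t
    refine (iidProb_sum_le (graphDist_nonneg f) (sum_graphDist f)
      (fun c => if t.2 then Y t.1 c else -Y t.1 c) ?_ (by positivity)
      (by linarith)).trans (le_of_eq ?_)
    · intro a
      split_ifs
      · exact (abs_sign _).le
      · rw [abs_neg]
        exact (abs_sign _).le
    · congr 1
      ring
  have hunion : iidProb (graphDist f) m (⋃ t, B t) ≤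
      2 ^ (n + 2) * Real.exp (-(m * ρ ^ 2 / 256)) := by
    refine (iidProb_iUnion_le (graphDist_nonneg f) B).trans
      ((Finset.sum_le_sum fun t _ => hBle t).trans (le_of_eq ?_))
    simp only [Finset.sum_const, Finset.card_univ, Fintype.card_prod, Fintype.card_fun, ZMod.card,
      Fintype.card_fin, Fintype.card_bool, nsmul_eq_mul]
    push_cast
    ring
  have hsub : (⋃ t, B t)ᶜ ⊆ {c | ∀ t,
      |∑ i, sign ((c i).2 + MvPolynomial.eval (c i).1 (plusAffine q t)) -
        m * corr f (fun x => MvPolynomial.eval x (plusAffine q t))| < m * (ρ / 4)} := by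
    intro c hc t
    simp only [Set.mem_compl_iff, Set.mem_iUnion, not_exists] at hc
    have h1 := hc (t, true)
    have h2 := hc (t, false)
    simp only [hB, Set.mem_ofPred_eq, if_true, not_le, hmean] at h1
    simp only [hB, Set.mem_ofPred_eq, Bool.false_eq_true, if_false, not_le, mul_neg,
      Finset.sum_neg_distrib, hmean] at h2
    simp only [hY] at h1 h2
    rw [abs_lt]
    constructor <;> linarith
  refine le_trans ?_ (iidProb_mono (graphDist_nonneg f) hsub)
  rw [iidProb_compl (sum_graphDist f)]
  linarith

/-- The decoder, as a function of the samples. -/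
theorem exists_quadraticDecoder (n m : ℕ) (θ ρ : ℝ) :
    ∃ A : QueryAlgorithm ((Fin n → ZMod 2) × ZMod 2) (MvPolynomial (Fin n) (ZMod 2)),
      A.queries = m * 3 ∧ (0 < θ → θ ≤ 1 → 8 * ((n : ℝ) + 1) ≤ θ * m → 0 < ρ →
        ρ ^ 2 ≤ Real.exp (-(24 / θ)) → 2 ^ (n + 2) * Real.exp (-(m * ρ ^ 2 / 256)) ≤ 1 →
        ∀ f : (Fin n → ZMod 2) → ZMod 2, ∀ q : MvPolynomial (Fin n) (ZMod 2),
        q.totalDegree ≤ 2 → θ ≤ corr f (fun x => MvPolynomial.eval x q) ^ 4 →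
        (1 - 2 * Real.exp (-(m * θ ^ 2 / 64))) *
          (1 - 2 ^ (n + 2) * Real.exp (-(m * ρ ^ 2 / 256))) ≤
        A.prob (bitOracle f) {g | g.totalDegree ≤ 2 ∧
          ρ / 4 ≤ corr f (fun x => MvPolynomial.eval x g)}) := by
  classical
  choose! M hM using fun (P : MvPolynomial (Fin n) (ZMod 2)) (hP : P.totalDegree ≤ 2) =>
    exists_matrix_of_totalDegree_le_two P hP
  let quadratic : (Fin m → (Fin n → ZMod 2) × (Fin n → ZMod 2)) → MvPolynomial (Fin n) (ZMod 2) :=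
    fun s => Classical.epsilon fun q => q.totalDegree ≤ 2 ∧
      θ * m / 2 < (Nat.card {i | s i ∈ (M q).mulVecLin.graph} : ℝ)
  let affine : MvPolynomial (Fin n) (ZMod 2) → (Fin m → (Fin n → ZMod 2) × ZMod 2) →
      (Fin n → ZMod 2) × ZMod 2 :=
    fun q c => Classical.epsilon fun t =>
      m * (ρ / 2) < ∑ i, sign ((c i).2 + MvPolynomial.eval (c i).1 (plusAffine q t))
  obtain ⟨A, hA, h⟩ := exists_bitSampling (n := n) m
    (fun s c => plusAffine (quadratic s) (affine (quadratic s) c))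
  refine ⟨A, hA, fun hθ₀ hθ hm hρ₀ hρ hsmall f q hq hcorr => ?_⟩
  have hn : (0 : ℝ) ≤ n := Nat.cast_nonneg n
  have hm0 : (0 : ℝ) < m := by
    by_contra hneg
    push Not at hneg
    nlinarith
  have hρ1 : ρ ≤ 1 := by
    have : Real.exp (-(24 / θ)) ≤ 1 := Real.exp_le_one_iff.2 (by rw [neg_nonpos]; positivity)
    nlinarith
  have hf : ∀ x, ‖(fun x => (ZMod.stdAddChar (f x) : ℂ)) x‖ = 1 := fun x => norm_stdAddChar _
  have hmass : θ ≤ mass (derivDist fun x => (ZMod.stdAddChar (f x) : ℂ))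
      ((M q).mulVecLin.graph : Set _) := by
    rw [mass_graph_eq f q (M q) (hM q hq)]
    refine hcorr.trans ?_
    have h0 : corr f (fun x => MvPolynomial.eval x q) ^ 4 =
        (corr f (fun x => MvPolynomial.eval x (plusAffine q ((0 : Fin n → ZMod 2), 0))) ^ 2) ^ 2 := by
      simp only [eval_plusAffine, dotProduct_zero, add_zero]
      ring
    rw [h0]
    exact Finset.single_le_sum (f := fun z =>
      (corr f (fun x => MvPolynomial.eval x (plusAffine q (z, 0))) ^ 2) ^ 2)
      (fun z _ => sq_nonneg _) (Finset.mem_univ 0)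
  refine h f _ _ _ _ (by linarith) (le_iidProb_subspace (p := 2) (derivDist_nonneg _)
    (sum_derivDist hf) hθ₀ hθ (by linarith) ?_ (M q).mulVecLin.graph hmass) ?_
  · simp only [Module.finrank_prod, Module.finrank_fin_fun]
    push_cast
    linarith
  · rintro s ⟨hs1, hs2⟩
    obtain ⟨hq1, hq2⟩ : (quadratic s).totalDegree ≤ 2 ∧
        θ * m / 2 < (Nat.card {i | s i ∈ (M (quadratic s)).mulVecLin.graph} : ℝ) :=
      Classical.epsilon_spec (p := fun q : MvPolynomial (Fin n) (ZMod 2) => q.totalDegree ≤ 2 ∧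
        θ * m / 2 < (Nat.card {i | s i ∈ (M q).mulVecLin.graph} : ℝ)) ⟨q, hq, hs1⟩
    obtain ⟨t₀, ht₀⟩ := exists_corr_of_mass f (quadratic s) (M (quadratic s)) (hM _ hq1)
      (hρ.trans (hs2 _ hq2))
    refine (le_iidProb_affine f (quadratic s) hρ₀ hρ1 m).trans
      (iidProb_mono (graphDist_nonneg f) fun c hc => ?_)
    have ht : m * (ρ / 2) < ∑ i, sign ((c i).2 +
        MvPolynomial.eval (c i).1 (plusAffine (quadratic s) (affine (quadratic s) c))) := by
      refine Classical.epsilon_spec (p := fun t => m * (ρ / 2) < ∑ i, sign ((c i).2 +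
        MvPolynomial.eval (c i).1 (plusAffine (quadratic s) t))) ⟨t₀, ?_⟩
      have h1 := (abs_lt.1 (hc t₀)).1
      have h2 : m * ρ ≤ m * corr f (fun x => MvPolynomial.eval x (plusAffine (quadratic s) t₀)) := by
        gcongr
      have h3 : 0 < m * ρ := by positivity
      linarith
    refine ⟨totalDegree_plusAffine_le hq1 _, ?_⟩
    have h1 := (abs_lt.1 (hc (affine (quadratic s) c))).2
    refine le_of_mul_le_mul_left (a := (m : ℝ)) ?_ hm0
    linarith

/-- Quadratic Reed-Muller decoding with `O(n)` queries. -/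
theorem exists_quadraticDecoding {ε : ℝ} (hε : 0 < ε) :
    ∃ K : ℝ, 0 < K ∧ ∀ n : ℕ,
      ∃ A : QueryAlgorithm ((Fin n → ZMod 2) × ZMod 2) (MvPolynomial (Fin n) (ZMod 2)),
        (2 ≤ n → (A.queries : ℝ) ≤ K * (n * Real.log n)) ∧
        ∀ f : (Fin n → ZMod 2) → ZMod 2, distRM2 f ≤ 1 / 2 - ε →
          2 / 3 ≤ A.prob (bitOracle f) {g | g.totalDegree ≤ 2 ∧
            relDist f (fun x => MvPolynomial.eval x g) ≤
              1 / 2 - Real.exp (-(1 / ε ^ (6 : ℝ)))} := by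
  set θ : ℝ := 16 * ε ^ 4 with hθ
  set ρ : ℝ := Real.exp (-(12 / θ)) with hρ
  have hθ₀ : 0 < θ := by positivity
  have hρ₀ : 0 < ρ := Real.exp_pos _
  obtain ⟨N, hN⟩ := exists_nat_ge (1024 / ρ ^ 2 + 256 / θ ^ 2 + 8 / θ)
  have hN1 : 1024 ≤ N * ρ ^ 2 := by
    rw [← div_le_iff₀ (by positivity)]
    have : 0 < 256 / θ ^ 2 := by positivity
    have : 0 < 8 / θ := by positivity
    linarith
  have hN2 : 256 ≤ N * θ ^ 2 := by
    rw [← div_le_iff₀ (by positivity)]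
    have : 0 < 1024 / ρ ^ 2 := by positivity
    have : 0 < 8 / θ := by positivity
    linarith
  have hN3 : 8 ≤ N * θ := by
    rw [← div_le_iff₀ (by positivity)]
    have : 0 < 1024 / ρ ^ 2 := by positivity
    have : 0 < 256 / θ ^ 2 := by positivity
    linarith
  refine ⟨10 * N + 1, by positivity, fun n => ?_⟩
  obtain ⟨A, hA, h⟩ := exists_quadraticDecoder n (N * (n + 1)) θ ρ
  have hn0 : (0 : ℝ) ≤ n := Nat.cast_nonneg n
  refine ⟨A, fun hn => ?_, fun f hf => ?_⟩
  · have hn' : (2 : ℝ) ≤ n := by exact_mod_cast hn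
    have hlog : (0.69 : ℝ) ≤ Real.log n :=
      (by linarith [Real.log_two_gt_d9] : (0.69 : ℝ) ≤ Real.log 2).trans
        (Real.log_le_log (by norm_num) hn')
    rw [hA]
    push_cast
    have hNn : (0 : ℝ) ≤ N * n := by positivity
    have h1 : (N : ℝ) ≤ N * n := le_mul_of_one_le_right (Nat.cast_nonneg N) (by linarith)
    have h2 : N * n * 0.69 ≤ N * n * Real.log n := by gcongr
    have h3 : 0 ≤ n * Real.log n := mul_nonneg hn0 (by linarith)
    nlinarith
  · have hε2 : ε ≤ 1 / 2 := by
      have : 0 ≤ distRM2 f := Real.sInf_nonneg (by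
        rintro _ ⟨c, -, rfl⟩
        exact div_nonneg (Nat.cast_nonneg _) (by positivity))
      linarith
    have hθ1 : θ ≤ 1 := by
      have : ε ^ 4 ≤ (1 / 2) ^ 4 := by gcongr
      rw [hθ]
      linarith
    obtain ⟨q, hq, hc⟩ := exists_quadratic_of_distRM2 hf
    have hc4 : θ ≤ corr f (fun x => MvPolynomial.eval x q) ^ 4 := by
      have h2 : 2 * ε ≤ corr f (fun x => MvPolynomial.eval x q) := by linarith
      calc θ = (2 * ε) ^ 4 := by rw [hθ]; ring
        _ ≤ _ := by gcongr
    have he : Real.exp (-4) ≤ 1 / 50 := by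
      have h2 : (2.7 : ℝ) ≤ Real.exp 1 := by linarith [Real.exp_one_gt_d9]
      have h4 : Real.exp 4 = Real.exp 1 ^ 4 := by rw [← Real.exp_nat_mul]; norm_num
      rw [Real.exp_neg, h4, ← one_div]
      apply one_div_le_one_div_of_le (by norm_num)
      calc (50 : ℝ) ≤ 2.7 ^ 4 := by norm_num
        _ ≤ _ := by gcongr
    have hs1 : Real.exp (-((N * (n + 1) : ℕ) * θ ^ 2 / 64)) ≤ 1 / 50 := by
      refine le_trans (Real.exp_le_exp.2 ?_) he
      push_cast
      nlinarith [mul_nonneg hn0 (by positivity : (0 : ℝ) ≤ N * θ ^ 2)]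
    have hs2 : 2 ^ (n + 2) * Real.exp (-((N * (n + 1) : ℕ) * ρ ^ 2 / 256)) ≤ 1 / 4 := by
      have h1 : Real.exp (-((N * (n + 1) : ℕ) * ρ ^ 2 / 256)) ≤ Real.exp (-4) ^ (n + 1) := by
        rw [← Real.exp_nat_mul (-4), Real.exp_le_exp]
        push_cast
        nlinarith
      have h2 : Real.exp (-4) ^ (n + 1) ≤ (1 / 16) ^ (n + 1) := by
        gcongr
        linarith
      calc _ ≤ 2 ^ (n + 2) * (1 / 16 : ℝ) ^ (n + 1) := by gcongr; exact h1.trans h2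
        _ = 2 * (2 * (1 / 16 : ℝ)) ^ (n + 1) := by rw [mul_pow]; ring
        _ ≤ 2 * (2 * (1 / 16 : ℝ)) ^ 1 := by
          refine mul_le_mul_of_nonneg_left ?_ (by norm_num)
          exact pow_le_pow_of_le_one (by norm_num) (by norm_num) (by omega)
        _ = 1 / 4 := by norm_num
    have hmain := h hθ₀ hθ1 (by push_cast; nlinarith) hρ₀
      (by
        rw [hρ, ← Real.exp_nat_mul]
        apply le_of_eq
        congr 1
        push_cast
        ring) (by linarith) f q hq hc4
    have hηρ : Real.exp (-(1 / ε ^ (6 : ℝ))) ≤ ρ / 8 := by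
      have h8 : Real.exp (-8) ≤ 1 / 8 := by
        rw [Real.exp_neg, ← one_div]
        exact one_div_le_one_div_of_le (by norm_num) (by linarith [Real.add_one_le_exp (8 : ℝ)])
      have hpow : ε ^ (6 : ℝ) = ε ^ 6 := by
        rw [← Real.rpow_natCast]
        norm_num
      have key : 12 / θ + 8 ≤ 1 / ε ^ 6 := by
        rw [hθ, div_add' _ _ _ (by positivity), div_le_div_iff₀ (by positivity) (by positivity)]
        have h2 : ε ^ 2 ≤ 1 / 4 := by nlinarith
        have h4 : ε ^ 4 ≤ 1 / 16 := by nlinarith [sq_nonneg ε]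
        have h5 : 0 < ε ^ 4 := by positivity
        have h6 : ε ^ 6 = ε ^ 4 * ε ^ 2 := by ring
        rw [h6]
        have : (12 + 8 * (16 * ε ^ 4)) * ε ^ 2 ≤ 16 := by nlinarith [sq_nonneg ε]
        nlinarith
      rw [hpow]
      calc Real.exp (-(1 / ε ^ 6)) ≤ Real.exp (-(12 / θ) + -8) := by
            rw [Real.exp_le_exp]
            linarith
        _ = ρ * Real.exp (-8) := by rw [Real.exp_add]
        _ ≤ ρ * (1 / 8) := by gcongr
        _ = ρ / 8 := by ring
    refine le_trans (le_trans ?_ hmain) ?_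
    · calc (2 / 3 : ℝ) ≤ (1 - 2 * (1 / 50)) * (1 - 1 / 4) := by norm_num
        _ ≤ _ := by
          apply mul_le_mul <;> linarith
    · refine Finset.sum_le_sum fun s _ => Set.indicator_le_indicator_of_subset ?_
        (fun s => sq_nonneg _) s
      rintro s ⟨hg1, hg2⟩
      refine ⟨hg1, ?_⟩
      rw [relDist_eq]
      linarith

end Quadratic

/-! ### Additive combinatorics -/

section Additive

open scoped Pointwise
open Finset

variable {E : Type} [AddCommGroup E] [DecidableEq E]

/-- The Balog-Szemerédi-Gowers theorem for a dense set of pairs whose differences lie in a small set. -/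
theorem balog_szemeredi_gowers (A A' : Finset E) (hA : A.Nonempty) {δ : ℝ} (hδ₀ : 0 < δ)
    (h : δ * (#A : ℝ) ^ 2 ≤ #{x ∈ A ×ˢ A | x.1 - x.2 ∈ A'}) :
    ∃ B ⊆ A, δ / 4 * #A ≤ #B ∧ (#(B - B) : ℝ) * (δ ^ 5 * (#A : ℝ) ^ 3) ≤ 1024 * (#A' : ℝ) ^ 4 := by
  classical
  set a : ℝ := (#A : ℝ) with ha
  have ha0 : 0 < a := by rw [ha]; exact_mod_cast hA.card_pos
  let N : E → Finset E := fun z => {v ∈ A | v - z ∈ A'}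
  let C : E → E → Finset E := fun v v' => {z ∈ A | v - z ∈ A' ∧ v' - z ∈ A'}
  let bad : E → E → Prop := fun v v' => (#(C v v') : ℝ) < δ ^ 2 / 16 * a
  let badPairs : E → Finset (E × E) := fun z => {x ∈ N z ×ˢ N z | bad x.1 x.2}
  have hN : δ * a ^ 2 ≤ ∑ z ∈ A, (#(N z) : ℝ) := by
    refine h.trans (le_of_eq ?_)
    rw [card_filter, sum_product_right]
    push_cast
    refine sum_congr rfl fun z _ => ?_
    rw [card_filter]
    push_cast
    rfl
  have hN2 : δ ^ 2 * a ^ 3 ≤ ∑ z ∈ A, (#(N z) : ℝ) ^ 2 := by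
    have hcs := sq_sum_le_card_mul_sum_sq (s := A) (f := fun z => (#(N z) : ℝ))
    rw [← ha] at hcs
    have h1 : (δ * a ^ 2) ^ 2 ≤ (∑ z ∈ A, (#(N z) : ℝ)) ^ 2 := by gcongr
    refine le_of_mul_le_mul_left ?_ ha0
    calc a * (δ ^ 2 * a ^ 3) = (δ * a ^ 2) ^ 2 := by ring
      _ ≤ _ := h1.trans hcs
  have hbad : ∑ z ∈ A, (#(badPairs z) : ℝ) ≤ δ ^ 2 / 16 * a ^ 3 := by
    let t : Finset (E × E) := {x ∈ A ×ˢ A | bad x.1 x.2}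
    have hdc := sum_card_bipartiteAbove_eq_sum_card_bipartiteBelow
      (s := A) (t := t) (fun z (x : E × E) => x.1 - z ∈ A' ∧ x.2 - z ∈ A')
    have h1 : ∀ z, bipartiteAbove (fun z (x : E × E) => x.1 - z ∈ A' ∧ x.2 - z ∈ A') t z =
        badPairs z := by
      intro z
      ext x
      simp only [bipartiteAbove, t, badPairs, N, mem_filter, mem_product]
      tauto
    have h2 : ∀ x : E × E, bipartiteBelow (fun z (x : E × E) => x.1 - z ∈ A' ∧ x.2 - z ∈ A') A x =
        C x.1 x.2 := fun x => rfl
    simp only [h1, h2] at hdc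
    have h3 : ∑ z ∈ A, (#(badPairs z) : ℝ) = ∑ x ∈ t, (#(C x.1 x.2) : ℝ) := by exact_mod_cast hdc
    rw [h3]
    calc ∑ x ∈ t, (#(C x.1 x.2) : ℝ) ≤ ∑ x ∈ t, δ ^ 2 / 16 * a :=
          sum_le_sum fun x hx => (mem_filter.1 hx).2.le
      _ = #t * (δ ^ 2 / 16 * a) := by rw [sum_const, nsmul_eq_mul]
      _ ≤ (a * a) * (δ ^ 2 / 16 * a) := by
          gcongr
          have := card_filter_le (A ×ˢ A) (fun x => bad x.1 x.2)
          rw [card_product] at this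
          rw [ha]
          exact_mod_cast this
      _ = _ := by ring
  obtain ⟨z, hz, hzN⟩ : ∃ z ∈ A, δ ^ 2 * a ^ 2 / 2 ≤ (#(N z) : ℝ) ^ 2 - 8 * #(badPairs z) := by
    apply exists_le_of_sum_le hA
    rw [sum_const, sum_sub_distrib, ← mul_sum, nsmul_eq_mul, ← ha]
    have : a * (δ ^ 2 * a ^ 2 / 2) = δ ^ 2 * a ^ 3 / 2 := by ring
    rw [this]
    linarith
  set ν : ℝ := (#(N z) : ℝ) with hν
  have hν0 : 0 ≤ ν := by positivity
  have hνlow : δ * a / 2 ≤ ν := by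
    refine abs_le_of_sq_le_sq' ?_ hν0 |>.2
    have : (0 : ℝ) ≤ #(badPairs z) := by positivity
    nlinarith [sq_nonneg (δ * a)]
  have hνbad : 8 * (#(badPairs z) : ℝ) ≤ ν ^ 2 := by
    have : 0 ≤ δ ^ 2 * a ^ 2 := by positivity
    linarith
  have hνpos : 0 < ν := lt_of_lt_of_le (by positivity) hνlow
  let bd : E → Finset E := fun v => {v' ∈ N z | bad v v'}
  let B : Finset E := {v ∈ N z | (#(bd v) : ℝ) ≤ ν / 4}
  have hBN : B ⊆ N z := filter_subset _ _
  have hsumbd : ∑ v ∈ N z, (#(bd v) : ℝ) = #(badPairs z) := by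
    simp only [bd, badPairs]
    rw [card_filter, sum_product]
    push_cast
    refine sum_congr rfl fun v _ => ?_
    rw [card_filter]
    push_cast
    rfl
  have hBcard : ν / 2 ≤ #B := by
    have h1 : (#(N z \ B) : ℝ) * (ν / 4) ≤ #(badPairs z) := by
      calc (#(N z \ B) : ℝ) * (ν / 4) = ∑ v ∈ N z \ B, ν / 4 := by rw [sum_const, nsmul_eq_mul]
        _ ≤ ∑ v ∈ N z \ B, (#(bd v) : ℝ) := by
            refine sum_le_sum fun v hv => ?_
            obtain ⟨hv1, hv2⟩ := mem_sdiff.1 hv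
            by_contra hlt
            exact hv2 (mem_filter.2 ⟨hv1, (not_le.1 hlt).le⟩)
        _ ≤ ∑ v ∈ N z, (#(bd v) : ℝ) :=
            sum_le_sum_of_subset_of_nonneg sdiff_subset fun _ _ _ => by positivity
        _ = _ := hsumbd
    have h2 : (#(N z \ B) : ℝ) = ν - #B := by
      rw [card_sdiff_of_subset hBN, Nat.cast_sub (card_le_card hBN)]
    rw [h2] at h1
    nlinarith
  refine ⟨B, hBN.trans (filter_subset _ _), by linarith, ?_⟩
  let T : E → Finset (E × E × E × E) := fun d =>
    {x ∈ A' ×ˢ A' ×ˢ A' ×ˢ A' | x.1 - x.2.1 - (x.2.2.1 - x.2.2.2) = d}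
  have hT : ∀ d ∈ B - B, δ ^ 5 * a ^ 3 / 1024 ≤ (#(T d) : ℝ) := by
    intro d hd
    obtain ⟨v, hv, v', hv', rfl⟩ := mem_sub.1 hd
    let good : Finset E := {b ∈ N z | ¬ bad v b ∧ ¬ bad v' b}
    have hgood : ν / 2 ≤ #good := by
      have hsub : N z ⊆ good ∪ (bd v ∪ bd v') := by
        intro b hb
        simp only [good, bd, mem_union, mem_filter]
        tauto
      have h1 : (#(N z) : ℝ) ≤ #good + (#(bd v) + #(bd v')) := by
        exact_mod_cast (card_le_card hsub).trans ((card_union_le _ _).trans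
          (by gcongr; exact card_union_le _ _))
      have h2 := (mem_filter.1 hv).2
      have h3 := (mem_filter.1 hv').2
      linarith
    let S : Finset (Σ _ : E, E × E) := good.sigma fun b => C v b ×ˢ C v' b
    have hS : δ ^ 5 * a ^ 3 / 1024 ≤ (#S : ℝ) := by
      have h1 : (#S : ℝ) = ∑ b ∈ good, (#(C v b) : ℝ) * #(C v' b) := by
        rw [card_sigma]
        push_cast
        refine sum_congr rfl fun b _ => ?_
        rw [card_product]
        push_cast
        rfl
      rw [h1]
      calc δ ^ 5 * a ^ 3 / 1024 = (δ * a / 2 / 2) * ((δ ^ 2 / 16 * a) * (δ ^ 2 / 16 * a)) := by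
            ring
        _ ≤ #good * ((δ ^ 2 / 16 * a) * (δ ^ 2 / 16 * a)) := by
            gcongr
            linarith
        _ = ∑ b ∈ good, (δ ^ 2 / 16 * a) * (δ ^ 2 / 16 * a) := by rw [sum_const, nsmul_eq_mul]
        _ ≤ _ := by
            refine sum_le_sum fun b hb => ?_
            obtain ⟨-, hb1, hb2⟩ := mem_filter.1 hb
            have := not_lt.1 hb1
            have := not_lt.1 hb2
            gcongr
    refine hS.trans ?_
    have : #S ≤ #(T (v - v')) := by
      refine card_le_card_of_injOn
        (fun x => (v - x.2.1, x.1 - x.2.1, v' - x.2.2, x.1 - x.2.2)) ?_ ?_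
      · rintro ⟨b, z₁, z₂⟩ hx
        simp only [S, C, coe_sigma, Set.mem_sigma_iff, mem_coe, mem_product, mem_filter] at hx
        simp only [T, mem_coe, mem_filter, mem_product]
        refine ⟨⟨hx.2.1.2.1, hx.2.1.2.2, hx.2.2.2.1, hx.2.2.2.2⟩, ?_⟩
        abel
      · rintro ⟨b, z₁, z₂⟩ _ ⟨b', z₁', z₂'⟩ _ hx
        simp only [Prod.mk.injEq, sub_right_inj] at hx
        obtain ⟨rfl, h2, rfl, -⟩ := hx
        rw [sub_left_inj] at h2
        rw [h2]
    exact_mod_cast this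
  have hsum : ∑ d ∈ B - B, #(T d) ≤ #(A' ×ˢ A' ×ˢ A' ×ˢ A') :=
    (sum_card_fiberwise_eq_card_filter _ _ _).trans_le (card_filter_le _ _)
  have hsum' : ∑ d ∈ B - B, (#(T d) : ℝ) ≤ (#A' : ℝ) ^ 4 := by
    have : #(A' ×ˢ A' ×ˢ A' ×ˢ A') = #A' ^ 4 := by
      simp only [card_product]
      ring
    rw [this] at hsum
    exact_mod_cast hsum
  have h1 : (#(B - B) : ℝ) * (δ ^ 5 * a ^ 3 / 1024) ≤ (#A' : ℝ) ^ 4 := by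
    refine le_trans ?_ hsum'
    rw [← nsmul_eq_mul, ← sum_const]
    exact sum_le_sum hT
  linarith

/-- A Freiman-type theorem: a set of small doubling spans a small subspace. -/
theorem card_span_le {p : ℕ} [Fact p.Prime] [Module (ZMod p) E] [Finite E] (B : Finset E)
    (hB : B.Nonempty) {K : ℝ} (hK : (#(B - B) : ℝ) ≤ K * #B) :
    ∃ r : ℕ, (r : ℝ) ≤ K ^ 5 + 1 ∧
      Nat.card (Submodule.span (ZMod p) (B : Set E)) ≤ p ^ r * #(B - B) := by
  classical
  have := Fintype.ofFinite E
  have hBpos : (0 : ℝ) < #B := by exact_mod_cast hB.card_pos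
  set D := B - B with hD
  have hcov : (#(D + D + B) : ℝ) ≤ K ^ 5 * #B := by
    have h1 : D + D + B = 3 • B - 2 • B := by
      rw [hD, sub_add_sub_comm, sub_add_eq_add_sub, succ_nsmul, two_nsmul]
    have h2 := pluennecke_ruzsa_inequality_nsmul_sub_nsmul_sub hB B 3 2
    rw [h1]
    have h3 : (#(3 • B - 2 • B) : ℝ) ≤ (#(B - B) / #B : ℝ) ^ (3 + 2) * #B := by
      have h4 := (NNRat.cast_le (K := ℝ)).2 h2
      push_cast at h4
      exact h4
    refine h3.trans ?_
    gcongr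
    rw [div_le_iff₀ hBpos]
    exact hK
  obtain ⟨F, -, hFcard, hF⟩ := ruzsa_covering_add hB hcov
  obtain ⟨b₀, hb₀⟩ := hB
  set X : Finset E := insert b₀ F with hX
  set H := Submodule.span (ZMod p) (X : Set E) with hH
  have h0D : (0 : E) ∈ D := mem_sub.2 ⟨b₀, hb₀, b₀, hb₀, sub_self _⟩
  have hclosed : ∀ x ∈ Submodule.span (ZMod p) (B : Set E),
      ∀ y ∈ (H : Set E) + (D : Set E), x + y ∈ (H : Set E) + (D : Set E) := by
    intro x hx
    induction hx using Submodule.span_induction with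
    | mem b hb =>
      rintro _ ⟨h, hh, d, hd, rfl⟩
      have hbD : b - b₀ ∈ D := mem_sub.2 ⟨b, hb, b₀, hb₀, rfl⟩
      obtain ⟨e, he, d', hd', hed⟩ := mem_add.1 (hF (mem_add.2 ⟨_, hbD, d, hd, rfl⟩))
      refine ⟨b₀ + h + e, ?_, d', hd', ?_⟩
      · refine H.add_mem (H.add_mem (Submodule.subset_span (by simp [hX])) hh)
          (Submodule.subset_span (by simp [hX, he]))
      · change b₀ + h + e + d' = b + (h + d)
        rw [add_assoc, hed]
        abel
    | zero =>
      intro y hy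
      rwa [zero_add]
    | add x y _ _ hx hy =>
      intro w hw
      rw [add_assoc]
      exact hx _ (hy _ hw)
    | smul c x _ hx =>
      have : ∀ k : ℕ, ∀ y ∈ (H : Set E) + (D : Set E), k • x + y ∈ (H : Set E) + (D : Set E) := by
        intro k
        induction k with
        | zero =>
          intro y hy
          rwa [zero_nsmul, zero_add]
        | succ k ih =>
          intro y hy
          rw [succ_nsmul, add_assoc]
          exact ih _ (hx _ hy)
      have hc : c • x = c.val • x := by
        rw [← Nat.cast_smul_eq_nsmul (ZMod p), ZMod.natCast_zmod_val]
      rw [hc]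
      exact this _
  have hsub : (Submodule.span (ZMod p) (B : Set E) : Set E) ⊆ (H : Set E) + (D : Set E) := by
    intro x hx
    have := hclosed x hx 0 ⟨0, H.zero_mem, 0, h0D, add_zero 0⟩
    rwa [add_zero] at this
  have hHcard : Nat.card H ≤ p ^ (#F + 1) := by
    rw [Nat.card_eq_fintype_card, Module.card_eq_pow_finrank (K := ZMod p), ZMod.card]
    exact Nat.pow_le_pow_right (Fact.out : p.Prime).pos
      ((finrank_span_finset_le_card X).trans (card_insert_le _ _))
  refine ⟨#F + 1, by push_cast; linarith, ?_⟩
  calc Nat.card (Submodule.span (ZMod p) (B : Set E))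
      ≤ Nat.card ((H : Set E) + (D : Set E) : Set E) :=
        Nat.card_mono (Set.toFinite _) hsub
    _ ≤ Nat.card H * Nat.card (D : Set E) := Set.natCard_add_le
    _ ≤ p ^ (#F + 1) * #D := by
        gcongr
        simp

end Additive

/-! ### Subspaces of large mass for functions with large `U³` norm -/

section InverseTheorem

open Finset

variable {p n : ℕ} [Fact p.Prime]

open scoped Classical Pointwise in
/-- If the `U³` average of `f` is at least `2α`, a subspace of size comparable to `pⁿ` carries a
large part of the mass of `derivDist f`. -/
theorem exists_subspace_mass {f : (Fin n → ZMod p) → ℂ} (hf : ∀ x, ‖f x‖ = 1) {α δ K : ℝ}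
    (hα : 0 < α) (hδ : δ = α ^ 2 / 2) (hK : K = 4096 / (α ^ 4 * δ ^ 10))
    (h : 2 * α ≤ (gowersAverage 3 f).re) :
    ∃ H : Submodule (ZMod p) ((Fin n → ZMod p) × (Fin n → ZMod p)),
      α ^ 2 * δ / 4 ≤ mass (derivDist f) (H : Set _) ∧
      ∃ r : ℕ, (r : ℝ) ≤ K ^ 5 + 1 ∧ (Nat.card H : ℝ) ≤ p ^ r * (K / α * (p : ℝ) ^ n) := by
  set N : ℝ := (p : ℝ) ^ n with hN
  have hN0 : 0 < N := card_pow_pos p n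
  have hδ0 : 0 < δ := by rw [hδ]; positivity
  have hK0 : 0 < K := by rw [hK]; positivity
  set w := derivWeight f with hw
  have hw0 : ∀ v, 0 ≤ w v := derivWeight_nonneg f
  have hw1 : ∀ v, w v ≤ 1 := derivWeight_le_one hf
  have hsum : ∑ v, w v = N := sum_derivWeight_univ hf
  have hlevel : ∀ β : ℝ, (#{v | β ≤ w v} : ℝ) * β ≤ N := by
    intro β
    calc (#{v | β ≤ w v} : ℝ) * β = ∑ v with β ≤ w v, β := by rw [sum_const, nsmul_eq_mul]
      _ ≤ ∑ v with β ≤ w v, w v := sum_le_sum fun v hv => (mem_filter.1 hv).2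
      _ ≤ ∑ v, w v := sum_le_sum_of_subset_of_nonneg (subset_univ _) fun v _ _ => hw0 v
      _ = N := hsum
  set A : Finset ((Fin n → ZMod p) × (Fin n → ZMod p)) := {v | α ≤ w v} with hA
  set A' : Finset ((Fin n → ZMod p) × (Fin n → ZMod p)) := {v | δ ≤ w v} with hA'
  have hAlow : α * N ≤ #A := by
    rw [gowersAverage_three, ← hN, ← hw] at h
    have h1 : 2 * α * N ≤ ∑ v, w v ^ 2 := by
      rwa [inv_mul_eq_div, le_div_iff₀ hN0] at h
    have h2 : ∀ v, w v ^ 2 ≤ (if α ≤ w v then 1 else 0) + α * w v := by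
      intro v
      split_ifs with hv
      · nlinarith [hw0 v, hw1 v]
      · nlinarith [hw0 v]
    have h3 := h1.trans (sum_le_sum fun v _ => h2 v)
    rw [sum_add_distrib, ← mul_sum, hsum, sum_boole] at h3
    linarith
  have hAhigh : (#A : ℝ) * α ≤ N := hlevel α
  have hA'high : (#A' : ℝ) * δ ≤ N := hlevel δ
  have hA0 : (0 : ℝ) < #A := lt_of_lt_of_le (by positivity) hAlow
  have hAne : A.Nonempty := by
    rw [← card_pos]
    exact_mod_cast hA0
  have hpairs : δ * (#A : ℝ) ^ 2 ≤ #{x ∈ A ×ˢ A | x.1 - x.2 ∈ A'} := by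
    have h1 : (α * #A) ^ 2 ≤ ∑ v ∈ A, ∑ v' ∈ A, w (v - v') := by
      refine le_trans ?_ (sq_sum_derivWeight_le hf A)
      gcongr
      rw [mul_comm, ← nsmul_eq_mul, ← sum_const]
      exact sum_le_sum fun v hv => (mem_filter.1 hv).2
    have h2 : ∀ v v', w (v - v') ≤ (if v - v' ∈ A' then 1 else 0) + δ := by
      intro v v'
      split_ifs with hv
      · linarith [hw1 (v - v')]
      · rw [hA', mem_filter, not_and, not_le] at hv
        linarith [hv (mem_univ _)]
    have h3 := h1.trans (sum_le_sum fun v _ => sum_le_sum fun v' _ => h2 v v')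
    simp only [sum_add_distrib, sum_const, nsmul_eq_mul] at h3
    have h4 : (#{x ∈ A ×ˢ A | x.1 - x.2 ∈ A'} : ℝ) =
        ∑ v ∈ A, ∑ v' ∈ A, if v - v' ∈ A' then (1 : ℝ) else 0 := by
      rw [card_filter, sum_product]
      push_cast
      rfl
    rw [h4]
    have h5 : (α * (#A : ℝ)) ^ 2 = 2 * δ * (#A : ℝ) ^ 2 := by rw [hδ]; ring
    rw [h5] at h3
    linarith
  obtain ⟨B, hBA, hBcard, hBB⟩ := balog_szemeredi_gowers A A' hAne hδ0 hpairs
  have hBne : B.Nonempty := by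
    rw [← card_pos]
    have : (0 : ℝ) < #B := lt_of_lt_of_le (by positivity) hBcard
    exact_mod_cast this
  have hdoubling : (#(B - B) : ℝ) ≤ K * #B := by
    have h1 : (#A' : ℝ) ^ 4 * (δ ^ 4 * α ^ 4) ≤ (#A : ℝ) ^ 4 := by
      have h2 : (#A' : ℝ) * (δ * α) ≤ #A := by nlinarith
      calc (#A' : ℝ) ^ 4 * (δ ^ 4 * α ^ 4) = ((#A' : ℝ) * (δ * α)) ^ 4 := by ring
        _ ≤ _ := by gcongr
    have h3 : (#(B - B) : ℝ) * (δ ^ 9 * α ^ 4) ≤ 1024 * #A := by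
      have hA3 : (0 : ℝ) < (#A : ℝ) ^ 3 := by positivity
      refine le_of_mul_le_mul_right ?_ hA3
      calc (#(B - B) : ℝ) * (δ ^ 9 * α ^ 4) * (#A : ℝ) ^ 3
          = (#(B - B) : ℝ) * (δ ^ 5 * (#A : ℝ) ^ 3) * (δ ^ 4 * α ^ 4) := by ring
        _ ≤ 1024 * (#A' : ℝ) ^ 4 * (δ ^ 4 * α ^ 4) := by gcongr
        _ = 1024 * ((#A' : ℝ) ^ 4 * (δ ^ 4 * α ^ 4)) := by ring
        _ ≤ 1024 * (#A : ℝ) ^ 4 := by gcongr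
        _ = _ := by ring
    rw [hK, div_mul_eq_mul_div, le_div_iff₀ (by positivity)]
    nlinarith
  obtain ⟨r, hr, hcard⟩ := card_span_le (p := p) B hBne hdoubling
  refine ⟨Submodule.span (ZMod p) (B : Set _), ?_, r, hr, ?_⟩
  · refine le_trans ?_ (mass_mono (derivDist_nonneg f) Submodule.subset_span)
    have h1 : mass (derivDist f) (B : Set _) = N⁻¹ * ∑ v ∈ B, w v := by
      rw [mass, Finset.sum_indicator_subset _ (subset_univ B), mul_sum]
      rfl
    rw [h1, inv_mul_eq_div, le_div_iff₀ hN0]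
    calc α ^ 2 * δ / 4 * N = α * (δ / 4 * (α * N)) := by ring
      _ ≤ α * (δ / 4 * #A) := by gcongr
      _ ≤ α * #B := by gcongr
      _ = ∑ v ∈ B, α := by rw [sum_const, nsmul_eq_mul, mul_comm]
      _ ≤ _ := sum_le_sum fun v hv => (mem_filter.1 (hBA hv)).2
  · have h1 : (Nat.card (Submodule.span (ZMod p)
        (B : Set ((Fin n → ZMod p) × (Fin n → ZMod p)))) : ℝ) ≤ p ^ r * #(B - B) := by
      exact_mod_cast hcard
    refine h1.trans ?_
    gcongr
    refine hdoubling.trans ?_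
    rw [div_mul_eq_mul_div, le_div_iff₀ hα, mul_assoc]
    gcongr
    refine le_trans ?_ hAhigh
    gcongr

end InverseTheorem

/-! ### Random linear maps inside a subspace -/

section RandomMap

variable {p n : ℕ} [Fact p.Prime]

lemma sum_matrix_mul_eq_zero {h h' : Fin n → ZMod p}
    (hh : h ∉ Submodule.span (ZMod p) {h'}) (φ ψ : (Fin n → ZMod p) → ℝ) (hφ : ∑ y, φ y = 0) :
    ∑ N : Matrix (Fin n) (Fin n) (ZMod p), φ (N *ᵥ h) * ψ (N *ᵥ h') = 0 := by
  obtain ⟨l, hl, hl'⟩ := Submodule.exists_le_ker_of_notMem hh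
  have hlh' : l h' = 0 := hl' (Submodule.mem_span_singleton_self h')
  let b : Fin n → ZMod p := fun i => (l h)⁻¹ * l fun j => if i = j then 1 else 0
  have hb : ∀ x, b ⬝ᵥ x = (l h)⁻¹ * l x := by
    intro x
    rw [LinearMap.pi_apply_eq_sum_univ l x, Finset.mul_sum]
    refine Finset.sum_congr rfl fun i _ => ?_
    simp only [b, smul_eq_mul]
    ring
  have hshift : ∀ y, ∑ N : Matrix (Fin n) (Fin n) (ZMod p), φ (N *ᵥ h) * ψ (N *ᵥ h') =
      ∑ N : Matrix (Fin n) (Fin n) (ZMod p), φ (N *ᵥ h + y) * ψ (N *ᵥ h') := by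
    intro y
    rw [← Equiv.sum_comp (Equiv.addRight (Matrix.vecMulVec y b))]
    refine Finset.sum_congr rfl fun N _ => ?_
    simp only [Equiv.coe_addRight, Matrix.add_mulVec, Matrix.vecMulVec_mulVec, hb, hlh',
      inv_mul_cancel₀ hl, mul_zero]
    simp
  have hcard : (Fintype.card (Fin n → ZMod p) : ℝ) *
      ∑ N : Matrix (Fin n) (Fin n) (ZMod p), φ (N *ᵥ h) * ψ (N *ᵥ h') = 0 := by
    calc _ = ∑ y : Fin n → ZMod p, ∑ N : Matrix (Fin n) (Fin n) (ZMod p),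
          φ (N *ᵥ h) * ψ (N *ᵥ h') := by
          rw [Finset.sum_const, Finset.card_univ, nsmul_eq_mul]
      _ = ∑ y : Fin n → ZMod p, ∑ N : Matrix (Fin n) (Fin n) (ZMod p),
          φ (N *ᵥ h + y) * ψ (N *ᵥ h') := Finset.sum_congr rfl fun y _ => hshift y
      _ = ∑ N : Matrix (Fin n) (Fin n) (ZMod p), 0 := by
          rw [Finset.sum_comm]
          refine Finset.sum_congr rfl fun N _ => ?_
          have : ∑ y, φ (N *ᵥ h + y) = ∑ y, φ y := Equiv.sum_comp (Equiv.addLeft (N *ᵥ h)) φ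
          rw [← Finset.sum_mul, this, hφ, zero_mul]
      _ = 0 := by simp
  exact (mul_eq_zero.1 hcard).resolve_left (by exact_mod_cast Fintype.card_ne_zero)

open scoped Classical in
lemma card_span_singleton_le (h' : Fin n → ZMod p) :
    (Finset.univ.filter fun h => h ∈ Submodule.span (ZMod p) {h'}).card ≤ p := by
  have : (Finset.univ.filter fun h => h ∈ Submodule.span (ZMod p) {h'}) ⊆
      Finset.univ.image fun c : ZMod p => c • h' := by
    intro h hh
    obtain ⟨c, hc⟩ := Submodule.mem_span_singleton.1 (Finset.mem_filter.1 hh).2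
    exact Finset.mem_image.2 ⟨c, Finset.mem_univ _, hc⟩
  refine (Finset.card_le_card this).trans (Finset.card_image_le.trans ?_)
  simp [ZMod.card]

/-- The variance of `∑ h, g h (N h)` for a uniformly random matrix `N`. -/
lemma sum_matrix_sq_le (g : (Fin n → ZMod p) → (Fin n → ZMod p) → ℝ)
    (hg0 : ∀ h y, 0 ≤ g h y) (hg1 : ∀ h y, g h y ≤ 1) :
    ∑ N : Matrix (Fin n) (Fin n) (ZMod p),
      (∑ h, g h (N *ᵥ h) - ((p : ℝ) ^ n)⁻¹ * ∑ h, ∑ y, g h y) ^ 2 ≤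
      Fintype.card (Matrix (Fin n) (Fin n) (ZMod p)) * (p * (p : ℝ) ^ n) := by
  classical
  have hN0 := card_pow_pos p n
  set a : (Fin n → ZMod p) → ℝ := fun h => ((p : ℝ) ^ n)⁻¹ * ∑ y, g h y with ha
  have hcard : (Fintype.card (Fin n → ZMod p) : ℝ) = (p : ℝ) ^ n := by simp [ZMod.card]
  have ha0 : ∀ h, 0 ≤ a h := fun h =>
    mul_nonneg (inv_nonneg.2 hN0.le) (Finset.sum_nonneg fun y _ => hg0 h y)
  have ha1 : ∀ h, a h ≤ 1 := by
    intro h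
    rw [ha]
    simp only
    rw [inv_mul_le_iff₀ hN0, mul_one, ← hcard]
    calc ∑ y, g h y ≤ ∑ y : Fin n → ZMod p, (1 : ℝ) := Finset.sum_le_sum fun y _ => hg1 h y
      _ = _ := by simp
  set d : (Fin n → ZMod p) → (Fin n → ZMod p) → ℝ := fun h y => g h y - a h with hd
  have hd1 : ∀ h y, |d h y| ≤ 1 := by
    intro h y
    rw [abs_le]
    constructor <;> simp only [hd] <;> linarith [hg0 h y, hg1 h y, ha0 h, ha1 h]
  have hdsum : ∀ h, ∑ y, d h y = 0 := by
    intro h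
    simp only [hd, Finset.sum_sub_distrib, Finset.sum_const, Finset.card_univ, nsmul_eq_mul, hcard,
      ha]
    rw [mul_inv_cancel_left₀ hN0.ne', sub_self]
  have hpair : ∀ h h', ∑ N : Matrix (Fin n) (Fin n) (ZMod p), d h (N *ᵥ h) * d h' (N *ᵥ h') ≤
      if h ∈ Submodule.span (ZMod p) {h'} then
        (Fintype.card (Matrix (Fin n) (Fin n) (ZMod p)) : ℝ) else 0 := by
    intro h h'
    split_ifs with hh
    · calc _ ≤ ∑ N : Matrix (Fin n) (Fin n) (ZMod p), (1 : ℝ) := by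
            refine Finset.sum_le_sum fun N _ => (le_abs_self _).trans ?_
            rw [abs_mul]
            exact mul_le_one₀ (hd1 _ _) (abs_nonneg _) (hd1 _ _)
        _ = _ := by simp
    · exact (sum_matrix_mul_eq_zero hh _ _ (hdsum h)).le
  have hexp : ∀ N : Matrix (Fin n) (Fin n) (ZMod p),
      (∑ h, g h (N *ᵥ h) - ((p : ℝ) ^ n)⁻¹ * ∑ h, ∑ y, g h y) ^ 2 =
      ∑ h, ∑ h', d h (N *ᵥ h) * d h' (N *ᵥ h') := by
    intro N
    rw [Finset.mul_sum, ← Finset.sum_sub_distrib, sq, Finset.sum_mul_sum]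
  simp only [hexp]
  calc _ = ∑ h', ∑ h, ∑ N : Matrix (Fin n) (Fin n) (ZMod p), d h (N *ᵥ h) * d h' (N *ᵥ h') := by
        rw [Finset.sum_comm' (t' := Finset.univ) (s' := fun _ => Finset.univ) (by simp)]
        rw [Finset.sum_comm (f := fun h' h => ∑ N : Matrix (Fin n) (Fin n) (ZMod p),
          d h (N *ᵥ h) * d h' (N *ᵥ h'))]
        exact Finset.sum_congr rfl fun h _ => Finset.sum_comm
    _ ≤ ∑ h' : Fin n → ZMod p, ∑ h, if h ∈ Submodule.span (ZMod p) {h'} then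
        (Fintype.card (Matrix (Fin n) (Fin n) (ZMod p)) : ℝ) else 0 :=
        Finset.sum_le_sum fun h' _ => Finset.sum_le_sum fun h _ => hpair h h'
    _ ≤ ∑ h' : Fin n → ZMod p,
        p * (Fintype.card (Matrix (Fin n) (Fin n) (ZMod p)) : ℝ) := by
        refine Finset.sum_le_sum fun h' _ => ?_
        rw [← Finset.sum_filter, Finset.sum_const, nsmul_eq_mul]
        gcongr
        exact card_span_singleton_le h'
    _ = _ := by
        rw [Finset.sum_const, Finset.card_univ, nsmul_eq_mul, hcard]
        ring

/-- A subspace `H` of `𝔽ₚⁿ × 𝔽ₚⁿ` is a union of fibres `{h} × (L h + H₀)`, and `H₀` is the image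
of a linear projection. -/
lemma exists_fibre_maps (H : Submodule (ZMod p) ((Fin n → ZMod p) × (Fin n → ZMod p))) :
    ∃ (L ρ : (Fin n → ZMod p) →ₗ[ZMod p] (Fin n → ZMod p)),
      (∀ h, (∃ y, (h, y) ∈ H) → (h, L h) ∈ H) ∧ (∀ y, ((0 : Fin n → ZMod p), ρ y) ∈ H) ∧
      ∀ y, ((0 : Fin n → ZMod p), y) ∈ H → ρ y = y := by
  let π : H →ₗ[ZMod p] (Fin n → ZMod p) := (LinearMap.fst (ZMod p) _ _).comp H.subtype
  obtain ⟨σ, hσ⟩ := π.rangeRestrict.exists_rightInverse_of_surjective π.range_rangeRestrict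
  obtain ⟨L, hL⟩ := LinearMap.exists_extend
    (((LinearMap.snd (ZMod p) (Fin n → ZMod p) (Fin n → ZMod p)).comp H.subtype).comp σ)
  let H₀ : Submodule (ZMod p) (Fin n → ZMod p) :=
    H.comap (LinearMap.inr (ZMod p) (Fin n → ZMod p) (Fin n → ZMod p))
  obtain ⟨ρ, hρ⟩ := H₀.subtype.exists_leftInverse_of_injective H₀.ker_subtype
  refine ⟨L, H₀.subtype.comp ρ, ?_, fun y => (ρ y).2, fun y hy => ?_⟩
  · rintro h ⟨y, hy⟩
    let t : LinearMap.range π := ⟨h, ⟨⟨(h, y), hy⟩, rfl⟩⟩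
    have h1 : L h = ((σ t : H) : (Fin n → ZMod p) × (Fin n → ZMod p)).2 :=
      congrArg (fun φ => φ t) hL
    have h2 : ((σ t : H) : (Fin n → ZMod p) × (Fin n → ZMod p)).1 = h :=
      congrArg Subtype.val (congrArg (fun φ => φ t) hσ)
    have h3 : (h, L h) = ((σ t : H) : (Fin n → ZMod p) × (Fin n → ZMod p)) := by
      rw [h1]
      exact Prod.ext h2.symm rfl
    rw [h3]
    exact (σ t).2
  · have := congrArg (fun φ => φ (⟨y, hy⟩ : H₀)) hρ
    exact congrArg Subtype.val this

open scoped Classical in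
/-- The mean mass of the graph of `L + ρ ∘ N`, for uniformly random values of `N`. -/
lemma le_mean_fibre {H : Submodule (ZMod p) ((Fin n → ZMod p) × (Fin n → ZMod p))}
    {L ρ : (Fin n → ZMod p) →ₗ[ZMod p] (Fin n → ZMod p)}
    (hL : ∀ h, (∃ y, (h, y) ∈ H) → (h, L h) ∈ H)
    (hρ : ∀ y, ((0 : Fin n → ZMod p), ρ y) ∈ H)
    (hρ' : ∀ y, ((0 : Fin n → ZMod p), y) ∈ H → ρ y = y)
    {f : (Fin n → ZMod p) → ℂ} (hf : ∀ x, ‖f x‖ = 1) {μ R : ℝ} (hμ : 0 < μ)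
    (hmass : μ ≤ mass (derivDist f) (H : Set _)) (hcard : (Nat.card H : ℝ) ≤ R * (p : ℝ) ^ n) :
    0 < R ∧ μ ^ 2 / R * (p : ℝ) ^ n ≤
      ((p : ℝ) ^ n)⁻¹ * ∑ h, ∑ y, derivWeight f (h, L h + ρ y) := by
  set q : ℝ := (p : ℝ) ^ n with hq
  have hq0 : 0 < q := card_pow_pos p n
  set π : Finset (Fin n → ZMod p) := Finset.univ.filter fun h => (h, L h) ∈ H with hπ
  set H₀ : Finset (Fin n → ZMod p) :=
    Finset.univ.filter fun y => ((0 : Fin n → ZMod p), y) ∈ H with hH₀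
  have hmem : ∀ h u, (h, L h + u) ∈ H ↔ h ∈ π ∧ u ∈ H₀ := by
    intro h u
    simp only [hπ, hH₀, Finset.mem_filter, Finset.mem_univ, true_and]
    have hsum : (h, L h + u) = (h, L h) + ((0 : Fin n → ZMod p), u) := by simp
    constructor
    · intro hh
      have h1 := hL h ⟨_, hh⟩
      refine ⟨h1, ?_⟩
      rw [hsum] at hh
      exact (H.add_mem_iff_right h1).1 hh
    · rintro ⟨h1, h2⟩
      rw [hsum]
      exact H.add_mem h1 h2
  have hfib : ∀ F : (Fin n → ZMod p) × (Fin n → ZMod p) → ℝ,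
      ∑ v, (H : Set _).indicator F v = ∑ h ∈ π, ∑ u ∈ H₀, F (h, L h + u) := by
    intro F
    rw [Fintype.sum_prod_type, hπ, Finset.sum_filter]
    refine Finset.sum_congr rfl fun h _ => ?_
    rw [← Equiv.sum_comp (Equiv.addLeft (L h))]
    simp only [Equiv.coe_addLeft, Set.indicator_apply, SetLike.mem_coe, hmem, hπ,
      Finset.mem_filter, Finset.mem_univ, true_and]
    by_cases hh : (h, L h) ∈ H
    · simp only [hh, true_and, if_true]
      rw [← Finset.sum_filter, Finset.filter_univ_mem]
    · simp only [hh, false_and, if_false, Finset.sum_const_zero]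
  have hH₀pos : (0 : ℝ) < H₀.card := by
    have : (0 : Fin n → ZMod p) ∈ H₀ := by
      simp only [hH₀, Finset.mem_filter, Finset.mem_univ, true_and]
      exact H.zero_mem
    exact_mod_cast Finset.card_pos.2 ⟨0, this⟩
  have hcardH : (Nat.card H : ℝ) = π.card * H₀.card := by
    have := hfib (fun _ => 1)
    simp only [Set.indicator_apply, SetLike.mem_coe, Finset.sum_boole, Finset.sum_const,
      nsmul_eq_mul, mul_one] at this
    rw [← this, Nat.card_eq_fintype_card, Fintype.card_subtype]
  have hmassH : mass (derivDist f) (H : Set _) =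
      q⁻¹ * ∑ h ∈ π, ∑ u ∈ H₀, derivWeight f (h, L h + u) := by
    rw [mass, hfib]
    simp only [derivDist, Finset.mul_sum, hq]
  have hπcard : μ * q ≤ π.card := by
    rw [hmassH, inv_mul_eq_div, le_div_iff₀ hq0] at hmass
    refine hmass.trans ?_
    rw [← mul_one (π.card : ℝ), ← nsmul_eq_mul, ← Finset.sum_const]
    refine Finset.sum_le_sum fun h _ => ?_
    calc ∑ u ∈ H₀, derivWeight f (h, L h + u) ≤ ∑ u, derivWeight f (h, L h + u) :=
          Finset.sum_le_sum_of_subset_of_nonneg (Finset.subset_univ _)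
            fun _ _ _ => derivWeight_nonneg f _
      _ = ∑ y, derivWeight f (h, y) :=
          Equiv.sum_comp (Equiv.addLeft (L h)) fun y => derivWeight f (h, y)
      _ = 1 := sum_derivWeight hf h
  have hH₀card : μ * H₀.card ≤ R := by
    rw [hcardH] at hcard
    refine le_of_mul_le_mul_right ?_ hq0
    calc μ * H₀.card * q = μ * q * H₀.card := by ring
      _ ≤ π.card * H₀.card := by gcongr
      _ ≤ _ := hcard
  have hR : 0 < R := lt_of_lt_of_le (by positivity) hH₀card
  set g : (Fin n → ZMod p) → (Fin n → ZMod p) → ℝ := fun h y => derivWeight f (h, L h + ρ y)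
    with hg
  have hproj : ∀ F : (Fin n → ZMod p) → ℝ, H₀.card * ∑ y, F (ρ y) = q * ∑ u ∈ H₀, F u := by
    intro F
    have h1 : ∀ u ∈ H₀, ∑ y, F (ρ y) = ∑ y, F (ρ y + u) := by
      intro u hu
      rw [← Equiv.sum_comp (Equiv.addRight u)]
      refine Finset.sum_congr rfl fun y _ => ?_
      rw [Equiv.coe_addRight, map_add, hρ' u (by simpa [hH₀] using hu)]
    have h2 : ∀ y, ∑ u ∈ H₀, F (ρ y + u) = ∑ u ∈ H₀, F u := by
      intro y
      refine Finset.sum_equiv (Equiv.addLeft (ρ y)) (fun u => ?_) (fun u _ => rfl)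
      simp only [hH₀, Finset.mem_filter, Finset.mem_univ, true_and, Equiv.coe_addLeft]
      have : ((0 : Fin n → ZMod p), ρ y + u) = (0, ρ y) + (0, u) := by simp
      rw [this]
      exact (H.add_mem_iff_right (hρ y)).symm
    calc (H₀.card : ℝ) * ∑ y, F (ρ y) = ∑ u ∈ H₀, ∑ y, F (ρ y) := by
          rw [Finset.sum_const, nsmul_eq_mul]
      _ = ∑ u ∈ H₀, ∑ y, F (ρ y + u) := Finset.sum_congr rfl h1
      _ = ∑ y, ∑ u ∈ H₀, F (ρ y + u) := Finset.sum_comm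
      _ = ∑ y : Fin n → ZMod p, ∑ u ∈ H₀, F u := Finset.sum_congr rfl fun y _ => h2 y
      _ = _ := by
          rw [Finset.sum_const, Finset.card_univ, nsmul_eq_mul]
          simp [ZMod.card, hq]
  set ν : ℝ := μ ^ 2 / R with hν
  set a : ℝ := q⁻¹ * ∑ h, ∑ y, g h y with ha
  have hg0 : ∀ h y, 0 ≤ g h y := fun h y => derivWeight_nonneg f _
  have ha0 : 0 ≤ a := mul_nonneg (inv_nonneg.2 hq0.le) (Finset.sum_nonneg fun h _ =>
    Finset.sum_nonneg fun y _ => hg0 h y)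
  have hνa : ν * q ≤ a := by
    have h1 : ∑ h ∈ π, ∑ u ∈ H₀, derivWeight f (h, L h + u) = H₀.card * (q⁻¹ *
        ∑ h ∈ π, ∑ y, g h y) := by
      rw [Finset.mul_sum, Finset.mul_sum]
      refine Finset.sum_congr rfl fun h _ => ?_
      have := hproj fun u => derivWeight f (h, L h + u)
      simp only [hg]
      rw [mul_left_comm, this, inv_mul_cancel_left₀ hq0.ne']
    have h2 : q⁻¹ * ∑ h ∈ π, ∑ y, g h y ≤ a := by
      rw [ha]
      gcongr
      · exact fun h _ _ => Finset.sum_nonneg fun y _ => hg0 h y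
      · exact Finset.subset_univ _
    have h3 : μ * q ≤ H₀.card * a := by
      rw [hmassH, inv_mul_eq_div, le_div_iff₀ hq0] at hmass
      refine hmass.trans ?_
      rw [h1]
      gcongr
    rw [hν, div_mul_eq_mul_div, div_le_iff₀ hR]
    calc μ ^ 2 * q = μ * (μ * q) := by ring
      _ ≤ μ * (H₀.card * a) := by gcongr
      _ = (μ * H₀.card) * a := by ring
      _ ≤ R * a := mul_le_mul_of_nonneg_right hH₀card ha0
      _ = a * R := mul_comm _ _
  exact ⟨hR, hνa⟩

open scoped Classical in
/-- Concentration of the mass of the graph of `L + ρ ∘ N`, for a uniformly random matrix `N`. -/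
lemma card_le_card_filter_graph (L ρ : (Fin n → ZMod p) →ₗ[ZMod p] (Fin n → ZMod p))
    {f : (Fin n → ZMod p) → ℂ} (hf : ∀ x, ‖f x‖ = 1) {ν : ℝ} (hν0 : 0 < ν)
    (hν : ν * (p : ℝ) ^ n ≤ ((p : ℝ) ^ n)⁻¹ * ∑ h, ∑ y, derivWeight f (h, L h + ρ y)) :
    (Fintype.card (Matrix (Fin n) (Fin n) (ZMod p)) : ℝ) / 2 ≤
      (Finset.univ.filter fun N : Matrix (Fin n) (Fin n) (ZMod p) => ν ^ 2 / (8 * p) ≤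
        ((p : ℝ) ^ n)⁻¹ * ∑ h, derivWeight f (h, L h + ρ (N *ᵥ h))).card := by
  set q : ℝ := (p : ℝ) ^ n with hq
  have hq0 : 0 < q := card_pow_pos p n
  have hp1 : (1 : ℝ) ≤ p := by exact_mod_cast (Fact.out : p.Prime).one_lt.le
  set g : (Fin n → ZMod p) → (Fin n → ZMod p) → ℝ := fun h y => derivWeight f (h, L h + ρ y)
    with hg
  have hg0 : ∀ h y, 0 ≤ g h y := fun h y => derivWeight_nonneg f _
  have hg1 : ∀ h y, g h y ≤ 1 := fun h y => derivWeight_le_one hf _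
  set a : ℝ := q⁻¹ * ∑ h, ∑ y, g h y with ha
  have hνa : ν * q ≤ a := hν
  have hν1 : ν ≤ 1 := by
    have h1 : a ≤ q := by
      rw [ha, inv_mul_le_iff₀ hq0]
      calc ∑ h, ∑ y, g h y ≤ ∑ h : Fin n → ZMod p, ∑ y : Fin n → ZMod p, (1 : ℝ) :=
            Finset.sum_le_sum fun h _ => Finset.sum_le_sum fun y _ => hg1 h y
        _ = q * q := by simp [ZMod.card, hq]
    nlinarith
  have hcMat : (0 : ℝ) < Fintype.card (Matrix (Fin n) (Fin n) (ZMod p)) := by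
    exact_mod_cast Fintype.card_pos
  by_cases hsmall : ν ^ 2 / (8 * p) ≤ q⁻¹
  · rw [Finset.filter_true_of_mem, Finset.card_univ]
    · linarith
    · intro N _
      refine hsmall.trans (le_mul_of_one_le_right (inv_nonneg.2 hq0.le) ?_)
      have h0 : derivWeight f ((0 : Fin n → ZMod p), L 0 + ρ (N *ᵥ 0)) = 1 := by
        rw [Matrix.mulVec_zero, map_zero, map_zero, add_zero]
        exact derivWeight_zero hf
      rw [← h0]
      exact Finset.single_le_sum (f := fun h => derivWeight f (h, L h + ρ (N *ᵥ h)))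
        (fun h _ => derivWeight_nonneg f _) (Finset.mem_univ 0)
  · push Not at hsmall
    have hvar := sum_matrix_sq_le g hg0 hg1
    rw [← hq, ← ha] at hvar
    set bad := Finset.univ.filter fun N : Matrix (Fin n) (Fin n) (ZMod p) =>
      ¬ ν ^ 2 / (8 * p) ≤ q⁻¹ * ∑ h, derivWeight f (h, L h + ρ (N *ᵥ h)) with hbad
    have hbadle : (bad.card : ℝ) * (ν * q / 2) ^ 2 ≤
        Fintype.card (Matrix (Fin n) (Fin n) (ZMod p)) * (p * q) := by
      refine le_trans ?_ hvar
      calc (bad.card : ℝ) * (ν * q / 2) ^ 2 = ∑ N ∈ bad, (ν * q / 2) ^ 2 := by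
            rw [Finset.sum_const, nsmul_eq_mul]
        _ ≤ ∑ N ∈ bad, (∑ h, g h (N *ᵥ h) - a) ^ 2 := by
            refine Finset.sum_le_sum fun N hN => ?_
            have h1 := not_le.1 (Finset.mem_filter.1 hN).2
            rw [inv_mul_lt_iff₀ hq0] at h1
            have h2 : ν ^ 2 / (8 * p) ≤ ν / 2 := by
              rw [div_le_div_iff₀ (by positivity) (by norm_num)]
              nlinarith
            have h3 : ∑ h, g h (N *ᵥ h) ≤ ν * q / 2 := by
              refine h1.le.trans ?_
              nlinarith
            have h4 : 0 < ν * q := by positivity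
            rw [sq_le_sq, abs_of_nonneg (by positivity), abs_of_nonpos (by linarith)]
            linarith
        _ ≤ _ := Finset.sum_le_sum_of_subset_of_nonneg (Finset.subset_univ _)
            fun _ _ _ => sq_nonneg _
    have hbad2 : (bad.card : ℝ) ≤ Fintype.card (Matrix (Fin n) (Fin n) (ZMod p)) / 2 := by
      rw [inv_lt_comm₀ hq0 (by positivity), inv_div, div_lt_iff₀ (by positivity)] at hsmall
      have hpos : (0 : ℝ) < ν ^ 2 * q ^ 2 := by positivity
      refine le_of_mul_le_mul_right ?_ hpos
      calc (bad.card : ℝ) * (ν ^ 2 * q ^ 2) = 4 * ((bad.card : ℝ) * (ν * q / 2) ^ 2) := by ring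
        _ ≤ 4 * (Fintype.card (Matrix (Fin n) (Fin n) (ZMod p)) * (p * q)) := by gcongr
        _ = Fintype.card (Matrix (Fin n) (Fin n) (ZMod p)) / 2 * (8 * p * q) := by ring
        _ ≤ Fintype.card (Matrix (Fin n) (Fin n) (ZMod p)) / 2 * (q * ν ^ 2 * q) := by gcongr
        _ = _ := by ring
    have htot := Finset.card_filter_add_card_filter_not (s := Finset.univ)
      (fun N : Matrix (Fin n) (Fin n) (ZMod p) =>
        ν ^ 2 / (8 * p) ≤ q⁻¹ * ∑ h, derivWeight f (h, L h + ρ (N *ᵥ h)))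
    rw [Finset.card_univ, ← hbad] at htot
    have htot' : (Finset.card (Finset.univ.filter fun N : Matrix (Fin n) (Fin n) (ZMod p) =>
        ν ^ 2 / (8 * p) ≤ q⁻¹ * ∑ h, derivWeight f (h, L h + ρ (N *ᵥ h))) : ℝ) + bad.card =
        Fintype.card (Matrix (Fin n) (Fin n) (ZMod p)) := by
      rw [← Nat.cast_add]
      exact congrArg Nat.cast htot
    linarith

open scoped Classical in
/-- A subspace `H` determines a random matrix, as a function of a uniformly random one, whose graph
is likely to carry a definite part of the mass of `H`. -/
theorem exists_randomMatrix (H : Submodule (ZMod p) ((Fin n → ZMod p) × (Fin n → ZMod p))) :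
    ∃ T : Matrix (Fin n) (Fin n) (ZMod p) → Matrix (Fin n) (Fin n) (ZMod p),
      ∀ f : (Fin n → ZMod p) → ℂ, (∀ x, ‖f x‖ = 1) → ∀ μ R : ℝ, 0 < μ →
        μ ≤ mass (derivDist f) (H : Set _) → (Nat.card H : ℝ) ≤ R * (p : ℝ) ^ n →
        (Fintype.card (Matrix (Fin n) (Fin n) (ZMod p)) : ℝ) / 2 ≤
          (Finset.univ.filter fun N => (μ ^ 2 / R) ^ 2 / (8 * p) ≤
            ((p : ℝ) ^ n)⁻¹ * ∑ h, derivWeight f (h, T N *ᵥ h)).card := by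
  obtain ⟨L, ρ, hL, hρ, hρ'⟩ := exists_fibre_maps H
  refine ⟨fun N => LinearMap.toMatrix' L + LinearMap.toMatrix' ρ * N,
    fun f hf μ R hμ hmass hcard => ?_⟩
  have hT : ∀ (N : Matrix (Fin n) (Fin n) (ZMod p)) h,
      (LinearMap.toMatrix' L + LinearMap.toMatrix' ρ * N) *ᵥ h = L h + ρ (N *ᵥ h) := by
    intro N h
    rw [Matrix.add_mulVec, ← Matrix.mulVec_mulVec, LinearMap.toMatrix'_mulVec,
      LinearMap.toMatrix'_mulVec]
  simp only [hT]
  obtain ⟨hR, hmean⟩ := le_mean_fibre hL hρ hρ' hf hμ hmass hcard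
  exact card_le_card_filter_graph L ρ hf (by positivity) hmean

end RandomMap

/-! ### Sampling with the phase oracle -/

section PhaseSampling

variable {p n : ℕ} [Fact p.Prime]

/-- The regrouping of a measurement outcome into a sample of `derivDist` and a random matrix. -/
def regroupPhase (p n : ℕ) :
    (Fin n → ZMod p) × ((Fin n → ZMod p) × Matrix (Fin n) (Fin n) (ZMod p)) ≃
      ((Fin n → ZMod p) × (Fin n → ZMod p)) × Matrix (Fin n) (Fin n) (ZMod p) where
  toFun r := ((r.2.1, r.1), r.2.2)
  invFun t := (t.1.2, (t.1.1, t.2))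
  left_inv _ := rfl
  right_inv _ := rfl

/-- The uniform distribution on matrices. -/
def uniformMatrix (p n : ℕ) [Fact p.Prime] (_ : Matrix (Fin n) (Fin n) (ZMod p)) : ℝ :=
  (Fintype.card (Matrix (Fin n) (Fin n) (ZMod p)) : ℝ)⁻¹

lemma uniformMatrix_nonneg (N : Matrix (Fin n) (Fin n) (ZMod p)) : 0 ≤ uniformMatrix p n N :=
  inv_nonneg.2 (Nat.cast_nonneg _)

lemma sum_uniformMatrix : ∑ N, uniformMatrix p n N = 1 := by
  simp only [uniformMatrix, Finset.sum_const, Finset.card_univ, nsmul_eq_mul]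
  exact mul_inv_cancel₀ (by exact_mod_cast Fintype.card_ne_zero)

lemma sum_norm_sq_single (x : Fin n → ZMod p) :
    ∑ y, ‖(Pi.single x 1 : (Fin n → ZMod p) → ℂ) y‖ ^ 2 = 1 := by
  rw [Finset.sum_eq_single x] <;> simp +contextual

lemma phaseOracle_mulVec_single (f : (Fin n → ZMod p) → ℂ) (x : Fin n → ZMod p) :
    phaseOracle f *ᵥ Pi.single x 1 = f x • (Pi.single x 1 : (Fin n → ZMod p) → ℂ) := by
  ext y
  by_cases hxy : y = x
  · subst hxy
    simp [phaseOracle, Matrix.mulVec_diagonal]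
  · simp [phaseOracle, Matrix.mulVec_diagonal, hxy]

lemma conj_eq_pow {z : ℂ} (hz : ‖z‖ = 1) (hzp : z ^ p = 1) : starRingEnd ℂ z = z ^ (p - 1) := by
  have h0 : z ≠ 0 := fun h0 => by simp [h0] at hz
  refine mul_left_cancel₀ h0 ?_
  rw [← pow_succ', Nat.sub_add_cancel (Fact.out : p.Prime).one_lt.le, hzp, Complex.mul_conj', hz]
  norm_num

/-- With `p` queries to a phase oracle per sample, one obtains independent samples from
`derivDist` and uniformly random matrices. -/
theorem exists_phaseSampling {R : Type} (m : ℕ)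
    (out : (Fin m → (Fin n → ZMod p) × (Fin n → ZMod p)) →
      (Fin m → Matrix (Fin n) (Fin n) (ZMod p)) → R) :
    ∃ A : QueryAlgorithm (Fin n → ZMod p) R, A.queries = m * p ∧
      ∀ f : (Fin n → ZMod p) → ℂ, (∀ x, ‖f x‖ = 1) → (∀ x, f x ^ p = 1) → ∀ (S : Set R)
        (good : Set (Fin m → (Fin n → ZMod p) × (Fin n → ZMod p))) (a b : ℝ), 0 ≤ b →
        a ≤ iidProb (derivDist f) m good →
        (∀ s ∈ good, b ≤ iidProb (uniformMatrix p n) m {c | out s c ∈ S}) →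
        a * b ≤ A.prob (phaseOracle f) S := by
  have hp : p - 1 + 1 = p := Nat.sub_add_cancel (Fact.out : p.Prime).one_lt.le
  obtain ⟨A, hA, h⟩ := exists_fourierSampling (p := p) (k := n)
    (Z := (Fin n → ZMod p) × Matrix (Fin n) (Fin n) (ZMod p)) (κ := Option (Fin (p - 1)))
    (X := Fin n → ZMod p) (fun x => Pi.single x 1) sum_norm_sq_single 0
    (fun j r => j.elim (r.1 + r.2.1) fun _ => r.1) m
    (fun w => out (fun i => (regroupPhase p n (w i)).1) (fun i => (regroupPhase p n (w i)).2))
  refine ⟨A, by simpa [hp] using hA, fun f hf hfp S good a b hb ha hgood => ?_⟩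
  rw [h (phaseOracle f) f (phaseOracle_mulVec_single f) S]
  have hφ : ∀ h : Fin n → ZMod p, (fun x => ∏ j : Option (Fin (p - 1)),
      f (j.elim (x + h) fun _ => x)) = mulDeriv h f := by
    intro h
    ext x
    rw [Fintype.prod_option, mulDeriv, conj_eq_pow (hf x) (hfp x)]
    simp
  have hD : ∀ r : (Fin n → ZMod p) × ((Fin n → ZMod p) × Matrix (Fin n) (Fin n) (ZMod p)),
      (Fintype.card ((Fin n → ZMod p) × Matrix (Fin n) (Fin n) (ZMod p)) : ℝ)⁻¹ *
        ‖fourierCoeff (mulDeriv r.2.1 f) r.1‖ ^ 2 =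
      derivDist f (regroupPhase p n r).1 * uniformMatrix p n (regroupPhase p n r).2 := by
    intro r
    simp only [regroupPhase, Equiv.coe_fn_mk, derivDist, derivWeight, uniformMatrix]
    rw [Fintype.card_prod, Fintype.card_fun, ZMod.card, Fintype.card_fin]
    push_cast
    rw [mul_inv]
    ring
  simp only [hφ, hD]
  exact mul_le_iidProb_of_equiv (regroupPhase p n)
    (D := fun r => derivDist f (regroupPhase p n r).1 * uniformMatrix p n (regroupPhase p n r).2)
    (fun _ => rfl) (derivDist_nonneg f) {t | out t.1 t.2 ∈ S} good hb ha uniformMatrix_nonneg hgood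

open scoped Classical in
/-- The algorithm of the core lemma, as a function of the samples. -/
theorem exists_matrixAlgorithm (p n m : ℕ) [Fact p.Prime] (θ R : ℝ) :
    ∃ A : QueryAlgorithm (Fin n → ZMod p) (Matrix (Fin n) (Fin n) (ZMod p)),
      A.queries = m * p ∧ (0 < θ → θ ≤ 1 → 8 * ((n : ℝ) + 1) ≤ θ * m → 128 ≤ m * θ ^ 2 →
        ∀ f : (Fin n → ZMod p) → ℂ, (∀ x, ‖f x‖ = 1) → (∀ x, f x ^ p = 1) →
        (∃ H : Submodule (ZMod p) ((Fin n → ZMod p) × (Fin n → ZMod p)),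
          θ ≤ mass (derivDist f) (H : Set _) ∧ (Nat.card H : ℝ) ≤ R * (p : ℝ) ^ n) →
        1 / 4 ≤ A.prob (phaseOracle f) {M | (Real.exp (-(24 / θ)) ^ 2 / R) ^ 2 / (8 * p) ≤
          ((p : ℝ) ^ n)⁻¹ * ∑ h, derivWeight f (h, M *ᵥ h)}) := by
  choose T hT using exists_randomMatrix (p := p) (n := n)
  let subspace : (Fin m → (Fin n → ZMod p) × (Fin n → ZMod p)) →
      Submodule (ZMod p) ((Fin n → ZMod p) × (Fin n → ZMod p)) :=
    fun s => Classical.epsilon fun H => (Nat.card H : ℝ) ≤ R * (p : ℝ) ^ n ∧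
      θ * m / 2 < (Nat.card {i | s i ∈ H} : ℝ)
  obtain ⟨A, hA, h⟩ := exists_phaseSampling (p := p) (n := n) m
    (fun s c => if hm : 0 < m then T (subspace s) (c ⟨0, hm⟩) else 0)
  refine ⟨A, hA, fun hθ₀ hθ hm hm2 f hf hfp ⟨H, hH, hHcard⟩ => ?_⟩
  have hn : (0 : ℝ) ≤ n := Nat.cast_nonneg n
  have hm0 : 0 < m := by
    rcases Nat.eq_zero_or_pos m with rfl | h0
    · norm_num at hm2
    · exact h0
  have hexp : 2 * Real.exp (-(m * θ ^ 2 / 64)) ≤ 1 / 2 := by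
    have h2 : (4 : ℝ) ≤ Real.exp 2 := by
      have h1 : (2 : ℝ) ≤ Real.exp 1 := by linarith [Real.add_one_le_exp (1 : ℝ)]
      calc (4 : ℝ) = 2 * 2 := by norm_num
        _ ≤ Real.exp 1 * Real.exp 1 := by gcongr
        _ = Real.exp 2 := by rw [← Real.exp_add]; norm_num
    have h3 : Real.exp (-(m * θ ^ 2 / 64)) ≤ Real.exp (-2) :=
      Real.exp_le_exp.2 (by linarith)
    have h4 : Real.exp (-2) ≤ 1 / 4 := by
      rw [Real.exp_neg, ← one_div]
      exact one_div_le_one_div_of_le (by norm_num) h2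
    linarith
  have hmain := h f hf hfp {M | (Real.exp (-(24 / θ)) ^ 2 / R) ^ 2 / (8 * p) ≤
    ((p : ℝ) ^ n)⁻¹ * ∑ h, derivWeight f (h, M *ᵥ h)} _ _ (1 / 2) (by norm_num)
    (le_iidProb_subspace (p := p) (derivDist_nonneg f)
      (sum_derivDist hf) hθ₀ hθ (by linarith)
      (by
        simp only [Module.finrank_prod, Module.finrank_fin_fun]
        push_cast
        linarith) H hH) (by
      rintro s ⟨hs1, hs2⟩
      obtain ⟨hH1, hH2⟩ : (Nat.card (subspace s) : ℝ) ≤ R * (p : ℝ) ^ n ∧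
          θ * m / 2 < (Nat.card {i | s i ∈ subspace s} : ℝ) :=
        Classical.epsilon_spec
          (p := fun H : Submodule (ZMod p) ((Fin n → ZMod p) × (Fin n → ZMod p)) =>
            (Nat.card H : ℝ) ≤ R * (p : ℝ) ^ n ∧ θ * m / 2 < (Nat.card {i | s i ∈ H} : ℝ))
          ⟨H, hHcard, hs1⟩
      have hcount := hT (subspace s) f hf _ R (Real.exp_pos _) (hs2 _ hH2) hH1
      simp only [hm0, dif_pos]
      have heq := iidProb_eval (m := m) (sum_uniformMatrix (p := p) (n := n)) ⟨0, hm0⟩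
        {N | (Real.exp (-(24 / θ)) ^ 2 / R) ^ 2 / (8 * p) ≤
          ((p : ℝ) ^ n)⁻¹ * ∑ h, derivWeight f (h, T (subspace s) N *ᵥ h)}
      refine le_trans ?_ heq.ge
      simp only [Set.indicator_apply, uniformMatrix, Set.mem_ofPred_eq]
      rw [← Finset.sum_filter, Finset.sum_const, nsmul_eq_mul, ← div_eq_mul_inv,
        le_div_iff₀ (by exact_mod_cast Fintype.card_pos)]
      linarith)
  refine le_trans ?_ hmain
  linarith

end PhaseSampling

/-! ### The core lemma -/

section Core

variable {p n : ℕ} [Fact p.Prime]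

lemma IsPolynomialPhase.norm_eq_one {f : (Fin n → ZMod p) → ℂ} (hf : IsPolynomialPhase f) (x) :
    ‖f x‖ = 1 := by
  obtain ⟨P, -, hP⟩ := hf
  rw [hP, norm_stdAddChar]

lemma IsPolynomialPhase.pow_eq_one {f : (Fin n → ZMod p) → ℂ} (hf : IsPolynomialPhase f) (x) :
    f x ^ p = 1 := by
  obtain ⟨P, -, hP⟩ := hf
  rw [hP, ← AddChar.map_nsmul_eq_pow]
  simp

lemma gowersAverage_three_nonneg (f : (Fin n → ZMod p) → ℂ) : 0 ≤ (gowersAverage 3 f).re := by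
  rw [gowersAverage_three]
  exact mul_nonneg (inv_nonneg.2 (card_pow_pos p n).le) (Finset.sum_nonneg fun _ _ => sq_nonneg _)

lemma pow_le_gowersAverage_three {f : (Fin n → ZMod p) → ℂ} {γ : ℝ} (hγ : 0 < γ)
    (h : γ ≤ gowersNorm 3 f) : γ ^ 8 ≤ (gowersAverage 3 f).re := by
  calc γ ^ 8 ≤ gowersNorm 3 f ^ 8 := by gcongr
    _ = (gowersAverage 3 f).re := by
      rw [gowersNorm, ← Real.rpow_natCast, ← Real.rpow_mul (gowersAverage_three_nonneg f)]
      norm_num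

lemma gowersAverage_three_le_one {f : (Fin n → ZMod p) → ℂ} (hf : ∀ x, ‖f x‖ = 1) :
    (gowersAverage 3 f).re ≤ 1 := by
  have hN := card_pow_pos p n
  rw [gowersAverage_three, inv_mul_le_iff₀ hN, mul_one, ← sum_derivWeight_univ hf]
  refine Finset.sum_le_sum fun v _ => ?_
  rw [sq]
  exact mul_le_of_le_one_left (derivWeight_nonneg f v) (derivWeight_le_one hf v)

lemma expect_eq_sum_derivWeight (f : (Fin n → ZMod p) → ℂ)
    (M : Matrix (Fin n) (Fin n) (ZMod p)) :
    (Finset.expect Finset.univ fun h : Fin n → ZMod p =>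
      ‖fourierCoeff (mulDeriv h f) (M *ᵥ h)‖ ^ 2) =
      ((p : ℝ) ^ n)⁻¹ * ∑ h, derivWeight f (h, M *ᵥ h) := by
  rw [expect_eq_inv_mul_sum_real]
  rfl

/-- Finding a matrix `M` with large `𝔼_h |(Δ_h f)^(M h)|²`, for `f` with large `U³` norm. -/
theorem exists_core (p : ℕ) [Fact p.Prime] : ∃ K : ℕ, 0 < K ∧ ∀ γ : ℝ, 0 < γ → ∀ n : ℕ,
    ∃ A : QueryAlgorithm (Fin n → ZMod p) (Matrix (Fin n) (Fin n) (ZMod p)),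
      (2 ≤ n → (A.queries : ℝ) ≤ K * (1 / γ) ^ K * (n * Real.log n)) ∧
      ∀ f : (Fin n → ZMod p) → ℂ, IsPolynomialPhase f → γ ≤ gowersNorm 3 f →
        γ ^ K / K ≤ A.prob (phaseOracle f)
          {M | Real.exp (-(K * (1 / γ) ^ K)) ≤
            Finset.expect Finset.univ fun h : Fin n → ZMod p =>
              ‖fourierCoeff (mulDeriv h f) (M *ᵥ h)‖ ^ 2} := by
  obtain ⟨c, hc⟩ : ∃ c : ℕ, c = 65536 * 8 ^ 10 := ⟨_, rfl⟩
  set K : ℕ := 960 + 12288 + 2 * p * (c ^ 5 + 1) + 4 * c + 8 * p + 3 * p * (129 * 128 ^ 2) with hK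
  have hp1 : (1 : ℝ) ≤ p := by exact_mod_cast (Fact.out : p.Prime).one_lt.le
  have hc1 : (1 : ℝ) ≤ c := by
    rw [hc]
    norm_num
  have hcK : 12288 + 2 * (p : ℝ) * ((c : ℝ) ^ 5 + 1) + 4 * c + 8 * p ≤ K := by
    rw [hK]
    push_cast
    have : (0 : ℝ) ≤ 3 * p * (129 * 128 ^ 2) := by positivity
    linarith
  have hqK : 3 * (p : ℝ) * (129 * 128 ^ 2) ≤ K := by
    rw [hK]
    push_cast
    have : (0 : ℝ) ≤ 2 * (p : ℝ) * ((c : ℝ) ^ 5 + 1) := by positivity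
    have : (0 : ℝ) ≤ 4 * c + 8 * p := by positivity
    linarith
  have hK960 : 960 ≤ K := by omega
  clear_value K
  refine ⟨K, by omega, fun γ hγ n => ?_⟩
  have hn0 : (0 : ℝ) ≤ n := Nat.cast_nonneg n
  rcases lt_or_ge 1 γ with hγ1 | hγ1
  · obtain ⟨A, hA, -⟩ := exists_matrixAlgorithm p n 0 0 0
    refine ⟨A, fun hn => ?_, fun f hf hU => ?_⟩
    · rw [hA, zero_mul, Nat.cast_zero]
      have : (1 : ℝ) ≤ n := by exact_mod_cast (by omega : 1 ≤ n)
      have := Real.log_nonneg this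
      positivity
    · have h1 := pow_le_gowersAverage_three hγ hU
      have h2 := gowersAverage_three_le_one hf.norm_eq_one
      have h3 : 1 < γ ^ 8 := one_lt_pow₀ hγ1 (by norm_num)
      linarith
  set t : ℝ := 1 / γ with ht
  have ht1 : 1 ≤ t := by rw [ht]; exact one_le_one_div hγ hγ1
  have ht0 : 0 < t := by linarith
  have hγt : γ = 1 / t := by rw [ht, one_div_one_div]
  set α : ℝ := γ ^ 8 / 2 with hα
  set δ : ℝ := α ^ 2 / 2 with hδ
  set D : ℝ := 4096 / (α ^ 4 * δ ^ 10) with hD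
  set θ : ℝ := α ^ 2 * δ / 4 with hθ
  have hαt : α = 1 / (2 * t ^ 8) := by rw [hα, hγt]; field_simp
  have hδt : δ = 1 / (8 * t ^ 16) := by rw [hδ, hαt]; field_simp; norm_num
  have hDt : D = c * t ^ 192 := by
    rw [hD, hδt, hαt, hc]
    field_simp
    norm_num
  have hθt : θ = 1 / (128 * t ^ 32) := by rw [hθ, hδt, hαt]; field_simp; norm_num
  have hα0 : 0 < α := by positivity
  have hθ0 : 0 < θ := by positivity
  have hθ1 : θ ≤ 1 := by
    rw [hθt, div_le_one (by positivity)]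
    have : 1 ≤ t ^ 32 := one_le_pow₀ ht1
    linarith
  have hD0 : 0 < D := by positivity
  set r : ℕ := ⌊D ^ 5 + 1⌋₊ with hr
  set R : ℝ := (p : ℝ) ^ r * (D / α) with hR
  have hR0 : 0 < R := by positivity
  set N : ℕ := ⌈128 / θ ^ 2⌉₊ with hN
  have hNlow : 128 ≤ N * θ ^ 2 := by
    rw [← div_le_iff₀ (by positivity)]
    exact Nat.le_ceil _
  have hN8 : 8 ≤ θ * N := by
    have h1 : (N : ℝ) * θ ^ 2 ≤ N * θ := by
      gcongr
      nlinarith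
    linarith
  obtain ⟨A, hA, h⟩ := exists_matrixAlgorithm p n (N * (n + 1)) θ R
  refine ⟨A, fun hn => ?_, fun f hf hU => ?_⟩
  · have hn' : (2 : ℝ) ≤ n := by exact_mod_cast hn
    have hlog : (0.69 : ℝ) ≤ Real.log n :=
      (by linarith [Real.log_two_gt_d9] : (0.69 : ℝ) ≤ Real.log 2).trans
        (Real.log_le_log (by norm_num) hn')
    have hNup : (N : ℝ) ≤ 129 * 128 ^ 2 * t ^ K := by
      have h1 : (N : ℝ) ≤ 128 / θ ^ 2 + 1 := (Nat.ceil_lt_add_one (by positivity)).le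
      have h2 : 128 / θ ^ 2 = 128 * 128 ^ 2 * t ^ 64 := by
        rw [hθt]
        field_simp
      have h3 : t ^ 64 ≤ t ^ K := pow_le_pow_right₀ ht1 (by omega)
      have h4 : 1 ≤ t ^ K := one_le_pow₀ ht1
      rw [h2] at h1
      linarith
    rw [hA]
    push_cast
    have h5 : ((n : ℝ) + 1) ≤ 3 * (n * Real.log n) := by nlinarith
    calc (N : ℝ) * (n + 1) * p ≤ (129 * 128 ^ 2 * t ^ K) * (3 * (n * Real.log n)) * p := by
          gcongr
      _ = (3 * p * (129 * 128 ^ 2)) * t ^ K * (n * Real.log n) := by ring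
      _ ≤ K * t ^ K * (n * Real.log n) := by
          have : 0 ≤ Real.log n := by linarith
          gcongr
  · have hf1 := hf.norm_eq_one
    have hU8 := pow_le_gowersAverage_three hγ hU
    obtain ⟨H, hH, r', hr', hHcard⟩ := exists_subspace_mass hf1 hα0 hδ hD
      (by rw [hα]; linarith)
    have hrr : r' ≤ r := Nat.le_floor hr'
    have hHR : (Nat.card H : ℝ) ≤ R * (p : ℝ) ^ n := by
      refine hHcard.trans ?_
      rw [hR, mul_assoc]
      gcongr
    have hm1 : 8 * ((n : ℝ) + 1) ≤ θ * (N * (n + 1) : ℕ) := by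
      push_cast
      rw [← mul_assoc]
      exact mul_le_mul_of_nonneg_right hN8 (by linarith)
    have hm2 : 128 ≤ ((N * (n + 1) : ℕ) : ℝ) * θ ^ 2 := by
      push_cast
      rw [mul_right_comm]
      exact hNlow.trans (le_mul_of_one_le_right (by linarith) (by linarith))
    have hmain := h hθ0 hθ1 hm1 hm2 f hf1 hf.pow_eq_one ⟨H, hH, hHR⟩
    have hK0 : (0 : ℝ) < K := by exact_mod_cast (by omega : 0 < K)
    have hsucc : γ ^ K / K ≤ 1 / 4 := by
      have h1 : γ ^ K ≤ 1 := pow_le_one₀ hγ.le hγ1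
      have h2 : (4 : ℝ) ≤ K := by exact_mod_cast (by omega : 4 ≤ K)
      rw [div_le_div_iff₀ hK0 (by norm_num)]
      linarith
    refine hsucc.trans (hmain.trans ?_)
    refine Finset.sum_le_sum fun s _ => Set.indicator_le_indicator_of_subset ?_
      (fun s => sq_nonneg _) s
    intro s hs
    refine le_trans ?_ ((show (Real.exp (-(24 / θ)) ^ 2 / R) ^ 2 / (8 * p) ≤ _ from hs).trans
      (expect_eq_sum_derivWeight f _).ge)
    have hRexp : R ≤ Real.exp (p * (D ^ 5 + 1) + D / α) := by
      rw [hR, Real.exp_add]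
      have h1 : (p : ℝ) ^ r ≤ Real.exp (p * (D ^ 5 + 1)) := by
        calc (p : ℝ) ^ r ≤ Real.exp p ^ r := by
              gcongr
              linarith [Real.add_one_le_exp (p : ℝ)]
          _ = Real.exp (r * p) := by rw [← Real.exp_nat_mul]
          _ ≤ _ := by
              rw [Real.exp_le_exp, mul_comm]
              gcongr
              exact Nat.floor_le (by positivity)
      have h2 : D / α ≤ Real.exp (D / α) := by linarith [Real.add_one_le_exp (D / α)]
      gcongr
    have hpexp : 8 * (p : ℝ) ≤ Real.exp (8 * p) := by linarith [Real.add_one_le_exp (8 * (p : ℝ))]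
    have hexponent : 96 / θ + 2 * (p * (D ^ 5 + 1) + D / α) + 8 * p ≤ K * t ^ K := by
      have e1 : 96 / θ = 12288 * t ^ 32 := by rw [hθt]; field_simp; norm_num
      have e2 : D / α = 2 * c * t ^ 200 := by rw [hDt, hαt]; field_simp
      have e3 : D ^ 5 = c ^ 5 * t ^ 960 := by rw [hDt]; ring
      rw [e1, e2, e3]
      have p1 : t ^ 32 ≤ t ^ K := pow_le_pow_right₀ ht1 (by omega)
      have p2 : t ^ 200 ≤ t ^ K := pow_le_pow_right₀ ht1 (by omega)
      have p3 : t ^ 960 ≤ t ^ K := pow_le_pow_right₀ ht1 (by omega)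
      have p4 : 1 ≤ t ^ K := one_le_pow₀ ht1
      have p5 : 8 * (p : ℝ) ≤ 8 * p * t ^ K := le_mul_of_one_le_right (by positivity) p4
      have p6 : p * (c ^ 5 * t ^ 960 + 1) ≤ p * (c ^ 5 * t ^ K + 1 * t ^ K) := by
        gcongr
        linarith
      have p7 : 2 * c * t ^ 200 ≤ 2 * c * t ^ K := by gcongr
      calc 12288 * t ^ 32 + 2 * (p * (c ^ 5 * t ^ 960 + 1) + 2 * c * t ^ 200) + 8 * p
          ≤ 12288 * t ^ K + 2 * (p * (c ^ 5 * t ^ K + 1 * t ^ K) + 2 * c * t ^ K) +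
            8 * p * t ^ K := by linarith
        _ = (12288 + 2 * (p : ℝ) * ((c : ℝ) ^ 5 + 1) + 4 * c + 8 * p) * t ^ K := by ring
        _ ≤ _ := by gcongr
    rw [le_div_iff₀ (by positivity), div_pow (Real.exp (-(24 / θ)) ^ 2) R 2, ← pow_mul,
      le_div_iff₀ (by positivity)]
    calc Real.exp (-(K * t ^ K)) * (8 * p) * R ^ 2
        ≤ Real.exp (-(K * t ^ K)) * Real.exp (8 * p) *
          Real.exp (p * (D ^ 5 + 1) + D / α) ^ 2 := by gcongr
      _ = Real.exp (-(K * t ^ K) + 8 * p + 2 * (p * (D ^ 5 + 1) + D / α)) := by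
          rw [← Real.exp_nat_mul, ← Real.exp_add, ← Real.exp_add]
          push_cast
          rfl
      _ ≤ Real.exp (-(96 / θ)) := by
          rw [Real.exp_le_exp]
          linarith
      _ = Real.exp (-(24 / θ)) ^ (2 * 2) := by
          rw [← Real.exp_nat_mul]
          congr 1
          push_cast
          ring

end Core

end QuadraticDecoding

end

theorem theorem5p1p1 :
    -- decoding: from distance `1/2 - ε` to distance `1/2 - η`, where `η = exp (-1/ε^C)`
    (∃ C : ℝ, 0 < C ∧ ∀ ε : ℝ, 0 < ε →
      ∃ K : ℝ, 0 < K ∧ ∀ n : ℕ,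
        ∃ A : QuadraticDecoding.QueryAlgorithm ((Fin n → ZMod 2) × ZMod 2)
            (MvPolynomial (Fin n) (ZMod 2)),
          (2 ≤ n → (A.queries : ℝ) ≤ K * (n * Real.log n)) ∧
          ∀ f : (Fin n → ZMod 2) → ZMod 2,
            QuadraticDecoding.distRM2 f ≤ 1 / 2 - ε →
            2 / 3 ≤ A.prob (QuadraticDecoding.bitOracle f)
              {g | g.totalDegree ≤ 2 ∧
                QuadraticDecoding.relDist f (fun x => MvPolynomial.eval x g) ≤
                  1 / 2 - Real.exp (-(1 / ε ^ C))}) ∧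
    -- the core lemma, for every prime `p`
    (∀ (p : ℕ) [Fact p.Prime], ∃ K : ℕ, 0 < K ∧ ∀ γ : ℝ, 0 < γ → ∀ n : ℕ,
      ∃ A : QuadraticDecoding.QueryAlgorithm (Fin n → ZMod p) (Matrix (Fin n) (Fin n) (ZMod p)),
        (2 ≤ n → (A.queries : ℝ) ≤ K * (1 / γ) ^ K * (n * Real.log n)) ∧
        ∀ f : (Fin n → ZMod p) → ℂ,
          QuadraticDecoding.IsPolynomialPhase f →
          γ ≤ QuadraticDecoding.gowersNorm 3 f →
          γ ^ K / K ≤ A.prob (QuadraticDecoding.phaseOracle f)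
            {M | Real.exp (-(K * (1 / γ) ^ K)) ≤
              Finset.expect Finset.univ fun h : Fin n → ZMod p =>
                ‖QuadraticDecoding.fourierCoeff (QuadraticDecoding.mulDeriv h f) (M *ᵥ h)‖ ^ 2}) := by
  exact ⟨⟨6, by norm_num, fun _ hε => QuadraticDecoding.exists_quadraticDecoding hε⟩,
    fun p _ => QuadraticDecoding.exists_core p⟩
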